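/- Let $N\ge 1$, $\gamma_1,\dots,\gamma_N\in\mathbb R$, $\gamma^c\in\mathbb R\setminus\{0\}$, and $K(x)=x^\perp/|x|^2$ for $x\in\mathbb R^2\setminus\{0\}$, with $(x^1,x^2)^\perp=(-x^2,x^1)$. For a control $z:[0,T]\to\mathbb R^2$ consider the single-control system $$\dot x_i(t)=\sum_{j\ne i}\gamma_j K(x_i(t)-x_j(t))+\gamma^c K(x_i(t)-z(t)),\qquad x_i(0)=x_{0,i},\qquad i=1,\dots,N. \tag{1}$$ Solutions (of (1) and of (2) below) are said to be defined on $[0,T]$ only if on $[0,T]$ no vortex $x_i$ meets another vortex $x_j$ or a control vortex. **Reference solution.** Let $T>0$, $\bar r>0$, let $y_1,\dots,y_N\in C^\infty([0,T];\mathbb R^2)$ be reference controls and let $\bar{\boldsymbol x}=(\bar x_1,\dots,\bar x_N)$ be a solution, defined on $[0,T]$, of $$\dot{\bar x}_i=\sum_{j\ne i}\gamma_jK(\bar x_i-\bar x_j)+\frac{\gamma^c}{N}\sum_{k=1}^N K(\bar x_i-y_k),\qquad \bar x_i(0)=x_{0,i}, \tag{2}$$ such that, for all $t\in[0,T]$,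 $|y_k(t)-\bar x_j(t)|\ge 2\bar r$ for all $j,k$, and $|\bar x_i(t)-\bar x_j(t)|\ge 4\bar r$ for all $i\neq j$. **Oscillating control.** For $n\ge1$ put $\delta=T/(nN)$ and cut $[0,T]$ into the $nN$ intervals $[m\delta,(m+1)\delta]$, $0\le m<nN$; write $\hat y_m=y_{(m \bmod N)+1}$. The curve $z_n^0$ equals $\hat y_m$ on $[m\delta,(m+1)\delta]$, except that on each $[t_1,t_2]=[m\delta-\frac{\delta}{2n},m\delta+\frac{\delta}{2n}]$, $0<m<nN$, it is the transition curve from $\hat y_{m-1}(t_1)$ to $\hat y_m(t_2)$ that goes along the straight segment, circumvents each disc $B(\bar x_j(t_1),3\bar r/2)$ crossed by the segment by following its boundary circle along the shorter arc (the clockwise one if both arcs are equal), and is run at constant speed. Extend $z_n^0$ by $z_n^0(0)$ for $t<0$ and by $z_n^0(T)$ for $t>T$. For $\rho\in C_c^\infty(\mathbb R)$ with $\rho\ge0$, $\int\rho=1$, and $\rho_\varepsilon(s)=\varepsilon^{-1}\rho(s/\varepsilon)$, put $z_n=\rho_{1/n^3}*z_n^0$. (For small $n$, where an end point of a transition may lie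 inside one of the discs, nothing is claimed.) **Theorem.** There are $C>0$, depending only on $\bar r$ and $T$ (and on the fixed data $N,\gamma_1,\dots,\gamma_N,\gamma^c$ of the system), and $n_0'\ge 1$ such that for every $n\ge n_0'$ the solution $\boldsymbol x^n$ of (1) with control $z=z_n$ is defined on the whole of $[0,T]$ and $$\|\boldsymbol x^n-\bar{\boldsymbol x}\|_{C^0([0,T])}=\max_{t\in[0,T]}\Big(\sum_{i=1}^N|x_i^n(t)-\bar x_i(t)|^2\Big)^{1/2}\le\frac Cn .$$ Here $n_0'$ depends only on $\bar r$, $T$, $N$, $\gamma_1,\dots,\gamma_N$, $\gamma^c$, $\rho$ and an upper bound $M$ of $|y_k|,|\dot y_k|,|\ddot y_k|$ on $[0,T]$. Hence system (1) is approximately controllable in arbitrary time: for all $T>0$, all $(N+1)$-tuples $(x_{0,1},\dots,x_{0,N},y_0)$ and $(x_{f,1},\dots,x_{f,N},y_f)$ of distinct points of $\mathbb R^2$ and every $\varepsilon>0$ there is $z\in C^\infty([0,T];\mathbb R^2)$ with $z(0)=y_0$, $z(T)=y_f$ such that the solution of (1) is defined on $[0,T]$ and $\big(\sum_i|x_i(T)-x_{f,i}|^2\big)^{1/2}\le\varepsilon$.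 -/

import Mathlib

open Set MeasureTheory
open scoped ContDiff InnerProductSpace

noncomputable section

/-- The Euclidean plane. -/
abbrev Plane : Type := EuclideanSpace ℝ (Fin 2)

/-- Rotation by the angle `π / 2`. -/
def perp (x : Plane) : Plane := !₂[-x 1, x 0]

/-- The Biot-Savart kernel `x ↦ x^⊥ / |x|²`, used away from the origin only. -/
def biotSavart (x : Plane) : Plane := (‖x‖ ^ 2)⁻¹ • perp x

/-- The Euclidean distance of two configurations in `(ℝ²)^N`. -/
def configDist {N : ℕ} (x x' : Fin N → Plane) : ℝ := √(∑ i, ‖x i - x' i‖ ^ 2)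

/-- `x` is a solution on `[0,T]`, starting at `x₀`, of the system of `N` vortices of intensities `γ`
(the factor `1/(2π)` being incorporated in the intensities) under the action of the control vortices
`y k`, `k ∈ κ`, of intensities `c k`. That no vortex meets another one or a control vortex is part
of being defined on `[0,T]`. -/
structure IsVortexSolution {N : ℕ} {κ : Type*} [Fintype κ] (T : ℝ) (γ : Fin N → ℝ) (c : κ → ℝ)
    (y : κ → ℝ → Plane) (x₀ : Fin N → Plane) (x : ℝ → Fin N → Plane) : Prop where
  init : x 0 = x₀
  vortices_ne : ∀ t ∈ Icc 0 T, ∀ i j, i ≠ j → x t i ≠ x t j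
  control_ne : ∀ t ∈ Icc 0 T, ∀ i k, x t i ≠ y k t
  ode : ∀ t ∈ Icc 0 T, ∀ i, HasDerivWithinAt (fun s => x s i)
    ((∑ j ∈ Finset.univ.erase i, γ j • biotSavart (x t i - x t j))
      + ∑ k, c k • biotSavart (x t i - y k t)) (Icc 0 T) t

/-- Solutions of the system with the single control vortex `z` of intensity `γc`. -/
def IsSingleControlSolution {N : ℕ} (T : ℝ) (γ : Fin N → ℝ) (γc : ℝ) (z : ℝ → Plane)
    (x₀ : Fin N → Plane) (x : ℝ → Fin N → Plane) : Prop :=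
  IsVortexSolution T γ (fun _ : Unit => γc) (fun _ => z) x₀ x

/-- Solutions of the system with `N` control vortices `y 0, …, y (N-1)`, each of
intensity `γc / N`. -/
def IsReferenceSolution {N : ℕ} (T : ℝ) (γ : Fin N → ℝ) (γc : ℝ) (y : Fin N → ℝ → Plane)
    (x₀ : Fin N → Plane) (x : ℝ → Fin N → Plane) : Prop :=
  IsVortexSolution T γ (fun _ : Fin N => γc / N) y x₀ x

/-- Approximate controllability in arbitrary time of the system with one control vortex. -/
def ApproximatelyControllable {N : ℕ} (γ : Fin N → ℝ) (γc : ℝ) : Prop :=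
  ∀ T : ℝ, 0 < T → ∀ (x₀ xf : Fin N → Plane) (y₀ yf : Plane),
    Function.Injective x₀ → (∀ i, x₀ i ≠ y₀) → Function.Injective xf → (∀ i, xf i ≠ yf) →
    ∀ ε : ℝ, 0 < ε → ∃ z : ℝ → Plane, ContDiffOn ℝ ∞ z (Icc 0 T) ∧ z 0 = y₀ ∧ z T = yf ∧
      ∃ x : ℝ → Fin N → Plane, IsSingleControlSolution T γ γc z x₀ x ∧ configDist (x T) xf ≤ ε

/-! ### Transition curves -/

/-- A point `v` of a line with unit direction `e` that lies in the open disc of centre `c` and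
radius `R` is moved to the shorter of the two arcs that the line cuts off the circle (the one run
clockwise when the line passes through `c`), proportionally to its position on the chord.
Here `a` and `h` are the coordinates of `v - c` along `e` and `perp e`, the half-chord has length
`√(R² - h²)`, and the arc has opening `2 * arccos (|h| / R)`. -/
def arcPoint (e c : Plane) (R : ℝ) (v : Plane) : Plane :=
  let a : ℝ := ⟪v - c, e⟫_ℝ
  let h : ℝ := ⟪v - c, perp e⟫_ℝ
  let θ : ℝ := Real.arccos (|h| / R) * (a / √(R ^ 2 - h ^ 2))
  c + (R * Real.sin θ) • e + ((if 0 ≤ h then R else -R) * Real.cos θ) • perp e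

open Classical in
/-- The path from `p` (at `s = 0`) to `q` (at `s = 1`) along the segment, circumventing along their
boundaries the discs of centres `c j` and radius `R` that the segment crosses. -/
def detourPath {N : ℕ} (p q : Plane) (c : Fin N → Plane) (R s : ℝ) : Plane :=
  let v : Plane := p + s • (q - p)
  if H : ∃ j, ‖v - c j‖ < R then arcPoint (‖q - p‖⁻¹ • (q - p)) (c H.choose) R v else v

/-- The path `detourPath p q c R`, followed at constant speed during `[t₁,t₂]`: its parametrization
by arc length is evaluated at the fraction `(t - t₁) / (t₂ - t₁)` of its total length. -/
def transitionCurve {N : ℕ} (p q : Plane) (c : Fin N → Plane) (R t₁ t₂ t : ℝ) : Plane :=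
  naturalParameterization (detourPath p q c R) (Icc 0 1) 0
    ((t - t₁) / (t₂ - t₁) * variationOnFromTo (detourPath p q c R) (Icc 0 1) 0 1)

/-! ### The oscillating control -/

/-- The `m`-th control of the cyclic enumeration `y 0, …, y (N-1), y 0, …`. -/
def cyc {N : ℕ} [NeZero N] (y : Fin N → ℝ → Plane) (m : ℕ) : ℝ → Plane := y (Fin.ofNat N m)

/-- The continuous oscillating control. The interval `[0,T]` is divided into `n * N` slots
`[m * δ, (m + 1) * δ]`, `0 ≤ m < n * N`, of length `δ = T / (n * N)`. The control follows
`y (m mod N)` in slot number `m`, except for times within `δ / (2 n)` of an interior grid point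
`m * δ`, `0 < m < n * N`, where it follows the transition curve from `y (m - 1 mod N)` to
`y (m mod N)`, which avoids the discs of radius `3 r / 2` around the points `x̄ j` taken at the
beginning of the transition. It is extended by constants outside of `[0,T]`. -/
def oscControl {N : ℕ} [NeZero N] (T r : ℝ) (y : Fin N → ℝ → Plane) (xb : ℝ → Fin N → Plane)
    (n : ℕ) (t' : ℝ) : Plane :=
  let t : ℝ := max 0 (min t' T)
  let δ : ℝ := T / (n * N)
  let m : ℕ := ⌊t / δ + 1 / 2⌋₊ -- the grid point `m * δ` is the closest to `t`
  let t₁ : ℝ := m * δ - δ / (2 * n)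
  let t₂ : ℝ := m * δ + δ / (2 * n)
  if 0 < m ∧ m < n * N ∧ t ∈ Icc t₁ t₂ then
    transitionCurve (cyc y (m - 1) t₁) (cyc y m t₂) (xb t₁) (3 * r / 2) t₁ t₂ t
  else
    cyc y (min ⌊t / δ⌋₊ (n * N - 1)) t

/-- The rescaled mollifier `ρ_ε(s) = ρ(s / ε) / ε`. -/
def rescale (ρ : ℝ → ℝ) (ε s : ℝ) : ℝ := ε⁻¹ * ρ (s / ε)

/-- The mollified oscillating control `z_n = ρ_{1/n³} * z_n⁰`. -/
def mollControl {N : ℕ} [NeZero N] (T r : ℝ) (ρ : ℝ → ℝ) (y : Fin N → ℝ → Plane)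
    (xb : ℝ → Fin N → Plane) (n : ℕ) : ℝ → Plane :=
  convolution (rescale ρ (1 / (n : ℝ) ^ 3)) (oscControl T r y xb n)
    (ContinuousLinearMap.lsmul ℝ ℝ) volume

end

noncomputable section

/-! ### The Biot-Savart kernel -/

/-! Stability. Along the reference trajectory the single-control field differs from the reference
field by a discrepancy that is of order one at each time, but whose integral over `[0,t]` is small
uniformly in `t`. Adding the integrated discrepancy to the difference of two trajectories leaves a
function to which Grönwall's inequality applies, so only that integral matters
(`exists_solution_near`). The kernel is cut off near its singularity to get a global solution;
closeness to the reference shows afterwards that the cut-off is never active.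

Averaging. The discrepancy is `-γc` times `K(x̄ᵢ - z)` minus the mean of the `K(x̄ᵢ - yₖ)`. Over one
period of `N` slots, the integral over slot `k` is the mean share plus a constant `cₖ` times the
increment of `K(x̄ᵢ - yₖ)` over the period, up to second-order terms. As `cₖ` is the same in all
periods, these first-order terms telescope to boundary terms bounded by the size `1/r` of the kernel
(`norm_integral_sub_mean_le`). The remaining dependence on the bound `M` of the controls has order
`1/n²`, or is otherwise absorbed by taking `n` large; hence `C` does not depend on `M`.

Geometry. Replacing a chord by the shorter arc lengthens it by a factor at most `π/2`, so the
transitions have speed `O(n²)`, and mollifying at scale `1/n³` moves the control by `O(1/n)` only.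
The transitions occupy a fraction `O(1/n)` of the time, and the vortices move little during each of
them, so the control stays away from the vortices.

Controllability. Parabolic paths with a common bending parameter join the two configurations without
collisions, and a fast circular motion common to all vortices makes every speed large. For large
speeds, controls realizing the trajectory are found close to the vortices by a contraction argument
(`exists_reference_controls`), based on the identity `K(K(x)) = -x`. These controls are Lipschitz,
which suffices for the averaging without a rate independent of `M`. The oscillating control is then
given the prescribed end points and smoothed, at a small cost in the integrated discrepancy
(`exists_smooth_control`). -/

theorem perp_sub (x y : Plane) : perp (x - y) = perp x - perp y := by
  ext i; fin_cases i <;> simp [perp]; ring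

theorem perp_smul (a : ℝ) (x : Plane) : perp (a • x) = a • perp x := by
  ext i; fin_cases i <;> simp [perp]

theorem norm_perp (x : Plane) : ‖perp x‖ = ‖x‖ := by
  simp [EuclideanSpace.norm_eq, perp, Fin.sum_univ_two, add_comm]

theorem inner_perp_self (x : Plane) : ⟪x, perp x⟫_ℝ = 0 := by
  simp [perp, PiLp.inner_apply, Fin.sum_univ_two]; ring

theorem continuous_perp : Continuous perp :=
  (LipschitzWith.of_dist_le_mul (K := 1) fun x y => by
    simp [dist_eq_norm, ← perp_sub, norm_perp]).continuous

/-- The plane as the complex line. -/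
def planeToComplex : Plane ≃ₗᵢ[ℝ] ℂ := Complex.orthonormalBasisOneI.repr.symm

theorem planeToComplex_apply (x : Plane) : planeToComplex x = x 0 + x 1 * Complex.I := by
  simp [planeToComplex]

/-- The kernel is an inversion followed by a rotation. This turns the estimates below into
identities between fractions; at the origin both sides have the default value `0`. -/
theorem planeToComplex_biotSavart (x : Plane) :
    planeToComplex (biotSavart x) = Complex.I / (starRingEnd ℂ) (planeToComplex x) := by
  by_cases hx : x = 0
  · simp [hx, biotSavart, perp]
  have h0 : planeToComplex x ≠ 0 := by simpa using hx
  have h1 : planeToComplex (perp x) = Complex.I * planeToComplex x := by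
    simp only [planeToComplex_apply, perp]
    simp
    linear_combination (-(x 1 : ℂ)) * Complex.I_sq
  have h2 : ((‖x‖ ^ 2 : ℝ) : ℂ) = planeToComplex x * (starRingEnd ℂ) (planeToComplex x) := by
    rw [Complex.mul_conj, Complex.normSq_eq_norm_sq, planeToComplex.norm_map]
  have h3 : (starRingEnd ℂ) (planeToComplex x) ≠ 0 := by simpa using h0
  rw [biotSavart, map_smul, h1, Complex.real_smul, Complex.ofReal_inv, h2]
  field_simp

theorem norm_biotSavart (x : Plane) : ‖biotSavart x‖ = ‖x‖⁻¹ := by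
  rw [← planeToComplex.norm_map, planeToComplex_biotSavart]; simp

theorem biotSavart_neg (x : Plane) : biotSavart (-x) = -biotSavart x := by
  apply planeToComplex.injective
  simp [planeToComplex_biotSavart, div_neg]

/-- In complex notation `I / conj (I / conj z) = -z`. The kernel is thus explicitly invertible,
which later gives the place of a control vortex from the velocity that it has to induce. -/
theorem biotSavart_biotSavart (x : Plane) : biotSavart (biotSavart x) = -x := by
  apply planeToComplex.injective
  rw [planeToComplex_biotSavart, planeToComplex_biotSavart]
  by_cases hx : x = 0
  · simp [hx]
  have h0 : planeToComplex x ≠ 0 := by simpa using hx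
  simp only [map_div₀, Complex.conj_conj, Complex.conj_I, map_neg]
  field_simp

theorem norm_biotSavart_sub (x y : Plane) (hx : x ≠ 0) (hy : y ≠ 0) :
    ‖biotSavart x - biotSavart y‖ = ‖x - y‖ / (‖x‖ * ‖y‖) := by
  have hx' : (starRingEnd ℂ) (planeToComplex x) ≠ 0 := by simpa using hx
  have hy' : (starRingEnd ℂ) (planeToComplex y) ≠ 0 := by simpa using hy
  rw [← planeToComplex.norm_map, map_sub, planeToComplex_biotSavart, planeToComplex_biotSavart,
    ← planeToComplex.norm_map (x - y), ← planeToComplex.norm_map x, ← planeToComplex.norm_map y]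
  have : Complex.I / (starRingEnd ℂ) (planeToComplex x)
      - Complex.I / (starRingEnd ℂ) (planeToComplex y) = - Complex.I *
      (starRingEnd ℂ) (planeToComplex (x - y)) /
        ((starRingEnd ℂ) (planeToComplex x) * (starRingEnd ℂ) (planeToComplex y)) := by
    rw [map_sub, map_sub]; field_simp; ring
  rw [this]; simp [-map_sub]

theorem norm_biotSavart_sub_le {x y : Plane} {ρ : ℝ} (hρ : 0 < ρ) (hx : ρ ≤ ‖x‖) (hy : ρ ≤ ‖y‖) :
    ‖biotSavart x - biotSavart y‖ ≤ ‖x - y‖ / ρ ^ 2 := by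
  rw [norm_biotSavart_sub x y (norm_pos_iff.1 (hρ.trans_le hx)) (norm_pos_iff.1 (hρ.trans_le hy)),
    sq]
  gcongr

/-- The derivative of the Biot-Savart kernel at `u`. -/
def biotSavartDeriv (u h : Plane) : Plane :=
  planeToComplex.symm (-Complex.I * (starRingEnd ℂ) (planeToComplex h) /
    (starRingEnd ℂ) (planeToComplex u) ^ 2)

theorem biotSavartDeriv_sub (u h k : Plane) :
    biotSavartDeriv u (h - k) = biotSavartDeriv u h - biotSavartDeriv u k := by
  apply planeToComplex.injective
  simp [biotSavartDeriv]; ring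

theorem biotSavartDeriv_smul (u : Plane) (a : ℝ) (h : Plane) :
    biotSavartDeriv u (a • h) = a • biotSavartDeriv u h := by
  apply planeToComplex.injective
  simp [biotSavartDeriv]; ring

theorem norm_biotSavartDeriv (u h : Plane) : ‖biotSavartDeriv u h‖ = ‖h‖ / ‖u‖ ^ 2 := by
  simp [biotSavartDeriv]

/-- The remainder is computed exactly, as `I * conj (x - y) ^ 2 / (conj x * conj y ^ 2)`. No mean
value argument is involved, so the segment from `x` to `y` may pass through the origin. -/
theorem norm_biotSavart_taylor (x y : Plane) (hx : x ≠ 0) (hy : y ≠ 0) :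
    ‖biotSavart x - biotSavart y - biotSavartDeriv y (x - y)‖
      = ‖x - y‖ ^ 2 / (‖x‖ * ‖y‖ ^ 2) := by
  have hx' : (starRingEnd ℂ) (planeToComplex x) ≠ 0 := by simpa using hx
  have hy' : (starRingEnd ℂ) (planeToComplex y) ≠ 0 := by simpa using hy
  rw [← planeToComplex.norm_map, map_sub, map_sub, planeToComplex_biotSavart,
    planeToComplex_biotSavart,
    ← planeToComplex.norm_map (x - y), ← planeToComplex.norm_map x, ← planeToComplex.norm_map y]
  have : Complex.I / (starRingEnd ℂ) (planeToComplex x)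
      - Complex.I / (starRingEnd ℂ) (planeToComplex y) - planeToComplex (biotSavartDeriv y (x - y))
      = Complex.I * (starRingEnd ℂ) (planeToComplex (x - y)) ^ 2 /
        ((starRingEnd ℂ) (planeToComplex x) * (starRingEnd ℂ) (planeToComplex y) ^ 2) := by
    simp only [biotSavartDeriv, LinearIsometryEquiv.apply_symm_apply]
    rw [map_sub, map_sub]; field_simp; ring
  rw [this]; simp [-map_sub]

theorem continuousOn_biotSavart : ContinuousOn biotSavart {0}ᶜ := by
  intro x hx
  have hx : ‖x‖ ^ 2 ≠ 0 := by simpa using hx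
  exact (((continuous_norm.pow 2).continuousAt.inv₀ hx).smul
    continuous_perp.continuousAt).continuousWithinAt

theorem ContinuousOn.biotSavart {X : Type*} [TopologicalSpace X] {s : Set X} {f : X → Plane}
    (hf : ContinuousOn f s) (h : ∀ t ∈ s, f t ≠ 0) : ContinuousOn (fun t => biotSavart (f t)) s :=
  continuousOn_biotSavart.comp hf h

/-- The Biot-Savart kernel, made globally Lipschitz inside the disc of radius `ρ`. -/
def cutKernel (ρ : ℝ) (x : Plane) : Plane := ((max ‖x‖ ρ) ^ 2)⁻¹ • perp x

theorem cutKernel_eq {ρ : ℝ} {x : Plane} (h : ρ ≤ ‖x‖) : cutKernel ρ x = biotSavart x := by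
  rw [cutKernel, biotSavart, max_eq_left h]

theorem norm_cutKernel_le {ρ : ℝ} (hρ : 0 < ρ) (x : Plane) : ‖cutKernel ρ x‖ ≤ ρ⁻¹ := by
  have hm : 0 < max ‖x‖ ρ := lt_max_of_lt_right hρ
  rw [cutKernel, norm_smul, norm_perp, norm_inv, norm_pow, Real.norm_of_nonneg hm.le]
  calc ((max ‖x‖ ρ) ^ 2)⁻¹ * ‖x‖ ≤ ((max ‖x‖ ρ) ^ 2)⁻¹ * max ‖x‖ ρ := by
        gcongr; exact le_max_left _ _
    _ = (max ‖x‖ ρ)⁻¹ := by field_simp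
    _ ≤ ρ⁻¹ := by gcongr; exact le_max_right _ _

/-- Of the factor `3`, one unit comes from changing the vector with the denominator fixed, and two
from changing the squared denominator. -/
theorem norm_cutKernel_sub_le {ρ : ℝ} (hρ : 0 < ρ) (x y : Plane) :
    ‖cutKernel ρ x - cutKernel ρ y‖ ≤ 3 / ρ ^ 2 * ‖x - y‖ := by
  set a := max ‖x‖ ρ with ha
  set b := max ‖y‖ ρ with hb
  have ha0 : ρ ≤ a := le_max_right _ _
  have hb0 : ρ ≤ b := le_max_right _ _
  have hy : ‖y‖ ≤ b := le_max_left _ _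
  have hab : |b - a| ≤ ‖x - y‖ := by
    rw [abs_sub_comm]
    exact (abs_max_sub_max_le_abs _ _ _).trans (abs_norm_sub_norm_le x y)
  have e : cutKernel ρ x - cutKernel ρ y
      = (a ^ 2)⁻¹ • perp (x - y) + ((a ^ 2)⁻¹ - (b ^ 2)⁻¹) • perp y := by
    rw [cutKernel, cutKernel, perp_sub]; module
  have ha1 := hρ.trans_le ha0
  have hb1 := hρ.trans_le hb0
  have h1 : ‖(a ^ 2)⁻¹ • perp (x - y)‖ ≤ 1 / ρ ^ 2 * ‖x - y‖ := by
    rw [norm_smul, norm_perp, norm_inv, norm_pow, Real.norm_of_nonneg ha1.le, one_div]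
    gcongr
  have h2 : ‖((a ^ 2)⁻¹ - (b ^ 2)⁻¹) • perp y‖ ≤ 2 / ρ ^ 2 * ‖x - y‖ := by
    rw [norm_smul, norm_perp]
    have : (a ^ 2)⁻¹ - (b ^ 2)⁻¹ = (b - a) * ((a ^ 2 * b)⁻¹ + (a * b ^ 2)⁻¹) := by
      field_simp; ring
    rw [this, Real.norm_eq_abs, abs_mul,
      abs_of_nonneg (by positivity : 0 ≤ (a ^ 2 * b)⁻¹ + (a * b ^ 2)⁻¹)]
    calc |b - a| * ((a ^ 2 * b)⁻¹ + (a * b ^ 2)⁻¹) * ‖y‖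
        ≤ ‖x - y‖ * ((a ^ 2 * b)⁻¹ + (a * b ^ 2)⁻¹) * b := by gcongr
      _ = ‖x - y‖ * ((a ^ 2)⁻¹ + (a * b)⁻¹) := by field_simp
      _ ≤ ‖x - y‖ * ((ρ ^ 2)⁻¹ + (ρ * ρ)⁻¹) := by gcongr
      _ = 2 / ρ ^ 2 * ‖x - y‖ := by field_simp; ring
  rw [e]
  calc _ ≤ _ := norm_add_le _ _
    _ ≤ _ := add_le_add h1 h2
    _ = _ := by ring

theorem continuous_cutKernel {ρ : ℝ} (hρ : 0 < ρ) : Continuous (cutKernel ρ) :=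
  (LipschitzWith.of_dist_le_mul (K := ⟨3 / ρ ^ 2, by positivity⟩) fun x y => by
    rw [dist_eq_norm, dist_eq_norm]; exact norm_cutKernel_sub_le hρ x y).continuous

/-! ### Stability of the single-control system -/

/-- The right-hand side of the single-control system with the kernel cut off at radius `ρ`. -/
def cutField {N : ℕ} (ρ : ℝ) (γ : Fin N → ℝ) (γc : ℝ) (p : Plane) (x : Fin N → Plane) :
    Fin N → Plane := fun i =>
  (∑ j ∈ Finset.univ.erase i, γ j • cutKernel ρ (x i - x j)) + γc • cutKernel ρ (x i - p)

/-- The right-hand side of the single-control system. -/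
def vortexField {N : ℕ} (γ : Fin N → ℝ) (γc : ℝ) (p : Plane) (x : Fin N → Plane) :
    Fin N → Plane := fun i =>
  (∑ j ∈ Finset.univ.erase i, γ j • biotSavart (x i - x j)) + γc • biotSavart (x i - p)

/-- A Lipschitz constant of `cutField`. -/
def fieldLip {N : ℕ} (ρ : ℝ) (γ : Fin N → ℝ) (γc : ℝ) : ℝ :=
  3 / ρ ^ 2 * (2 * ∑ j, |γ j| + |γc|)

section

variable {N : ℕ} {ρ : ℝ} {γ : Fin N → ℝ} {γc : ℝ}

theorem fieldLip_nonneg : 0 ≤ fieldLip ρ γ γc := by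
  unfold fieldLip; positivity

theorem cutField_eq {p : Plane} {x : Fin N → Plane}
    (h1 : ∀ i j, i ≠ j → ρ ≤ ‖x i - x j‖) (h2 : ∀ i, ρ ≤ ‖x i - p‖) :
    cutField ρ γ γc p x = vortexField γ γc p x := by
  funext i
  rw [cutField, vortexField, cutKernel_eq (h2 i)]
  congr 1
  refine Finset.sum_congr rfl fun j hj => ?_
  rw [cutKernel_eq (h1 i j (Finset.ne_of_mem_erase hj).symm)]

theorem sum_erase_abs_le (γ : Fin N → ℝ) (i : Fin N) :
    ∑ j ∈ Finset.univ.erase i, |γ j| ≤ ∑ j, |γ j| :=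
  Finset.sum_le_sum_of_subset_of_nonneg (Finset.erase_subset _ _) fun _ _ _ => abs_nonneg _

theorem norm_cutField_le (hρ : 0 < ρ) (p : Plane) (x : Fin N → Plane) :
    ‖cutField ρ γ γc p x‖ ≤ ρ⁻¹ * (∑ j, |γ j| + |γc|) := by
  refine (pi_norm_le_iff_of_nonneg (by positivity)).2 fun i => ?_
  refine (norm_add_le _ _).trans ?_
  rw [mul_add]
  refine add_le_add ((norm_sum_le _ _).trans ?_) ?_
  · refine le_trans ?_ (mul_le_mul_of_nonneg_left (sum_erase_abs_le γ i) (by positivity))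
    rw [Finset.mul_sum]
    refine Finset.sum_le_sum fun j _ => ?_
    rw [norm_smul, mul_comm, Real.norm_eq_abs]
    exact mul_le_mul_of_nonneg_right (norm_cutKernel_le hρ _) (abs_nonneg _)
  · rw [norm_smul, mul_comm, Real.norm_eq_abs]
    exact mul_le_mul_of_nonneg_right (norm_cutKernel_le hρ _) (abs_nonneg _)

theorem norm_cutField_sub_le (hρ : 0 < ρ) (p : Plane) (x y : Fin N → Plane) :
    ‖cutField ρ γ γc p x - cutField ρ γ γc p y‖ ≤ fieldLip ρ γ γc * ‖x - y‖ := by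
  refine (pi_norm_le_iff_of_nonneg (mul_nonneg fieldLip_nonneg (norm_nonneg _))).2 fun i => ?_
  have hc : ∀ i, ‖x i - y i‖ ≤ ‖x - y‖ := fun i => norm_le_pi_norm (x - y) i
  have e : (cutField ρ γ γc p x - cutField ρ γ γc p y) i
      = (∑ j ∈ Finset.univ.erase i, γ j • (cutKernel ρ (x i - x j) - cutKernel ρ (y i - y j)))
        + γc • (cutKernel ρ (x i - p) - cutKernel ρ (y i - p)) := by
    simp only [cutField, Pi.sub_apply, smul_sub, Finset.sum_sub_distrib]
    abel
  rw [e]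
  refine (norm_add_le _ _).trans ?_
  have h1 : ‖γc • (cutKernel ρ (x i - p) - cutKernel ρ (y i - p))‖
      ≤ 3 / ρ ^ 2 * |γc| * ‖x - y‖ := by
    rw [norm_smul, Real.norm_eq_abs]
    calc _ ≤ |γc| * (3 / ρ ^ 2 * ‖(x i - p) - (y i - p)‖) := by
          gcongr; exact norm_cutKernel_sub_le hρ _ _
      _ ≤ |γc| * (3 / ρ ^ 2 * ‖x - y‖) := by
          gcongr; rw [sub_sub_sub_cancel_right]; exact hc i
      _ = _ := by ring
  have h2 : ‖∑ j ∈ Finset.univ.erase i,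
        γ j • (cutKernel ρ (x i - x j) - cutKernel ρ (y i - y j))‖
      ≤ (3 / ρ ^ 2 * (2 * ‖x - y‖)) * ∑ j, |γ j| := by
    refine (norm_sum_le _ _).trans ?_
    refine le_trans ?_ (mul_le_mul_of_nonneg_left (sum_erase_abs_le γ i) (by positivity))
    rw [Finset.mul_sum]
    refine Finset.sum_le_sum fun j _ => ?_
    rw [norm_smul, Real.norm_eq_abs, mul_comm]
    gcongr
    refine (norm_cutKernel_sub_le hρ _ _).trans ?_
    gcongr
    have : (x i - x j) - (y i - y j) = (x i - y i) - (x j - y j) := by abel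
    rw [this, two_mul]
    exact (norm_sub_le _ _).trans (add_le_add (hc i) (hc j))
  calc _ ≤ _ := add_le_add h2 h1
    _ = _ := by unfold fieldLip; ring

theorem continuousOn_vortexField {s : Set ℝ} {x : ℝ → Fin N → Plane} {z : ℝ → Plane}
    (hx : ∀ i, ContinuousOn (fun t => x t i) s) (hz : ContinuousOn z s)
    (h1 : ∀ t ∈ s, ∀ i j, i ≠ j → x t i ≠ x t j) (h2 : ∀ t ∈ s, ∀ i, x t i ≠ z t) (i : Fin N) :
    ContinuousOn (fun t => vortexField γ γc (z t) (x t) i) s := by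
  refine ContinuousOn.add (continuousOn_finsetSum _ fun j hj => ?_) ?_
  · have h : ContinuousOn (fun t => x t i - x t j) s := (hx i).sub (hx j)
    have h' := h.biotSavart fun t ht => sub_ne_zero.2
      (h1 t ht i j (Finset.ne_of_mem_erase hj).symm)
    exact h'.fun_const_smul (γ j)
  · have h : ContinuousOn (fun t => x t i - z t) s := (hx i).sub hz
    have h' := h.biotSavart fun t ht => sub_ne_zero.2 (h2 t ht i)
    exact h'.fun_const_smul γc

/-- The cut-off field is bounded and globally Lipschitz, so Picard–Lindelöf applies on all of
`[0,T]`, in a ball too large to be left during that time. -/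
theorem exists_cutField_solution {T : ℝ} (hT : 0 ≤ T) (hρ : 0 < ρ) {z : ℝ → Plane}
    (hz : ContinuousOn z (Icc 0 T)) (x₀ : Fin N → Plane) :
    ∃ x : ℝ → Fin N → Plane, x 0 = x₀ ∧
      ∀ t ∈ Icc 0 T, HasDerivWithinAt x (cutField ρ γ γc (z t) (x t)) (Icc 0 T) t := by
  have hB : 0 ≤ ρ⁻¹ * (∑ j, |γ j| + |γc|) := by positivity
  have h : IsPicardLindelof (fun t x => cutField ρ γ γc (z t) x) (tmin := 0) (tmax := T)
      ⟨0, le_rfl, hT⟩ x₀ ⟨ρ⁻¹ * (∑ j, |γ j| + |γc|) * T, mul_nonneg hB hT⟩ 0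
      ⟨ρ⁻¹ * (∑ j, |γ j| + |γc|), hB⟩ ⟨fieldLip ρ γ γc, fieldLip_nonneg⟩ := by
    refine ⟨fun t _ => ?_, fun x _ => ?_, fun t _ x _ => norm_cutField_le hρ _ _, ?_⟩
    · refine LipschitzOnWith.of_dist_le_mul fun x _ y _ => ?_
      rw [dist_eq_norm, dist_eq_norm]
      exact norm_cutField_sub_le hρ _ _ _
    · refine continuousOn_pi.2 fun i => ?_
      refine ContinuousOn.add continuousOn_const ?_
      exact ((continuous_cutKernel hρ).comp_continuousOn
        (continuousOn_const.sub hz)).const_smul γc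
    · simp only [sub_zero, sub_self, max_eq_left hT, NNReal.coe_zero]
      exact le_rfl
  exact h.exists_eq_forall_mem_Icc_hasDerivWithinAt₀

/-- A trajectory that solves the single-control system up to an error with small integral is
close to a solution. -/
theorem exists_solution_near {T s η : ℝ} (hT : 0 < T) (hρ : 0 < ρ) (hs : 0 ≤ s) {z : ℝ → Plane}
    (hz : ContinuousOn z (Icc 0 T)) {xb xb' : ℝ → Fin N → Plane}
    (hxb : ∀ t ∈ Icc 0 T, ∀ i, HasDerivWithinAt (fun u => xb u i) (xb' t i) (Icc 0 T) t)
    (hxb' : ∀ i, ContinuousOn (fun t => xb' t i) (Icc 0 T))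
    (hsep : ∀ t ∈ Icc 0 T, ∀ i j, i ≠ j → ρ + 2 * s ≤ ‖xb t i - xb t j‖)
    (hzd : ∀ t ∈ Icc 0 T, ∀ i, ρ + s ≤ ‖xb t i - z t‖)
    (hint : ∀ t ∈ Icc 0 T, ∀ i, ‖∫ u in (0 : ℝ)..t,
      (xb' u i - vortexField γ γc (z u) (xb u) i)‖ ≤ η)
    (hη : η * Real.exp (fieldLip ρ γ γc * T) ≤ s) :
    ∃ x, IsSingleControlSolution T γ γc z (xb 0) x ∧
      ∀ t ∈ Icc 0 T, ∀ i, ‖x t i - xb t i‖ ≤ η * Real.exp (fieldLip ρ γ γc * T) := by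
  set L := fieldLip ρ γ γc with hL
  have hL0 : 0 ≤ L := fieldLip_nonneg
  obtain ⟨x, hx0, hx⟩ := exists_cutField_solution (γ := γ) (γc := γc) hT.le hρ hz (xb 0)
  have hxbc : ∀ i, ContinuousOn (fun t => xb t i) (Icc 0 T) := fun i t ht =>
    (hxb t ht i).continuousWithinAt
  have hcut : ∀ t ∈ Icc 0 T, cutField ρ γ γc (z t) (xb t) = vortexField γ γc (z t) (xb t) :=
    fun t ht => cutField_eq (fun i j hij => by linarith [hsep t ht i j hij])
      (fun i => by linarith [hzd t ht i])
  have hpos : ∀ {a b : Plane} {c : ℝ}, ρ + c ≤ ‖a - b‖ → 0 ≤ c → a ≠ b := by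
    rintro a b c h hc rfl
    simp at h; linarith
  set D : ℝ → Fin N → Plane := fun t i => xb' t i - vortexField γ γc (z t) (xb t) i with hD
  have hDc : ∀ i, ContinuousOn (fun t => D t i) (Icc 0 T) := fun i =>
    (hxb' i).sub (continuousOn_vortexField hxbc hz
      (fun t ht i j hij => hpos (hsep t ht i j hij) (by linarith))
      (fun t ht i => hpos (hzd t ht i) hs) i)
  set e : ℝ → Fin N → Plane := fun t i => ∫ u in (0 : ℝ)..t, D u i with he
  have hed : ∀ t ∈ Icc 0 T, HasDerivWithinAt e (D t) (Icc 0 T) t := by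
    intro t ht
    refine hasDerivWithinAt_pi.2 fun i => ?_
    have : Fact (t ∈ Icc 0 T) := ⟨ht⟩
    refine intervalIntegral.integral_hasDerivWithinAt_right ?_
      ((hDc i).stronglyMeasurableAtFilter_nhdsWithin measurableSet_Icc t) ((hDc i) t ht)
    exact ((hDc i).mono (uIcc_subset_Icc ⟨le_rfl, hT.le⟩ ht)).intervalIntegrable
  -- Without vortices the hypotheses say nothing about the sign of `η`, and every claim is vacuous.
  have hη0 : 0 ≤ η ∨ IsEmpty (Fin N) := by
    by_cases h : Nonempty (Fin N)
    · exact Or.inl ((norm_nonneg _).trans (hint 0 ⟨le_rfl, hT.le⟩ h.some))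
    · exact Or.inr (not_nonempty_iff.1 h)
  rcases hη0 with hη0 | hE
  swap
  · exact ⟨xb, ⟨rfl, fun t ht i => hE.elim i, fun t ht i => hE.elim i, fun t ht i => hE.elim i⟩,
      fun t ht i => hE.elim i⟩
  have heη : ∀ t ∈ Icc 0 T, ‖e t‖ ≤ η := fun t ht =>
    (pi_norm_le_iff_of_nonneg hη0).2 fun i => hint t ht i
  have hxbd : ∀ t ∈ Icc 0 T, HasDerivWithinAt xb (xb' t) (Icc 0 T) t := fun t ht =>
    hasDerivWithinAt_pi.2 fun i => hxb t ht i
  -- Adding the accumulated error cancels the discrepancy in the derivative: `g'` is a difference of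
  -- two values of the cut-off field, at most `L * (‖g‖ + η)`. Grönwall then gives `‖g‖ ≤ η * (exp
  -- (L * T) - 1)`, and going back to `x - xb` costs one more `η`.
  set g : ℝ → Fin N → Plane := fun t => x t - xb t + e t with hg
  have hgd : ∀ t ∈ Icc 0 T, HasDerivWithinAt g
      (cutField ρ γ γc (z t) (x t) - cutField ρ γ γc (z t) (xb t)) (Icc 0 T) t := by
    intro t ht
    have := ((hx t ht).sub (hxbd t ht)).add (hed t ht)
    have h : cutField ρ γ γc (z t) (x t) - cutField ρ γ γc (z t) (xb t)
        = cutField ρ γ γc (z t) (x t) - xb' t + D t := by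
      rw [hcut t ht]
      funext i
      simp only [hD, Pi.sub_apply, Pi.add_apply]
      abel
    rw [h]
    exact this
  have hgb := norm_le_gronwallBound_of_norm_deriv_right_le (f := g)
    (f' := fun t => cutField ρ γ γc (z t) (x t) - cutField ρ γ γc (z t) (xb t))
    (δ := 0) (K := L) (ε := L * η) (a := 0) (b := T)
    (fun t ht => (hgd t ht).continuousWithinAt)
    (fun t ht => ((hgd t ⟨ht.1, ht.2.le⟩).mono_of_mem_nhdsWithin
      (Icc_mem_nhdsGE_of_mem ht)))
    (by simp [hg, hx0, he]; rfl)
    (fun t ht => by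
      have ht' : t ∈ Icc 0 T := ⟨ht.1, ht.2.le⟩
      refine (norm_cutField_sub_le hρ _ _ _).trans ?_
      rw [← mul_add]
      refine mul_le_mul_of_nonneg_left ?_ hL0
      have : x t - xb t = g t - e t := by simp [hg]
      rw [this]
      exact (norm_sub_le _ _).trans (add_le_add le_rfl (heη t ht')))
  have hclose : ∀ t ∈ Icc 0 T, ‖x t - xb t‖ ≤ η * Real.exp (L * T) := by
    intro t ht
    have h1 : ‖g t‖ ≤ η * (Real.exp (L * T) - 1) := by
      refine (hgb t ht).trans ?_
      have hmono : Real.exp (L * t) ≤ Real.exp (L * T) :=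
        Real.exp_le_exp.2 (mul_le_mul_of_nonneg_left ht.2 hL0)
      by_cases hL00 : L = 0
      · rw [hL00, gronwallBound_K0]; simp
      · rw [gronwallBound_of_K_ne_0 hL00]
        simp only [sub_zero, zero_mul, zero_add]
        rw [mul_div_cancel_left₀ _ hL00]
        gcongr
    have : x t - xb t = g t - e t := by simp [hg]
    rw [this]
    calc _ ≤ _ := norm_sub_le _ _
      _ ≤ _ := add_le_add h1 (heη t ht)
      _ = _ := by ring
  have hclose' : ∀ t ∈ Icc 0 T, ∀ i, ‖x t i - xb t i‖ ≤ s := fun t ht i =>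
    (norm_le_pi_norm (x t - xb t) i).trans ((hclose t ht).trans hη)
  -- Closeness to the reference keeps the solution where the cut-off is inactive, so it solves the
  -- true system.
  have hxs : ∀ t ∈ Icc 0 T, ∀ i j, i ≠ j → ρ ≤ ‖x t i - x t j‖ := by
    intro t ht i j hij
    have h1 := hsep t ht i j hij
    have h2 : xb t i - xb t j = (x t i - x t j) - (x t i - xb t i) + (x t j - xb t j) := by abel
    rw [h2] at h1
    have h3 := norm_add_le ((x t i - x t j) - (x t i - xb t i)) (x t j - xb t j)
    have h4 := norm_sub_le (x t i - x t j) (x t i - xb t i)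
    linarith [hclose' t ht i, hclose' t ht j]
  have hxz : ∀ t ∈ Icc 0 T, ∀ i, ρ ≤ ‖x t i - z t‖ := by
    intro t ht i
    have h1 := hzd t ht i
    have h2 : xb t i - z t = (x t i - z t) - (x t i - xb t i) := by abel
    rw [h2] at h1
    linarith [hclose' t ht i, norm_sub_le (x t i - z t) (x t i - xb t i)]
  refine ⟨x, ⟨hx0, fun t ht i j hij => hpos (c := 0) (by simpa using hxs t ht i j hij) le_rfl,
    fun t ht i _ => hpos (c := 0) (by simpa using hxz t ht i) le_rfl, fun t ht i => ?_⟩,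
    fun t ht i => (norm_le_pi_norm (x t - xb t) i).trans (hclose t ht)⟩
  have := hasDerivWithinAt_pi.1 (hx t ht) i
  rw [cutField_eq (hxs t ht) (hxz t ht)] at this
  simpa [vortexField] using this

/-! ### Uniform separation and uniqueness of solutions -/

theorem exists_pos_le_of_finite {ι : Type*} [Finite ι] (f : ι → ℝ) (hf : ∀ i, 0 < f i) :
    ∃ ρ : ℝ, 0 < ρ ∧ ∀ i, ρ ≤ f i := by
  obtain ⟨B, hB⟩ := (Set.finite_range fun i => (f i)⁻¹).bddAbove
  refine ⟨(max B 1)⁻¹, by positivity, fun i => inv_le_of_inv_le₀ (hf i) ?_⟩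
  exact (hB ⟨i, rfl⟩).trans (le_max_left _ _)

theorem exists_pos_le_norm_sub {T : ℝ} (hT : 0 ≤ T) {f g : ℝ → Plane}
    (hf : ContinuousOn f (Icc 0 T)) (hg : ContinuousOn g (Icc 0 T))
    (h : ∀ t ∈ Icc 0 T, f t ≠ g t) : ∃ ρ : ℝ, 0 < ρ ∧ ∀ t ∈ Icc 0 T, ρ ≤ ‖f t - g t‖ := by
  obtain ⟨t, ht, hmin⟩ := isCompact_Icc.exists_isMinOn (nonempty_Icc.2 hT) (hf.sub hg).norm
  exact ⟨‖f t - g t‖, norm_pos_iff.2 (sub_ne_zero.2 (h t ht)), fun u hu => hmin hu⟩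

theorem IsSingleControlSolution.exists_radius {T : ℝ} (hT : 0 ≤ T) {z : ℝ → Plane}
    (hz : ContinuousOn z (Icc 0 T)) {x₀ : Fin N → Plane} {x : ℝ → Fin N → Plane}
    (hx : IsSingleControlSolution T γ γc z x₀ x) :
    ∃ ρ : ℝ, 0 < ρ ∧ ∀ t ∈ Icc 0 T, (∀ i j, i ≠ j → ρ ≤ ‖x t i - x t j‖) ∧
      ∀ i, ρ ≤ ‖x t i - z t‖ := by
  have hc : ∀ i, ContinuousOn (fun t => x t i) (Icc 0 T) := fun i t ht =>
    (hx.ode t ht i).continuousWithinAt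
  have h1 : ∀ p : {p : Fin N × Fin N // p.1 ≠ p.2}, ∃ ρ : ℝ, 0 < ρ ∧ ∀ t ∈ Icc 0 T,
      ρ ≤ ‖x t p.1.1 - x t p.1.2‖ := fun p =>
    exists_pos_le_norm_sub hT (hc _) (hc _) fun t ht => hx.vortices_ne t ht _ _ p.2
  have h2 : ∀ i, ∃ ρ : ℝ, 0 < ρ ∧ ∀ t ∈ Icc 0 T, ρ ≤ ‖x t i - z t‖ := fun i =>
    exists_pos_le_norm_sub hT (hc _) hz fun t ht => hx.control_ne t ht i ()
  choose f hf hf' using h1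
  choose g hg hg' using h2
  obtain ⟨ρ₁, h1, h1'⟩ := exists_pos_le_of_finite f hf
  obtain ⟨ρ₂, h2, h2'⟩ := exists_pos_le_of_finite g hg
  exact ⟨min ρ₁ ρ₂, lt_min h1 h2, fun t ht => ⟨fun i j hij => (min_le_left _ _).trans
    ((h1' ⟨(i, j), hij⟩).trans (hf' ⟨(i, j), hij⟩ t ht)),
    fun i => (min_le_right _ _).trans ((h2' i).trans (hg' i t ht))⟩⟩

theorem IsSingleControlSolution.hasDerivWithinAt_cutField {T : ℝ} {z : ℝ → Plane}
    {x₀ : Fin N → Plane} {x : ℝ → Fin N → Plane} (hx : IsSingleControlSolution T γ γc z x₀ x)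
    {t : ℝ} (ht : t ∈ Icc 0 T) (h1 : ∀ i j, i ≠ j → ρ ≤ ‖x t i - x t j‖)
    (h2 : ∀ i, ρ ≤ ‖x t i - z t‖) :
    HasDerivWithinAt x (cutField ρ γ γc (z t) (x t)) (Icc 0 T) t := by
  rw [cutField_eq h1 h2]
  exact hasDerivWithinAt_pi.2 fun i => by simpa [vortexField] using hx.ode t ht i

/-- By compactness both solutions keep some common distance from the singularities, so they solve
the same globally Lipschitz cut-off system. This extends the estimate for the constructed solution
to every solution. -/
theorem IsSingleControlSolution.eqOn {T : ℝ} (hT : 0 ≤ T) {z : ℝ → Plane}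
    (hz : ContinuousOn z (Icc 0 T)) {x₀ : Fin N → Plane} {x y : ℝ → Fin N → Plane}
    (hx : IsSingleControlSolution T γ γc z x₀ x) (hy : IsSingleControlSolution T γ γc z x₀ y) :
    EqOn x y (Icc 0 T) := by
  obtain ⟨ρ₁, h1, hx'⟩ := hx.exists_radius hT hz
  obtain ⟨ρ₂, h2, hy'⟩ := hy.exists_radius hT hz
  set ρ := min ρ₁ ρ₂
  have hρ : 0 < ρ := lt_min h1 h2
  have hxd : ∀ t ∈ Icc 0 T, HasDerivWithinAt x (cutField ρ γ γc (z t) (x t)) (Icc 0 T) t :=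
    fun t ht => hx.hasDerivWithinAt_cutField ht
      (fun i j hij => (min_le_left _ _).trans ((hx' t ht).1 i j hij))
      (fun i => (min_le_left _ _).trans ((hx' t ht).2 i))
  have hyd : ∀ t ∈ Icc 0 T, HasDerivWithinAt y (cutField ρ γ γc (z t) (y t)) (Icc 0 T) t :=
    fun t ht => hy.hasDerivWithinAt_cutField ht
      (fun i j hij => (min_le_right _ _).trans ((hy' t ht).1 i j hij))
      (fun i => (min_le_right _ _).trans ((hy' t ht).2 i))
  refine ODE_solution_unique_of_mem_Icc_right (v := fun t x => cutField ρ γ γc (z t) x)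
    (s := fun _ => univ) (K := ⟨fieldLip ρ γ γc, fieldLip_nonneg⟩) (fun t _ => ?_)
    (fun t ht => (hxd t ht).continuousWithinAt)
    (fun t ht => ((hxd t ⟨ht.1, ht.2.le⟩).mono_of_mem_nhdsWithin (Icc_mem_nhdsGE_of_mem ht)))
    (fun _ _ => mem_univ _)
    (fun t ht => (hyd t ht).continuousWithinAt)
    (fun t ht => ((hyd t ⟨ht.1, ht.2.le⟩).mono_of_mem_nhdsWithin (Icc_mem_nhdsGE_of_mem ht)))
    (fun _ _ => mem_univ _) (hx.init.trans hy.init.symm)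
  refine LipschitzOnWith.of_dist_le_mul fun x _ y _ => ?_
  rw [dist_eq_norm, dist_eq_norm]
  exact norm_cutField_sub_le hρ _ _ _

theorem configDist_le {x y : Fin N → Plane} {c : ℝ} (hc : 0 ≤ c) (h : ∀ i, ‖x i - y i‖ ≤ c) :
    configDist x y ≤ √N * c := by
  have : ∑ i, ‖x i - y i‖ ^ 2 ≤ N * c ^ 2 := by
    calc _ ≤ ∑ _i : Fin N, c ^ 2 := Finset.sum_le_sum fun i _ => by gcongr; exact h i
      _ = _ := by simp
  calc _ ≤ √(N * c ^ 2) := Real.sqrt_le_sqrt this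
    _ = _ := by rw [Real.sqrt_mul (by positivity), Real.sqrt_sq hc]

end

/-! ### Averaging over the slots of a period -/

/-- Used with end layers of length `θ` where only a crude bound is known: around transitions, and
where the end points of a control are modified. -/
theorem norm_integral_le_of_core {G : ℝ → Plane} {a δ θ C e : ℝ} (hθ : 0 ≤ θ) (hδ : 0 ≤ δ)
    (he0 : 0 ≤ e) (hG : ContinuousOn G (Icc a (a + δ)))
    (hC : ∀ t ∈ Icc a (a + δ), ‖G t‖ ≤ C) (he : ∀ t ∈ Icc (a + θ) (a + δ - θ), ‖G t‖ ≤ e) :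
    ‖∫ t in a..(a + δ), G t‖ ≤ δ * e + 2 * θ * C := by
  have hC0 : 0 ≤ C := (norm_nonneg _).trans (hC a ⟨le_rfl, by linarith⟩)
  have key : ∀ {p q c : ℝ}, p ≤ q → (∀ t ∈ Icc p q, ‖G t‖ ≤ c) →
      ‖∫ t in p..q, G t‖ ≤ c * (q - p) := by
    intro p q c hpq h
    have := intervalIntegral.norm_integral_le_of_norm_le_const (f := G) (a := p) (b := q) (C := c)
      (fun t ht => h t (by rw [uIoc_of_le hpq] at ht; exact Ioc_subset_Icc_self ht))
    rwa [abs_of_nonneg (by linarith)] at this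
  by_cases h2 : 2 * θ ≤ δ
  · have hi : ∀ {p q : ℝ}, a ≤ p → p ≤ q → q ≤ a + δ → IntervalIntegrable G volume p q :=
      fun hp hpq hq => (hG.mono (by
        rw [uIcc_of_le hpq]; exact Icc_subset_Icc hp hq)).intervalIntegrable
    have e1 : ∫ t in a..(a + δ), G t = (∫ t in a..(a + θ), G t)
        + (∫ t in (a + θ)..(a + δ - θ), G t) + ∫ t in (a + δ - θ)..(a + δ), G t := by
      rw [intervalIntegral.integral_add_adjacent_intervals, intervalIntegral.integral_add_adjacent_intervals]
      all_goals apply hi <;> linarith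
    have h1 := key (p := a) (q := a + θ) (c := C) (by linarith)
      (fun t ht => hC t ⟨ht.1, by linarith [ht.2]⟩)
    have h3 := key (p := a + δ - θ) (q := a + δ) (c := C) (by linarith)
      (fun t ht => hC t ⟨by linarith [ht.1], ht.2⟩)
    have h4 := key (p := a + θ) (q := a + δ - θ) (c := e) (by linarith) he
    rw [e1]
    have h5 := norm_add₃_le (a := ∫ t in a..(a + θ), G t)
      (b := ∫ t in (a + θ)..(a + δ - θ), G t) (c := ∫ t in (a + δ - θ)..(a + δ), G t)
    nlinarith [mul_nonneg he0 hθ]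
  · have h1 := key (p := a) (q := a + δ) (c := C) (by linarith) hC
    nlinarith [mul_nonneg he0 hδ]

theorem integral_affine (p q a : ℝ) (v w : Plane) :
    ∫ s in p..q, (w + (s - a) • v) = (q - p) • w + ((q - a) ^ 2 / 2 - (p - a) ^ 2 / 2) • v := by
  rw [intervalIntegral.integral_add (by simp), intervalIntegral.integral_const,
    intervalIntegral.integral_smul_const]
  · congr 2
    rw [intervalIntegral.integral_comp_sub_right (fun x => x) a, integral_id]; ring
  · exact Continuous.intervalIntegrable (by fun_prop) _ _

/-- On a period, the integral over a slot is the mean of the integrals over all of the slots, up to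
a multiple of the increment; the error vanishes for affine functions. -/
theorem norm_slot_sub_mean_le {F : ℝ → Plane} {a δ E : ℝ} {N k : ℕ} (hk : k < N) (hδ : 0 ≤ δ)
    (hF : ContinuousOn F (Icc a (a + N * δ))) {v : Plane}
    (hE : ∀ s ∈ Icc a (a + N * δ), ‖F s - F a - (s - a) • v‖ ≤ E) :
    ‖(∫ t in (a + k * δ)..(a + (k + 1) * δ), F t) - (N : ℝ)⁻¹ • (∫ t in a..(a + N * δ), F t)
      - (δ * (k + 1 / 2 - N / 2) / N) • (F (a + N * δ) - F a)‖ ≤ 3 * E * δ := by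
  have hN : (0 : ℝ) < N := by exact_mod_cast (Nat.zero_le k).trans_lt hk
  have hk1 : (k : ℝ) + 1 ≤ N := by exact_mod_cast hk
  have hE0 : 0 ≤ E := (norm_nonneg _).trans (hE a ⟨le_rfl, by nlinarith⟩)
  set G : ℝ → Plane := fun s => F s - F a - (s - a) • v with hG
  have hk0 : 0 ≤ (k : ℝ) * δ := by positivity
  have hkN : (k + 1 : ℝ) * δ ≤ N * δ := by gcongr
  have hGc : ContinuousOn G (Icc a (a + N * δ)) :=
    (hF.sub continuousOn_const).sub (by fun_prop)
  have hFG : ∀ p q, a ≤ p → p ≤ q → q ≤ a + N * δ →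
      ∫ t in p..q, F t = (∫ t in p..q, G t)
        + ((q - p) • F a + ((q - a) ^ 2 / 2 - (p - a) ^ 2 / 2) • v) := by
    intro p q hp hpq hq
    rw [← integral_affine, ← intervalIntegral.integral_add]
    · congr 1; funext s; simp only [hG]; abel
    · exact (hGc.mono (by rw [uIcc_of_le hpq]; exact Icc_subset_Icc hp hq)).intervalIntegrable
    · exact Continuous.intervalIntegrable (by fun_prop) _ _
  have key : ∀ p q, a ≤ p → p ≤ q → q ≤ a + N * δ → ‖∫ t in p..q, G t‖ ≤ E * (q - p) := by
    intro p q hp hpq hq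
    have := intervalIntegral.norm_integral_le_of_norm_le_const (f := G) (a := p) (b := q) (C := E)
      (fun t ht => hE t (by
        rw [uIoc_of_le hpq] at ht; exact ⟨hp.trans ht.1.le, ht.2.trans hq⟩))
    rwa [abs_of_nonneg (by linarith)] at this
  rw [hFG (a + k * δ) (a + (k + 1) * δ) (by linarith) (by linarith) (by linarith),
    hFG a (a + N * δ) le_rfl (by nlinarith) le_rfl]
  have h1 := key (a + k * δ) (a + (k + 1) * δ) (by linarith) (by linarith) (by linarith)
  have h2 := key a (a + N * δ) le_rfl (by nlinarith) le_rfl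
  have h3 : ‖G (a + N * δ)‖ ≤ E := hE _ ⟨by nlinarith, le_rfl⟩
  have hFe : F (a + N * δ) - F a = G (a + N * δ) + (N * δ) • v := by
    simp only [hG]; rw [add_sub_cancel_left]; abel
  rw [hFe]
  set I1 := ∫ t in (a + k * δ)..(a + (k + 1) * δ), G t
  set I2 := ∫ t in a..(a + N * δ), G t
  -- For an affine function of slope `v`, the slot integral minus the mean share is `δ • v` times
  -- the distance `δ * (k + 1/2 - N/2)` between the midpoints of the slot and of the period. Since
  -- the increment over the period is `(N * δ) • v`, the coefficient of the increment is `c`.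
  set c : ℝ := δ * (k + 1 / 2 - N / 2) / N with hc
  have hc' : |c| ≤ δ := by
    rw [hc, abs_div, abs_mul, abs_of_nonneg hδ, abs_of_pos hN, div_le_iff₀ hN]
    have : |(k : ℝ) + 1 / 2 - N / 2| ≤ N := by
      rw [abs_le]; constructor <;> nlinarith [Nat.cast_nonneg (α := ℝ) k]
    gcongr
  have e1 : I1 + ((a + (k + 1) * δ - (a + k * δ)) • F a
        + ((a + (k + 1) * δ - a) ^ 2 / 2 - (a + k * δ - a) ^ 2 / 2) • v)
      - (N : ℝ)⁻¹ • (I2 + ((a + N * δ - a) • F a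
        + ((a + N * δ - a) ^ 2 / 2 - (a - a) ^ 2 / 2) • v))
      - c • (G (a + N * δ) + (N * δ) • v) = I1 - (N : ℝ)⁻¹ • I2 - c • G (a + N * δ) := by
    match_scalars <;> simp [hc] <;> field_simp <;> ring
  rw [e1]
  have h4 : ‖(N : ℝ)⁻¹ • I2‖ ≤ E * δ := by
    rw [norm_smul, norm_inv, Real.norm_of_nonneg hN.le, inv_mul_le_iff₀ hN]
    linarith
  have h5 : ‖c • G (a + N * δ)‖ ≤ δ * E := by
    rw [norm_smul]; exact mul_le_mul hc' h3 (norm_nonneg _) hδ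
  have h6 := norm_sub_le (I1 - (N : ℝ)⁻¹ • I2) (c • G (a + N * δ))
  have h7 := norm_sub_le I1 ((N : ℝ)⁻¹ • I2)
  nlinarith

/-- A function that follows `F 0, …, F (N - 1)` cyclically on slots of length `T / (n N)` has
nearly the same integrals as the mean of the functions `F k`. -/
theorem norm_integral_sub_mean_le {N n : ℕ} [NeZero N] (hn : 0 < n) {T : ℝ} (hT : 0 < T)
    {F : Fin N → ℝ → Plane} {H : ℝ → Plane} {B e E : ℝ} (he0 : 0 ≤ e)
    (hF : ∀ k, ContinuousOn (F k) (Icc 0 T)) (hH : ContinuousOn H (Icc 0 T))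
    (hFB : ∀ k, ∀ t ∈ Icc 0 T, ‖F k t‖ ≤ B) (hHB : ∀ t ∈ Icc 0 T, ‖H t‖ ≤ B)
    (hE : ∀ k, ∀ a ∈ Icc 0 T, ∃ v : Plane, ∀ s ∈ Icc 0 T, a ≤ s → s ≤ a + T / n →
      ‖F k s - F k a - (s - a) • v‖ ≤ E)
    (he : ∀ m : ℕ, m < n * N → ∀ t ∈ Icc (m * (T / (n * N)) + T / (n * N) / n)
      ((m + 1) * (T / (n * N)) - T / (n * N) / n), ‖H t - F (Fin.ofNat N m) t‖ ≤ e) :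
    ∀ t ∈ Icc 0 T, ‖∫ u in (0 : ℝ)..t, (H u - (N : ℝ)⁻¹ • ∑ k, F k u)‖
      ≤ T * (7 * B / n + e + 3 * E) := by
  have hN : (0 : ℝ) < N := by exact_mod_cast NeZero.pos N
  have hn' : (0 : ℝ) < n := by exact_mod_cast hn
  have hB0 : 0 ≤ B := (norm_nonneg _).trans (hHB 0 ⟨le_rfl, hT.le⟩)
  set δ := T / (n * N) with hδ
  have hδ0 : 0 < δ := by positivity
  have hP : N * δ = T / n := by rw [hδ]; field_simp
  have hnP : n * (N * δ) = T := by rw [hP]; field_simp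
  have hE0 : 0 ≤ E := by
    obtain ⟨v, hv⟩ := hE ⟨0, NeZero.pos N⟩ 0 ⟨le_rfl, hT.le⟩
    exact (norm_nonneg _).trans (hv 0 ⟨le_rfl, hT.le⟩ le_rfl (by positivity))
  set g : ℝ → Plane := fun u => H u - (N : ℝ)⁻¹ • ∑ k, F k u with hg
  have hsum : ContinuousOn (fun u => ∑ k, F k u) (Icc 0 T) :=
    continuousOn_finsetSum _ fun k _ => hF k
  have hgc : ContinuousOn g (Icc 0 T) := hH.sub (hsum.fun_const_smul _)
  have hgB : ∀ t ∈ Icc 0 T, ‖g t‖ ≤ 2 * B := by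
    intro t ht
    refine (norm_sub_le _ _).trans ?_
    have : ‖(N : ℝ)⁻¹ • ∑ k, F k t‖ ≤ B := by
      rw [norm_smul, norm_inv, Real.norm_of_nonneg hN.le, inv_mul_le_iff₀ hN]
      refine (norm_sum_le _ _).trans ((Finset.sum_le_sum fun k _ => hFB k t ht).trans ?_)
      simp
    linarith [hHB t ht]
  have hii : ∀ {f : ℝ → Plane}, ContinuousOn f (Icc 0 T) → ∀ p q, 0 ≤ p → p ≤ q → q ≤ T →
      IntervalIntegrable f volume p q := fun hf p q hp hpq hq =>
    (hf.mono (by rw [uIcc_of_le hpq]; exact Icc_subset_Icc hp hq)).intervalIntegrable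
  let c : ℕ → ℝ := fun k => δ * (k + 1 / 2 - N / 2) / N
  have hc : ∀ k < N, |c k| ≤ δ / 2 := by
    intro k hk
    have hk1 : (k : ℝ) + 1 ≤ N := by exact_mod_cast hk
    rw [abs_div, abs_mul, abs_of_pos hδ0, abs_of_pos hN, div_le_iff₀ hN]
    have : |(k : ℝ) + 1 / 2 - N / 2| ≤ N / 2 := by
      rw [abs_le]; constructor <;> nlinarith [Nat.cast_nonneg (α := ℝ) k]
    calc δ * |(k : ℝ) + 1 / 2 - N / 2| ≤ δ * (N / 2) := by gcongr
      _ = _ := by ring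
  have hper : ∀ j : ℕ, j < n → ‖(∫ u in (j * (N * δ))..((j + 1) * (N * δ)), g u)
      - ∑ k : Fin N, c k • (F k ((j + 1) * (N * δ)) - F k (j * (N * δ)))‖
      ≤ N * (δ * e + 2 * (δ / n) * (2 * B) + 3 * E * δ) := by
    intro j hj
    have hj1 : (j : ℝ) + 1 ≤ n := by exact_mod_cast hj
    set a := (j : ℝ) * (N * δ) with ha
    have ha0 : 0 ≤ a := by positivity
    have haP : a + N * δ ≤ T := by
      rw [← hnP]; nlinarith [mul_pos hN hδ0]
    have hb : ((j : ℝ) + 1) * (N * δ) = a + N * δ := by rw [ha]; ring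
    rw [hb]
    have hsub : Icc a (a + N * δ) ⊆ Icc 0 T := Icc_subset_Icc ha0 haP
    have hslot : ∀ k : Fin N, a ≤ a + k * δ ∧ a + (k + 1) * δ ≤ a + N * δ := by
      intro k
      have : (k : ℝ) + 1 ≤ N := by exact_mod_cast k.2
      exact ⟨by have : 0 ≤ (k : ℝ) * δ := by positivity
                linarith, by gcongr⟩
    have e1 : ∫ u in a..(a + N * δ), H u
        = ∑ k : Fin N, ∫ u in (a + k * δ)..(a + (k + 1) * δ), H u := by
      rw [← Finset.sum_range (fun k : ℕ => ∫ u in (a + k * δ)..(a + (k + 1) * δ), H u)]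
      have := intervalIntegral.sum_integral_adjacent_intervals (f := H) (μ := volume)
        (a := fun k : ℕ => a + k * δ) (n := N) (fun k hk => ?_)
      · simp only [Nat.cast_add, Nat.cast_one, Nat.cast_zero, zero_mul, add_zero] at this
        exact this.symm
      · have := hslot ⟨k, hk⟩
        push_cast
        exact hii hH _ _ (ha0.trans this.1) (by nlinarith) (this.2.trans haP)
    have e2 : ∫ u in a..(a + N * δ), g u = (∫ u in a..(a + N * δ), H u)
        - ∑ k : Fin N, (N : ℝ)⁻¹ • ∫ u in a..(a + N * δ), F k u := by
      simp only [hg]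
      rw [intervalIntegral.integral_sub (hii hH _ _ ha0 (by nlinarith) haP)
        (hii (hsum.fun_const_smul _) _ _ ha0 (by nlinarith) haP),
        intervalIntegral.integral_smul, intervalIntegral.integral_finsetSum, Finset.smul_sum]
      exact fun k _ => hii (hF k) _ _ ha0 (by nlinarith) haP
    have e3 : (∫ u in a..(a + N * δ), g u) - ∑ k : Fin N, c k • (F k (a + N * δ) - F k a)
        = ∑ k : Fin N, ((∫ u in (a + k * δ)..(a + (k + 1) * δ), (H u - F k u))
          + ((∫ u in (a + k * δ)..(a + (k + 1) * δ), F k u)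
            - (N : ℝ)⁻¹ • (∫ u in a..(a + N * δ), F k u) - c k • (F k (a + N * δ) - F k a))) := by
      rw [e2, e1, ← Finset.sum_sub_distrib, ← Finset.sum_sub_distrib]
      refine Finset.sum_congr rfl fun k _ => ?_
      have := hslot k
      have h1 := ha0.trans this.1
      have h2 : a + k * δ ≤ a + (k + 1) * δ := by nlinarith
      rw [intervalIntegral.integral_sub (hii hH _ _ h1 h2 (this.2.trans haP))
        (hii (hF k) _ _ h1 h2 (this.2.trans haP))]
      abel
    rw [e3]
    refine (norm_sum_le _ _).trans ?_
    have hterm : ∀ k ∈ (Finset.univ : Finset (Fin N)),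
        ‖(∫ u in (a + k * δ)..(a + (k + 1) * δ), (H u - F k u))
          + ((∫ u in (a + k * δ)..(a + (k + 1) * δ), F k u)
            - (N : ℝ)⁻¹ • (∫ u in a..(a + N * δ), F k u) - c k • (F k (a + N * δ) - F k a))‖
        ≤ δ * e + 2 * (δ / n) * (2 * B) + 3 * E * δ := by
      intro k _
      refine (norm_add_le _ _).trans (add_le_add ?_ ?_)
      · have hs := hslot k
        have hss : Icc (a + k * δ) (a + k * δ + δ) ⊆ Icc 0 T :=
          Icc_subset_Icc (ha0.trans hs.1) (by linarith)
        have h3 : a + (k + 1) * δ = a + k * δ + δ := by ring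
        rw [h3]
        refine norm_integral_le_of_core (by positivity) hδ0.le he0
          ((hH.sub (hF k)).mono hss) (fun t ht => ?_) (fun t ht => ?_)
        · refine (norm_sub_le _ _).trans ?_
          linarith [hHB t (hss ht), hFB k t (hss ht)]
        · have hm : j * N + (k : ℕ) < n * N := by
            calc j * N + (k : ℕ) < j * N + N := by omega
              _ = (j + 1) * N := by ring
              _ ≤ n * N := Nat.mul_le_mul_right _ hj
          have hmod : Fin.ofNat N (j * N + (k : ℕ)) = k := by
            ext; simp [Fin.ofNat, Nat.mod_eq_of_lt k.2]
          have := he (j * N + k) hm t (by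
            push_cast
            have h4 : ((j : ℝ) * N + k) * δ = a + k * δ := by rw [ha]; ring
            have h5 : ((j : ℝ) * N + k + 1) * δ = a + k * δ + δ := by rw [ha]; ring
            rw [h4, h5]; exact ht)
          rwa [hmod] at this
      · obtain ⟨v, hv⟩ := hE k a (hsub ⟨le_rfl, by nlinarith⟩)
        exact norm_slot_sub_mean_le k.2 hδ0.le ((hF k).mono hsub)
          (fun s hs => hv s (hsub hs) hs.1 (by rw [← hP]; exact hs.2))
    refine (Finset.sum_le_sum hterm).trans ?_
    rw [Finset.sum_const, Finset.card_univ, Fintype.card_fin, nsmul_eq_mul]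
  -- The coefficients `c k` do not depend on the period, so the increments add up to `F k (j * (N *
  -- δ)) - F k 0`, which is bounded by `2 * B` however fast `F k` varies.
  have hind : ∀ j : ℕ, j ≤ n → ‖(∫ u in (0 : ℝ)..(j * (N * δ)), g u)
      - ∑ k : Fin N, c k • (F k (j * (N * δ)) - F k 0)‖
      ≤ j * (N * (δ * e + 2 * (δ / n) * (2 * B) + 3 * E * δ)) := by
    intro j
    induction j with
    | zero => intro _; simp
    | succ j ih =>
      intro hj
      have hj1 : (j : ℝ) + 1 ≤ n := by exact_mod_cast hj
      have hTj : ((j : ℝ) + 1) * (N * δ) ≤ T := by rw [← hnP]; gcongr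
      push_cast
      rw [← intervalIntegral.integral_add_adjacent_intervals (b := j * (N * δ))
        (hii hgc _ _ le_rfl (by positivity) (by nlinarith [mul_pos hN hδ0]))
        (hii hgc _ _ (by positivity) (by gcongr; linarith) hTj)]
      have e1 : ∑ k : Fin N, c k • (F k ((j + 1) * (N * δ)) - F k 0)
          = ∑ k : Fin N, c k • (F k (j * (N * δ)) - F k 0)
          + ∑ k : Fin N, c k • (F k ((j + 1) * (N * δ)) - F k (j * (N * δ))) := by
        rw [← Finset.sum_add_distrib]
        refine Finset.sum_congr rfl fun k _ => ?_
        rw [← smul_add]; congr 1; abel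
      rw [e1, add_sub_add_comm]
      refine (norm_add_le _ _).trans ?_
      exact (add_le_add (ih (by omega)) (hper j (by omega))).trans_eq (by ring)
  intro t ht
  have hPpos : 0 < N * δ := by positivity
  set j := ⌊t / (N * δ)⌋₊ with hj
  have hj1 : (j : ℝ) * (N * δ) ≤ t := by
    have := Nat.floor_le (div_nonneg ht.1 hPpos.le)
    rwa [le_div_iff₀ hPpos] at this
  have hj2 : t ≤ (j : ℝ) * (N * δ) + N * δ := by
    have := Nat.lt_floor_add_one (t / (N * δ))
    rw [div_lt_iff₀ hPpos] at this
    linarith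
  have hjn : j ≤ n := by
    have : (j : ℝ) * (N * δ) ≤ n * (N * δ) := by rw [hnP]; exact hj1.trans ht.2
    exact_mod_cast le_of_mul_le_mul_right this hPpos
  have hjn' : (j : ℝ) ≤ n := by exact_mod_cast hjn
  have hj0 : 0 ≤ (j : ℝ) * (N * δ) := by positivity
  rw [← intervalIntegral.integral_add_adjacent_intervals (b := j * (N * δ))
    (hii hgc _ _ le_rfl hj0 (hj1.trans ht.2)) (hii hgc _ _ hj0 hj1 ht.2)]
  have hlast : ‖∫ u in (j * (N * δ))..t, g u‖ ≤ 2 * B * (N * δ) := by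
    have := intervalIntegral.norm_integral_le_of_norm_le_const (f := g) (a := j * (N * δ)) (b := t)
      (C := 2 * B) (fun u hu => hgB u (by
        rw [uIoc_of_le hj1] at hu; exact ⟨hj0.trans hu.1.le, hu.2.trans ht.2⟩))
    refine this.trans ?_
    rw [abs_of_nonneg (by linarith)]
    gcongr; linarith
  have hbdry : ‖∑ k : Fin N, c k • (F k (j * (N * δ)) - F k 0)‖ ≤ N * (δ / 2 * (2 * B)) := by
    refine (norm_sum_le _ _).trans ?_
    have : ∀ k ∈ (Finset.univ : Finset (Fin N)), ‖c k • (F k (j * (N * δ)) - F k 0)‖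
        ≤ δ / 2 * (2 * B) := by
      intro k _
      rw [norm_smul]
      refine mul_le_mul (hc k k.2) ?_ (norm_nonneg _) (by positivity)
      refine (norm_sub_le _ _).trans ?_
      linarith [hFB k (j * (N * δ)) ⟨hj0, hj1.trans ht.2⟩, hFB k 0 ⟨le_rfl, hT.le⟩]
    refine (Finset.sum_le_sum this).trans ?_
    simp
  have hmain := hind j hjn
  have hmain' : (j : ℝ) * (N * (δ * e + 2 * (δ / n) * (2 * B) + 3 * E * δ))
      ≤ n * (N * (δ * e + 2 * (δ / n) * (2 * B) + 3 * E * δ)) := by gcongr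
  set A := ∫ u in (0 : ℝ)..(j * (N * δ)), g u
  set S := ∑ k : Fin N, c k • (F k (j * (N * δ)) - F k 0)
  have hA : ‖A‖ ≤ ‖A - S‖ + ‖S‖ := by
    simpa using norm_add_le (A - S) S
  -- In `7 * B`, the layers of length `δ / n` at the ends of the slots account for `4`, the
  -- telescoped boundary terms for `1`, and the last incomplete period for `2`.
  have hfin : n * (N * (δ * e + 2 * (δ / n) * (2 * B) + 3 * E * δ)) + N * (δ / 2 * (2 * B))
      + 2 * B * (N * δ) = T * (7 * B / n + e + 3 * E) := by
    rw [hδ]; field_simp; ring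
  have := norm_add_le A (∫ u in (j * (N * δ))..t, g u)
  linarith

/-! ### Detours around discs -/

theorem norm_sq_smul_add_perp (w : Plane) (α β : ℝ) :
    ‖α • w + β • perp w‖ ^ 2 = (α ^ 2 + β ^ 2) * ‖w‖ ^ 2 := by
  rw [EuclideanSpace.real_norm_sq_eq, EuclideanSpace.real_norm_sq_eq, Fin.sum_univ_two,
    Fin.sum_univ_two]
  simp [perp]
  ring

theorem norm_sq_add_perp {e : Plane} (he : ‖e‖ = 1) (α β : ℝ) :
    ‖α • e + β • perp e‖ ^ 2 = α ^ 2 + β ^ 2 := by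
  rw [norm_sq_smul_add_perp, he]; ring

theorem decomp_perp {e : Plane} (he : ‖e‖ = 1) (w : Plane) :
    w = ⟪w, e⟫_ℝ • e + ⟪w, perp e⟫_ℝ • perp e := by
  have h1 : e 0 ^ 2 + e 1 ^ 2 = 1 := by
    have := EuclideanSpace.real_norm_sq_eq e
    rw [he, Fin.sum_univ_two] at this
    linarith
  ext i
  fin_cases i <;> simp [perp, PiLp.inner_apply, Fin.sum_univ_two]
  · linear_combination (-w 0) * h1
  · linear_combination (-w 1) * h1

theorem norm_sq_eq_inner_perp {e : Plane} (he : ‖e‖ = 1) (w : Plane) :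
    ‖w‖ ^ 2 = ⟪w, e⟫_ℝ ^ 2 + ⟪w, perp e⟫_ℝ ^ 2 := by
  conv_lhs => rw [decomp_perp he w]
  exact norm_sq_add_perp he _ _

theorem abs_inner_perp_le {e : Plane} (he : ‖e‖ = 1) (w : Plane) : |⟪w, perp e⟫_ℝ| ≤ ‖w‖ := by
  have := abs_real_inner_le_norm w (perp e)
  rwa [norm_perp, he, mul_one] at this

theorem norm_arcPoint_sub {e c : Plane} (he : ‖e‖ = 1) {R : ℝ} (hR : 0 ≤ R) (v : Plane) :
    ‖arcPoint e c R v - c‖ = R := by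
  refine (sq_eq_sq₀ (norm_nonneg _) hR).1 ?_
  simp only [arcPoint]
  rw [add_assoc, add_sub_cancel_left, norm_sq_add_perp he]
  split_ifs <;> linear_combination R ^ 2 * Real.sin_sq_add_cos_sq _

/-- This is the ratio of arc to chord. With half-opening `φ = arccos (u / R)` the half-chord is `R *
sin φ` and the half-arc `R * φ`, and Jordan's inequality bounds `φ / sin φ` by `π / 2`. -/
theorem arccos_mul_le {R u : ℝ} (hR : 0 < R) (hu0 : 0 ≤ u) (hu1 : u < R) :
    R * (Real.arccos (u / R) / √(R ^ 2 - u ^ 2)) ≤ Real.pi / 2 := by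
  have h0 : 0 ≤ u / R := by positivity
  have h1 : u / R < 1 := (div_lt_one hR).2 hu1
  have hs : √(R ^ 2 - u ^ 2) = R * Real.sin (Real.arccos (u / R)) := by
    rw [Real.sin_arccos]
    have : R ^ 2 - u ^ 2 = R ^ 2 * (1 - (u / R) ^ 2) := by field_simp
    rw [this, Real.sqrt_mul (by positivity), Real.sqrt_sq hR.le]
  have hpos : 0 < Real.sin (Real.arccos (u / R)) := by
    rw [Real.sin_arccos]; exact Real.sqrt_pos.2 (by nlinarith)
  have hj := Real.mul_le_sin (Real.arccos_nonneg (u / R)) (Real.arccos_le_pi_div_two.2 h0)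
  rw [hs, mul_div_assoc', div_le_iff₀ (by positivity)]
  have : Real.arccos (u / R) ≤ Real.pi / 2 * Real.sin (Real.arccos (u / R)) := by
    have hpi := Real.pi_pos
    calc Real.arccos (u / R) = Real.pi / 2 * (2 / Real.pi * Real.arccos (u / R)) := by field_simp
      _ ≤ _ := by gcongr
  nlinarith

/-- On a line of direction `e` the coordinate `h` is constant and the angle is linear in the
position, so lengths are stretched by the ratio of arc to chord. Only the line has to meet the disc;
the two points may lie outside. -/
theorem norm_arcPoint_sub_arcPoint_le {e c v v' : Plane} (he : ‖e‖ = 1) {R : ℝ} (hR : 0 < R)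
    (hvv' : ⟪v - c, perp e⟫_ℝ = ⟪v' - c, perp e⟫_ℝ) (hv : |⟪v - c, perp e⟫_ℝ| < R) :
    ‖arcPoint e c R v - arcPoint e c R v'‖ ≤ Real.pi / 2 * ‖v - v'‖ := by
  simp only [arcPoint]
  rw [← hvv']
  set h := ⟪v - c, perp e⟫_ℝ with hh
  set θ := Real.arccos (|h| / R) * (⟪v - c, e⟫_ℝ / √(R ^ 2 - h ^ 2)) with hθ
  set θ' := Real.arccos (|h| / R) * (⟪v' - c, e⟫_ℝ / √(R ^ 2 - h ^ 2)) with hθ'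
  set S : ℝ := if 0 ≤ h then R else -R with hS
  have hS2 : S ^ 2 = R ^ 2 := by rw [hS]; split_ifs <;> ring
  have e1 : c + (R * Real.sin θ) • e + (S * Real.cos θ) • perp e
      - (c + (R * Real.sin θ') • e + (S * Real.cos θ') • perp e)
      = (R * (Real.sin θ - Real.sin θ')) • e + (S * (Real.cos θ - Real.cos θ')) • perp e := by
    module
  have e2 : ‖(R * (Real.sin θ - Real.sin θ')) • e + (S * (Real.cos θ - Real.cos θ')) • perp e‖
      ≤ R * |θ - θ'| := by
    refine abs_le_of_sq_le_sq' ?_ (by positivity) |>.2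
    rw [norm_sq_add_perp he, mul_pow, mul_pow, mul_pow, hS2, sq_abs]
    have h1 := Real.one_sub_sq_div_two_le_cos (x := θ - θ')
    rw [Real.cos_sub] at h1
    have h2 := Real.sin_sq_add_cos_sq θ
    have h3 := Real.sin_sq_add_cos_sq θ'
    have h4 : (Real.sin θ - Real.sin θ') ^ 2 + (Real.cos θ - Real.cos θ') ^ 2 ≤ (θ - θ') ^ 2 := by
      nlinarith
    nlinarith [sq_nonneg R]
  rw [e1]
  refine e2.trans ?_
  have e3 : θ - θ' = Real.arccos (|h| / R) / √(R ^ 2 - |h| ^ 2) * ⟪v - v', e⟫_ℝ := by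
    have : v - v' = (v - c) - (v' - c) := by abel
    rw [this, inner_sub_left, hθ, hθ', sq_abs]; ring
  have e4 : |⟪v - v', e⟫_ℝ| ≤ ‖v - v'‖ := by
    have := abs_real_inner_le_norm (v - v') e
    rwa [he, mul_one] at this
  have hc0 : 0 ≤ Real.arccos (|h| / R) / √(R ^ 2 - |h| ^ 2) :=
    div_nonneg (Real.arccos_nonneg _) (Real.sqrt_nonneg _)
  rw [e3, abs_mul, abs_of_nonneg hc0, ← mul_assoc]
  exact mul_le_mul (arccos_mul_le hR (abs_nonneg h) hv) e4 (abs_nonneg _) (by positivity)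

/-- At the ends of the chord the angle is `± arccos (|h| / R)`, whose sine and cosine give back the
coordinates of `v - c`. This makes the detour fit the segment continuously. -/
theorem arcPoint_eq_self {e c v : Plane} (he : ‖e‖ = 1) {R : ℝ} (hR : 0 < R)
    (hv : |⟪v - c, perp e⟫_ℝ| < R) (hvc : ‖v - c‖ = R) : arcPoint e c R v = v := by
  have hsq := norm_sq_eq_inner_perp he (v - c)
  rw [hvc] at hsq
  have hdec := decomp_perp he (v - c)
  simp only [arcPoint]
  set h := ⟪v - c, perp e⟫_ℝ with hh
  set a := ⟪v - c, e⟫_ℝ with ha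
  have hr : √(R ^ 2 - h ^ 2) = |a| := by
    rw [hsq, add_sub_cancel_right, Real.sqrt_sq_eq_abs]
  have h1 : |h| / R < 1 := (div_lt_one hR).2 hv
  have h0 : 0 ≤ |h| / R := by positivity
  have ha0 : 0 < |a| := by
    rw [← hr]; refine Real.sqrt_pos.2 ?_
    nlinarith [sq_abs h, abs_nonneg h]
  have hsin : R * Real.sin (Real.arccos (|h| / R)) = |a| := by
    rw [Real.sin_arccos, ← hr]
    have : R ^ 2 - h ^ 2 = R ^ 2 * (1 - (|h| / R) ^ 2) := by
      rw [div_pow, sq_abs]; field_simp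
    rw [this, Real.sqrt_mul (by positivity), Real.sqrt_sq hR.le]
  have hcos : R * Real.cos (Real.arccos (|h| / R)) = |h| := by
    rw [Real.cos_arccos (by linarith) h1.le]; field_simp
  have hS : ∀ x : ℝ, R * x = |h| → (if 0 ≤ h then R else -R) * x = h := by
    intro x hx
    split_ifs with h3
    · rw [hx, abs_of_nonneg h3]
    · rw [neg_mul, hx, abs_of_neg (not_le.1 h3), neg_neg]
  rw [hr]
  rcases abs_cases a with ⟨h2, -⟩ | ⟨h2, -⟩
  · rw [h2] at hsin ha0 ⊢
    rw [div_self ha0.ne', mul_one, hsin, hS _ hcos, add_assoc, ← hdec, add_sub_cancel]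
  · rw [h2] at hsin ha0 ⊢
    have h4 : a / -a = -1 := by
      rw [div_neg, div_self (by linarith : a ≠ 0)]
    rw [h4, mul_neg, mul_one, Real.sin_neg, Real.cos_neg, mul_neg, hsin, neg_neg, hS _ hcos,
      add_assoc, ← hdec, add_sub_cancel]

section

variable {N : ℕ} {p q : Plane} {c : Fin N → Plane} {R : ℝ}

theorem detourPath_of_forall {s : ℝ} (h : ∀ j, R ≤ ‖p + s • (q - p) - c j‖) :
    detourPath p q c R s = p + s • (q - p) := by
  have : ¬ ∃ j, ‖p + s • (q - p) - c j‖ < R := by push Not; exact h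
  simp only [detourPath]
  rw [dif_neg this]

/-- The open discs are disjoint, so the disc selected by `choose` can only be the `j`-th. -/
theorem detourPath_of_mem (hc : ∀ i j, i ≠ j → 2 * R ≤ ‖c i - c j‖) {s : ℝ} {j : Fin N}
    (h : ‖p + s • (q - p) - c j‖ < R) :
    detourPath p q c R s
      = arcPoint (‖q - p‖⁻¹ • (q - p)) (c j) R (p + s • (q - p)) := by
  have H : ∃ j, ‖p + s • (q - p) - c j‖ < R := ⟨j, h⟩
  have hj : H.choose = j := by
    by_contra hne
    have h1 := hc _ _ hne
    have h2 : c H.choose - c j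
        = (p + s • (q - p) - c j) - (p + s • (q - p) - c H.choose) := by abel
    rw [h2] at h1
    linarith [norm_sub_le (p + s • (q - p) - c j) (p + s • (q - p) - c H.choose), H.choose_spec]
  simp only [detourPath]
  rw [dif_pos H, hj]

theorem le_norm_sub_of_mem_circle (hc : ∀ i j, i ≠ j → 2 * R ≤ ‖c i - c j‖) {v : Plane}
    {k : Fin N} (h : ‖v - c k‖ = R) (j : Fin N) : R ≤ ‖v - c j‖ := by
  rcases eq_or_ne j k with rfl | hne
  · exact h.ge
  · have h1 := hc j k hne
    have h2 : c j - c k = (v - c k) - (v - c j) := by abel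
    rw [h2] at h1
    linarith [norm_sub_le (v - c k) (v - c j)]

theorem norm_unitVec (hpq : p ≠ q) : ‖‖q - p‖⁻¹ • (q - p)‖ = 1 := by
  have : ‖q - p‖ ≠ 0 := norm_ne_zero_iff.2 (sub_ne_zero.2 hpq.symm)
  rw [norm_smul, norm_inv, norm_norm, inv_mul_cancel₀ this]

theorem inner_segment_perp (s s' : ℝ) (d : Plane) :
    ⟪p + s • (q - p) - d, perp (‖q - p‖⁻¹ • (q - p))⟫_ℝ
      = ⟪p + s' • (q - p) - d, perp (‖q - p‖⁻¹ • (q - p))⟫_ℝ := by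
  have : ∀ s : ℝ, p + s • (q - p) - d = (p - d) + s • (q - p) := fun s => by abel
  simp only [this, inner_add_left, perp_smul, inner_smul_left, inner_smul_right, inner_perp_self]
  simp

/-- The boundary of a disc is met between a point inside and a point outside. -/
theorem exists_mem_uIcc_circle {s s' : ℝ} {d : Plane} (h : ‖p + s • (q - p) - d‖ < R)
    (h' : R ≤ ‖p + s' • (q - p) - d‖) : ∃ τ ∈ uIcc s s', ‖p + τ • (q - p) - d‖ = R := by
  have hcont : ContinuousOn (fun τ : ℝ => ‖p + τ • (q - p) - d‖) (uIcc s s') := by fun_prop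
  obtain ⟨τ, hτ, hτ'⟩ := intermediate_value_uIcc hcont (Icc_subset_uIcc ⟨h.le, h'⟩)
  exact ⟨τ, hτ, hτ'⟩

theorem norm_segment_sub (s s' : ℝ) :
    ‖(p + s • (q - p)) - (p + s' • (q - p))‖ = ‖q - p‖ * |s - s'| := by
  rw [add_sub_add_left_eq_sub, ← sub_smul, norm_smul, mul_comm, Real.norm_eq_abs]

theorem abs_sub_add_of_mem_uIcc {s τ s' : ℝ} (h : τ ∈ uIcc s s') :
    |s - τ| + |τ - s'| = |s - s'| := by
  rcases mem_uIcc.1 h with ⟨h1, h2⟩ | ⟨h1, h2⟩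
  · rw [abs_of_nonpos (by linarith), abs_of_nonpos (by linarith), abs_of_nonpos (by linarith)]; ring
  · rw [abs_of_nonneg (by linarith), abs_of_nonneg (by linarith), abs_of_nonneg (by linarith)]; ring

/-- If `s` lies in a disc, the segment leaves that disc at some `σ` between `s` and `τ`. The arc
estimate serves from `s` to `σ` and the segment itself from `σ` to `τ`; the two parameter lengths
add up. -/
theorem norm_detourPath_sub_segment_le (hR : 0 < R) (hpq : p ≠ q)
    (hc : ∀ i j, i ≠ j → 2 * R ≤ ‖c i - c j‖) (s : ℝ) {τ : ℝ}
    (hτ : ∀ j, R ≤ ‖p + τ • (q - p) - c j‖) :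
    ‖detourPath p q c R s - (p + τ • (q - p))‖ ≤ Real.pi / 2 * (‖q - p‖ * |s - τ|) := by
  have hpi : 1 ≤ Real.pi / 2 := by linarith [Real.pi_gt_three]
  by_cases hs : ∀ j, R ≤ ‖p + s • (q - p) - c j‖
  · rw [detourPath_of_forall hs, norm_segment_sub]
    exact le_mul_of_one_le_left (by positivity) hpi
  · push Not at hs
    obtain ⟨j, hj⟩ := hs
    have he := norm_unitVec hpq
    have hlt := (abs_inner_perp_le he (p + s • (q - p) - c j)).trans_lt hj
    obtain ⟨σ, hσ, hσ'⟩ := exists_mem_uIcc_circle hj (hτ j)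
    have h1 := norm_arcPoint_sub_arcPoint_le (c := c j) (v := p + s • (q - p))
      (v' := p + σ • (q - p)) he hR (inner_segment_perp _ _ _) hlt
    have hlt' : |⟪p + σ • (q - p) - c j, perp (‖q - p‖⁻¹ • (q - p))⟫_ℝ| < R := by
      rw [inner_segment_perp σ s]; exact hlt
    rw [arcPoint_eq_self he hR hlt' hσ', norm_segment_sub, ← detourPath_of_mem hc hj] at h1
    have h2 : detourPath p q c R s - (p + τ • (q - p)) = (detourPath p q c R s
      - (p + σ • (q - p))) + ((p + σ • (q - p)) - (p + τ • (q - p))) := by abel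
    rw [h2, ← abs_sub_add_of_mem_uIcc hσ]
    refine (norm_add_le _ _).trans ?_
    rw [mul_add, mul_add]
    refine add_le_add h1 ?_
    rw [norm_segment_sub]
    exact le_mul_of_one_le_left (by positivity) hpi

/-- Two parameters in the same disc are compared along the arc. Otherwise an exit point of the
segment from the disc containing one of them lies between them and on no other open disc, so the
previous estimate applies on both sides of it. -/
theorem norm_detourPath_sub_le (hR : 0 < R)
    (hc : ∀ i j, i ≠ j → 2 * R ≤ ‖c i - c j‖) (s s' : ℝ) :
    ‖detourPath p q c R s - detourPath p q c R s'‖ ≤ Real.pi / 2 * ‖q - p‖ * |s - s'| := by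
  rcases eq_or_ne p q with rfl | hpq
  · simp [detourPath]
  rw [mul_assoc]
  by_cases hs' : ∀ j, R ≤ ‖p + s' • (q - p) - c j‖
  · rw [detourPath_of_forall hs']
    exact norm_detourPath_sub_segment_le hR hpq hc s hs'
  · push Not at hs'
    obtain ⟨k, hk⟩ := hs'
    by_cases hs : ‖p + s • (q - p) - c k‖ < R
    · rw [detourPath_of_mem hc hk, detourPath_of_mem hc hs, ← norm_segment_sub]
      exact norm_arcPoint_sub_arcPoint_le (norm_unitVec hpq) hR (inner_segment_perp _ _ _)
        ((abs_inner_perp_le (norm_unitVec hpq) _).trans_lt hs)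
    · obtain ⟨τ, hτ, hτ'⟩ := exists_mem_uIcc_circle hk (not_lt.1 hs)
      have hfree := le_norm_sub_of_mem_circle hc hτ'
      have h1 := norm_detourPath_sub_segment_le hR hpq hc s hfree
      have h2 := norm_detourPath_sub_segment_le hR hpq hc s' hfree
      have h3 : detourPath p q c R s - detourPath p q c R s' = (detourPath p q c R s
        - (p + τ • (q - p))) - (detourPath p q c R s' - (p + τ • (q - p))) := by abel
      rw [h3, ← abs_sub_add_of_mem_uIcc (uIcc_comm s s' ▸ hτ), abs_sub_comm τ s', mul_add, mul_add]
      exact (norm_sub_le _ _).trans (add_le_add h1 h2)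

theorem le_norm_detourPath_sub (hR : 0 < R) (hc : ∀ i j, i ≠ j → 2 * R ≤ ‖c i - c j‖)
    (hp : ∀ j, R ≤ ‖p - c j‖) (s : ℝ) (j : Fin N) : R ≤ ‖detourPath p q c R s - c j‖ := by
  by_cases hs : ∀ j, R ≤ ‖p + s • (q - p) - c j‖
  · rw [detourPath_of_forall hs]; exact hs j
  · push Not at hs
    obtain ⟨k, hk⟩ := hs
    rcases eq_or_ne p q with rfl | hpq
    · simp at hk; exact absurd hk (not_lt.2 (hp k))
    · rw [detourPath_of_mem hc hk]
      exact le_norm_sub_of_mem_circle hc (norm_arcPoint_sub (norm_unitVec hpq) hR.le _) j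

theorem detourPath_zero (hp : ∀ j, R ≤ ‖p - c j‖) : detourPath p q c R 0 = p := by
  rw [detourPath_of_forall (by simpa using hp)]; simp

theorem detourPath_one (hq : ∀ j, R ≤ ‖q - c j‖) : detourPath p q c R 1 = q := by
  rw [detourPath_of_forall (by simpa using hq)]; simp

theorem continuous_detourPath (hR : 0 < R) (hc : ∀ i j, i ≠ j → 2 * R ≤ ‖c i - c j‖) :
    Continuous (detourPath p q c R) :=
  (LipschitzWith.of_dist_le_mul (K := ⟨Real.pi / 2 * ‖q - p‖, by positivity⟩) fun s s' => by
    rw [dist_eq_norm, Real.dist_eq]; exact norm_detourPath_sub_le hR hc s s').continuous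

end

/-! ### Constant speed parametrizations -/

section

variable {f : ℝ → Plane} {K : ℝ}

theorem variationOnFromTo_sub_le (hK : 0 ≤ K) (hf : ∀ s s', ‖f s - f s'‖ ≤ K * |s - s'|)
    {b b' : ℝ} (hb : b ∈ Icc (0 : ℝ) 1) (hb' : b' ∈ Icc (0 : ℝ) 1) (hbb' : b ≤ b') :
    LocallyBoundedVariationOn f (Icc 0 1) ∧
    variationOnFromTo f (Icc 0 1) 0 b' - variationOnFromTo f (Icc 0 1) 0 b ≤ K * (b' - b) ∧
    ‖f b - f b'‖ ≤ variationOnFromTo f (Icc 0 1) 0 b' - variationOnFromTo f (Icc 0 1) 0 b := by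
  have hlip : ∀ s, LipschitzOnWith K.toNNReal f s := fun s =>
    LipschitzOnWith.of_dist_le_mul fun x _ y _ => by
      rw [dist_eq_norm, Real.dist_eq, Real.coe_toNNReal K hK]; exact hf x y
  have hbv : LocallyBoundedVariationOn f (Icc 0 1) := (hlip _).locallyBoundedVariationOn
  refine ⟨hbv, ?_, ?_⟩
  · rw [variationOnFromTo.sub_right hbv ⟨le_rfl, zero_le_one⟩ hb' hb,
      variationOnFromTo.eq_of_le _ _ hbb']
    refine ENNReal.toReal_le_of_le_ofReal (by have := sub_nonneg.2 hbb'; positivity) ?_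
    have h1 := (hlip univ).comp_eVariationOn_le (g := id) (s := Icc 0 1 ∩ Icc b b')
      (fun _ _ => mem_univ _)
    have h2 := eVariationOn_id hb hb'
    rw [h2] at h1
    rw [ENNReal.ofReal_mul hK]
    exact h1
  · rw [variationOnFromTo.sub_right hbv ⟨le_rfl, zero_le_one⟩ hb' hb,
      variationOnFromTo.eq_of_le _ _ hbb', ← dist_eq_norm, dist_edist]
    exact ENNReal.toReal_mono (hbv b b' hb hb')
      (eVariationOn.edist_le f ⟨hb, le_rfl, hbb'⟩ ⟨hb', hbb', le_rfl⟩)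

/-- Arc length is continuous, so by the intermediate value theorem each fraction of the total length
is attained at some `b`. Hence a constant-speed curve visits only points of `f`, and distance bounds
carry over to it. -/
theorem exists_naturalParameterization_eq (hK : 0 ≤ K)
    (hf : ∀ s s', ‖f s - f s'‖ ≤ K * |s - s'|) {u : ℝ} (hu : u ∈ Icc (0 : ℝ) 1) :
    ∃ b ∈ Icc (0 : ℝ) 1, variationOnFromTo f (Icc 0 1) 0 b
        = u * variationOnFromTo f (Icc 0 1) 0 1 ∧
      naturalParameterization f (Icc 0 1) 0 (u * variationOnFromTo f (Icc 0 1) 0 1) = f b := by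
  set V := variationOnFromTo f (Icc 0 1) 0 with hV
  have h01 : (0 : ℝ) ∈ Icc (0 : ℝ) 1 := ⟨le_rfl, zero_le_one⟩
  have h11 : (1 : ℝ) ∈ Icc (0 : ℝ) 1 := ⟨zero_le_one, le_rfl⟩
  have hbv := (variationOnFromTo_sub_le hK hf h01 h11 zero_le_one).1
  have hmono : MonotoneOn V (Icc 0 1) := variationOnFromTo.monotoneOn hbv h01
  have hV0 : V 0 = 0 := variationOnFromTo.self _ _ _
  have hV1 : 0 ≤ V 1 := hV0 ▸ hmono h01 h11 zero_le_one
  have hVc : ContinuousOn V (Icc 0 1) := by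
    refine LipschitzOnWith.continuousOn (K := ⟨K, hK⟩)
      (LipschitzOnWith.of_dist_le_mul fun x hx y hy => ?_)
    rw [Real.dist_eq, Real.dist_eq]
    rcases le_total x y with h | h
    · rw [abs_sub_comm, abs_of_nonneg (sub_nonneg.2 (hmono hx hy h)), abs_sub_comm,
        abs_of_nonneg (sub_nonneg.2 h)]
      exact (variationOnFromTo_sub_le hK hf hx hy h).2.1
    · rw [abs_of_nonneg (sub_nonneg.2 (hmono hy hx h)), abs_of_nonneg (sub_nonneg.2 h)]
      exact (variationOnFromTo_sub_le hK hf hy hx h).2.1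
  obtain ⟨b, hb, hb'⟩ := intermediate_value_Icc zero_le_one hVc
    (show u * V 1 ∈ Icc (V 0) (V 1) by
      rw [hV0]; exact ⟨mul_nonneg hu.1 hV1, mul_le_of_le_one_left hV1 hu.2⟩)
  refine ⟨b, hb, hb', ?_⟩
  rw [← hb']
  exact edist_eq_zero.1 (edist_naturalParameterization_eq_zero hbv h01 hb)

/-- The constant speed is the total length, which is at most `K`, and arc length dominates distance.
-/
theorem norm_naturalParameterization_sub_le (hK : 0 ≤ K)
    (hf : ∀ s s', ‖f s - f s'‖ ≤ K * |s - s'|) {u u' : ℝ} (hu : u ∈ Icc (0 : ℝ) 1)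
    (hu' : u' ∈ Icc (0 : ℝ) 1) :
    ‖naturalParameterization f (Icc 0 1) 0 (u * variationOnFromTo f (Icc 0 1) 0 1)
      - naturalParameterization f (Icc 0 1) 0 (u' * variationOnFromTo f (Icc 0 1) 0 1)‖
      ≤ K * |u - u'| := by
  obtain ⟨b, hb, h1, h2⟩ := exists_naturalParameterization_eq hK hf hu
  obtain ⟨b', hb', h1', h2'⟩ := exists_naturalParameterization_eq hK hf hu'
  have h01 : (0 : ℝ) ∈ Icc (0 : ℝ) 1 := ⟨le_rfl, zero_le_one⟩
  have h11 : (1 : ℝ) ∈ Icc (0 : ℝ) 1 := ⟨zero_le_one, le_rfl⟩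
  have hV := variationOnFromTo_sub_le hK hf h01 h11 zero_le_one
  have hV1 : variationOnFromTo f (Icc 0 1) 0 1 ≤ K := by
    have := hV.2.1
    rwa [variationOnFromTo.self, sub_zero, sub_zero, mul_one] at this
  have hV0 : 0 ≤ variationOnFromTo f (Icc 0 1) 0 1 :=
    variationOnFromTo.nonneg_of_le _ _ zero_le_one
  rw [h2, h2']
  have key : ∀ {b b' u u' : ℝ}, b ∈ Icc (0 : ℝ) 1 → b' ∈ Icc (0 : ℝ) 1 → b ≤ b' →
      variationOnFromTo f (Icc 0 1) 0 b = u * variationOnFromTo f (Icc 0 1) 0 1 →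
      variationOnFromTo f (Icc 0 1) 0 b' = u' * variationOnFromTo f (Icc 0 1) 0 1 →
      ‖f b - f b'‖ ≤ K * |u - u'| := by
    intro b b' u u' hb hb' h h1 h1'
    refine (variationOnFromTo_sub_le hK hf hb hb' h).2.2.trans ?_
    rw [h1, h1', ← sub_mul, abs_sub_comm, mul_comm]
    exact (mul_le_mul_of_nonneg_left (le_abs_self _) hV0).trans (by gcongr)
  rcases le_total b b' with h | h
  · exact key hb hb' h h1 h1'
  · rw [norm_sub_rev, abs_sub_comm]; exact key hb' hb h h1' h1

theorem naturalParameterization_zero (hK : 0 ≤ K) (hf : ∀ s s', ‖f s - f s'‖ ≤ K * |s - s'|) :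
    naturalParameterization f (Icc 0 1) 0 (0 * variationOnFromTo f (Icc 0 1) 0 1) = f 0 := by
  have h01 : (0 : ℝ) ∈ Icc (0 : ℝ) 1 := ⟨le_rfl, zero_le_one⟩
  have hbv := (variationOnFromTo_sub_le hK hf h01 h01 le_rfl).1
  have h := edist_eq_zero.1 (edist_naturalParameterization_eq_zero hbv h01 h01)
  rw [variationOnFromTo.self] at h
  rw [zero_mul, h]

theorem naturalParameterization_one (hK : 0 ≤ K) (hf : ∀ s s', ‖f s - f s'‖ ≤ K * |s - s'|) :
    naturalParameterization f (Icc 0 1) 0 (1 * variationOnFromTo f (Icc 0 1) 0 1) = f 1 := by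
  have h01 : (0 : ℝ) ∈ Icc (0 : ℝ) 1 := ⟨le_rfl, zero_le_one⟩
  have h11 : (1 : ℝ) ∈ Icc (0 : ℝ) 1 := ⟨zero_le_one, le_rfl⟩
  have hbv := (variationOnFromTo_sub_le hK hf h01 h01 le_rfl).1
  rw [one_mul]
  exact edist_eq_zero.1 (edist_naturalParameterization_eq_zero hbv h01 h11)

end

/-! ### Transition curves -/

section

variable {N : ℕ} {p q : Plane} {c : Fin N → Plane} {R t₁ t₂ : ℝ}

theorem transitionCurve_left (hR : 0 < R) (hc : ∀ i j, i ≠ j → 2 * R ≤ ‖c i - c j‖)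
    (hp : ∀ j, R ≤ ‖p - c j‖) : transitionCurve p q c R t₁ t₂ t₁ = p := by
  rw [transitionCurve, sub_self, zero_div, naturalParameterization_zero
    (K := Real.pi / 2 * ‖q - p‖) (by positivity) (norm_detourPath_sub_le hR hc),
    detourPath_zero hp]

theorem transitionCurve_right (hR : 0 < R) (hc : ∀ i j, i ≠ j → 2 * R ≤ ‖c i - c j‖)
    (hq : ∀ j, R ≤ ‖q - c j‖) (ht : t₁ < t₂) : transitionCurve p q c R t₁ t₂ t₂ = q := by
  rw [transitionCurve, div_self (sub_pos.2 ht).ne', naturalParameterization_one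
    (K := Real.pi / 2 * ‖q - p‖) (by positivity) (norm_detourPath_sub_le hR hc),
    detourPath_one hq]

theorem div_mem_unitInterval {t : ℝ} (ht : t₁ < t₂) (h : t ∈ Icc t₁ t₂) :
    (t - t₁) / (t₂ - t₁) ∈ Icc (0 : ℝ) 1 := by
  have h0 := sub_pos.2 ht
  exact ⟨div_nonneg (by linarith [h.1]) h0.le, (div_le_one h0).2 (by linarith [h.2])⟩

theorem le_norm_transitionCurve_sub (hR : 0 < R) (hc : ∀ i j, i ≠ j → 2 * R ≤ ‖c i - c j‖)
    (hp : ∀ j, R ≤ ‖p - c j‖) (ht : t₁ < t₂) {t : ℝ} (h : t ∈ Icc t₁ t₂) (j : Fin N) :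
    R ≤ ‖transitionCurve p q c R t₁ t₂ t - c j‖ := by
  obtain ⟨b, -, -, hb⟩ := exists_naturalParameterization_eq (K := Real.pi / 2 * ‖q - p‖)
    (by positivity) (norm_detourPath_sub_le (p := p) (q := q) hR hc) (div_mem_unitInterval ht h)
  rw [transitionCurve, hb]
  exact le_norm_detourPath_sub hR hc hp b j

theorem norm_transitionCurve_sub_le (hR : 0 < R) (hc : ∀ i j, i ≠ j → 2 * R ≤ ‖c i - c j‖)
    (ht : t₁ < t₂) {t t' : ℝ} (h : t ∈ Icc t₁ t₂) (h' : t' ∈ Icc t₁ t₂) :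
    ‖transitionCurve p q c R t₁ t₂ t - transitionCurve p q c R t₁ t₂ t'‖
      ≤ 2 * ‖q - p‖ / (t₂ - t₁) * |t - t'| := by
  have h0 := sub_pos.2 ht
  refine (norm_naturalParameterization_sub_le (K := Real.pi / 2 * ‖q - p‖)
    (by positivity) (norm_detourPath_sub_le hR hc) (div_mem_unitInterval ht h)
    (div_mem_unitInterval ht h')).trans ?_
  rw [← sub_div, sub_sub_sub_cancel_right, abs_div, abs_of_pos h0]
  have : Real.pi / 2 ≤ 2 := by linarith [Real.pi_le_four]
  calc Real.pi / 2 * ‖q - p‖ * (|t - t'| / (t₂ - t₁))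
      ≤ 2 * ‖q - p‖ * (|t - t'| / (t₂ - t₁)) := by gcongr
    _ = _ := by ring

end

/-! ### The oscillating control -/

/-- Reference trajectories and controls, bounded and Lipschitz, that keep their distances. -/
structure IsSeparatedReference {N : ℕ} (T r M B : ℝ) (y : Fin N → ℝ → Plane)
    (xb : ℝ → Fin N → Plane) : Prop where
  time_pos : 0 < T
  radius_pos : 0 < r
  speed_nonneg : 0 ≤ B
  control_lip : ∀ k, ∀ s ∈ Icc 0 T, ∀ t ∈ Icc 0 T, ‖y k s - y k t‖ ≤ M * |s - t|
  control_le : ∀ k, ∀ t ∈ Icc 0 T, ‖y k t‖ ≤ M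
  vortex_lip : ∀ j, ∀ s ∈ Icc 0 T, ∀ t ∈ Icc 0 T, ‖xb s j - xb t j‖ ≤ B * |s - t|
  control_dist : ∀ t ∈ Icc 0 T, ∀ j k, 2 * r ≤ ‖y k t - xb t j‖
  vortex_dist : ∀ t ∈ Icc 0 T, ∀ i j, i ≠ j → 4 * r ≤ ‖xb t i - xb t j‖

theorem norm_sub_le_of_Icc_union {f : ℝ → Plane} {Λ a b c : ℝ}
    (h1 : ∀ s ∈ Icc a b, ∀ t ∈ Icc a b, ‖f s - f t‖ ≤ Λ * |s - t|)
    (h2 : ∀ s ∈ Icc b c, ∀ t ∈ Icc b c, ‖f s - f t‖ ≤ Λ * |s - t|) :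
    ∀ s ∈ Icc a c, ∀ t ∈ Icc a c, ‖f s - f t‖ ≤ Λ * |s - t| := by
  have key : ∀ s ∈ Icc a c, ∀ t ∈ Icc a c, s ≤ t → ‖f s - f t‖ ≤ Λ * |s - t| := by
    intro s hs t ht hst
    rcases le_total t b with htb | hbt
    · exact h1 s ⟨hs.1, hst.trans htb⟩ t ⟨ht.1, htb⟩
    rcases le_total s b with hsb | hbs
    · have e1 := h1 s ⟨hs.1, hsb⟩ b ⟨hs.1.trans hsb, le_rfl⟩
      have e2 := h2 b ⟨le_rfl, hbt.trans ht.2⟩ t ⟨hbt, ht.2⟩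
      rw [← abs_sub_add_of_mem_uIcc (show b ∈ uIcc s t from mem_uIcc.2 (Or.inl ⟨hsb, hbt⟩)),
        mul_add, ← sub_add_sub_cancel (f s) (f b) (f t)]
      exact (norm_add_le _ _).trans (add_le_add e1 e2)
    · exact h2 s ⟨hbs, hs.2⟩ t ⟨hbt, ht.2⟩
  intro s hs t ht
  rcases le_total s t with h | h
  · exact key s hs t ht h
  · rw [norm_sub_rev, abs_sub_comm]; exact key t ht s hs h

section

variable {N : ℕ} [NeZero N] {T r M B : ℝ} {y : Fin N → ℝ → Plane} {xb : ℝ → Fin N → Plane}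
  {n : ℕ}

theorem oscControl_clamp (t : ℝ) (hT : 0 ≤ T) :
    oscControl T r y xb n t = oscControl T r y xb n (max 0 (min t T)) := by
  have : max 0 (min (max 0 (min t T)) T) = max 0 (min t T) := by
    rw [min_eq_left (max_le hT (min_le_right _ _)), max_eq_right (le_max_left _ _)]
  simp only [oscControl, this]

theorem clamp_eq_self {t : ℝ} (ht : t ∈ Icc 0 T) : max 0 (min t T) = t := by
  rw [min_eq_left ht.2, max_eq_right ht.1]

theorem oscControl_apply {t : ℝ} (ht : t ∈ Icc 0 T) {δ θ : ℝ} (hδ : δ = T / (n * N))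
    (hθ : θ = δ / (2 * n)) {m : ℕ} (hm : ⌊t / δ + 1 / 2⌋₊ = m) :
    oscControl T r y xb n t = if 0 < m ∧ m < n * N ∧ t ∈ Icc (m * δ - θ) (m * δ + θ) then
        transitionCurve (cyc y (m - 1) (m * δ - θ)) (cyc y m (m * δ + θ)) (xb (m * δ - θ))
          (3 * r / 2) (m * δ - θ) (m * δ + θ) t
      else cyc y (min ⌊t / δ⌋₊ (n * N - 1)) t := by
  subst hθ hδ hm
  simp only [oscControl, clamp_eq_self ht]

/-- The number of slots times their length. -/
theorem slots_mul_length (hn : 2 ≤ n) {δ : ℝ} (hδ : δ = T / (n * N)) :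
    ((n * N : ℕ) : ℝ) * δ = T := by
  have hN : (N : ℝ) ≠ 0 := by exact_mod_cast NeZero.ne N
  have hn' : (n : ℝ) ≠ 0 := by positivity
  rw [hδ]; push_cast; field_simp

namespace IsSeparatedReference

theorem lip_nonneg (h : IsSeparatedReference T r M B y xb) : 0 ≤ M :=
  (norm_nonneg _).trans (h.control_le ⟨0, NeZero.pos N⟩ 0 ⟨le_rfl, h.time_pos.le⟩)

theorem length_pos (h : IsSeparatedReference T r M B y xb) (hn : 2 ≤ n) {δ θ : ℝ}
    (hδ : δ = T / (n * N)) (hθ : θ = δ / (2 * n)) :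
    0 < δ ∧ 0 < θ ∧ 4 * θ ≤ δ ∧ 2 * θ ≤ T / n := by
  have hN : (1 : ℝ) ≤ N := by exact_mod_cast NeZero.pos N
  have hn' : (2 : ℝ) ≤ n := by exact_mod_cast hn
  have hT := h.time_pos
  have h0 : 0 < δ := by rw [hδ]; positivity
  have h1 : 4 * θ ≤ δ := by
    rw [hθ, mul_div_assoc', div_le_iff₀ (by positivity)]; nlinarith
  have h2 : δ ≤ T / n := by
    rw [hδ]; gcongr; nlinarith
  have h3 : 0 < θ := by rw [hθ]; positivity
  exact ⟨h0, h3, h1, by linarith⟩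

theorem mem_Icc_of_slot (h : IsSeparatedReference T r M B y xb) (hn : 2 ≤ n) {δ : ℝ}
    (hδ : δ = T / (n * N)) {m : ℕ} (hm : m < n * N) {t : ℝ} (ht : t ∈ Icc (m * δ) ((m + 1) * δ)) :
    t ∈ Icc 0 T := by
  obtain ⟨h0, -⟩ := h.length_pos hn hδ rfl
  refine ⟨le_trans (by positivity) ht.1, ht.2.trans ?_⟩
  rw [← slots_mul_length hn hδ]
  gcongr
  exact_mod_cast hm

/-- The geometry of the transition around an interior grid point. -/
theorem transition_data (h : IsSeparatedReference T r M B y xb) (hn : 2 ≤ n)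
    (hB : B * (T / n) ≤ r / 8) {δ θ : ℝ} (hδ : δ = T / (n * N)) (hθ : θ = δ / (2 * n)) {m : ℕ}
    (hm0 : 0 < m) (hm : m < n * N) :
    m * δ - θ ∈ Icc 0 T ∧ m * δ + θ ∈ Icc 0 T ∧
    (∀ i j, i ≠ j → 2 * (3 * r / 2) ≤ ‖xb (m * δ - θ) i - xb (m * δ - θ) j‖) ∧
    (∀ j, 3 * r / 2 ≤ ‖cyc y (m - 1) (m * δ - θ) - xb (m * δ - θ) j‖) ∧
    (∀ j, 3 * r / 2 ≤ ‖cyc y m (m * δ + θ) - xb (m * δ - θ) j‖) := by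
  obtain ⟨h0, h1, h2, h3⟩ := h.length_pos hn hδ hθ
  have hr := h.radius_pos
  have hm1 : (1 : ℝ) ≤ m := by exact_mod_cast hm0
  have hm2 : (m : ℝ) + 1 ≤ (n * N : ℕ) := by exact_mod_cast hm
  have hmT : ((m : ℝ) + 1) * δ ≤ T := by rw [← slots_mul_length hn hδ]; gcongr
  have ht1 : m * δ - θ ∈ Icc 0 T := ⟨by nlinarith, by nlinarith⟩
  have ht2 : m * δ + θ ∈ Icc 0 T := ⟨by nlinarith, by nlinarith⟩
  refine ⟨ht1, ht2, fun i j hij => ?_, fun j => ?_, fun j => ?_⟩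
  · linarith [h.vortex_dist _ ht1 i j hij]
  · exact le_trans (by linarith) (h.control_dist _ ht1 j (Fin.ofNat N (m - 1)))
  · have e1 := h.control_dist _ ht2 j (Fin.ofNat N m)
    have e2 := h.vortex_lip j _ ht1 _ ht2
    have e3 : |(m * δ - θ) - (m * δ + θ)| ≤ T / n := by
      rw [abs_le]; constructor <;> linarith
    have e4 := mul_le_mul_of_nonneg_left e3 h.speed_nonneg
    have e5 : cyc y m (m * δ + θ) - xb (m * δ + θ) j
        = (cyc y m (m * δ + θ) - xb (m * δ - θ) j) + (xb (m * δ - θ) j - xb (m * δ + θ) j) := by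
      abel
    change 2 * r ≤ ‖cyc y m (m * δ + θ) - xb (m * δ + θ) j‖ at e1
    rw [e5] at e1
    linarith [norm_add_le (cyc y m (m * δ + θ) - xb (m * δ - θ) j)
      (xb (m * δ - θ) j - xb (m * δ + θ) j)]

theorem oscControl_eq_transition (h : IsSeparatedReference T r M B y xb) (hn : 2 ≤ n)
    {δ θ : ℝ} (hδ : δ = T / (n * N)) (hθ : θ = δ / (2 * n)) {m : ℕ}
    (hm0 : 0 < m) (hm : m < n * N) {t : ℝ} (ht : t ∈ Icc (m * δ - θ) (m * δ + θ)) :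
    oscControl T r y xb n t = transitionCurve (cyc y (m - 1) (m * δ - θ)) (cyc y m (m * δ + θ))
      (xb (m * δ - θ)) (3 * r / 2) (m * δ - θ) (m * δ + θ) t := by
  obtain ⟨h0, h1, h2, h3⟩ := h.length_pos hn hδ hθ
  have hm1 : (1 : ℝ) ≤ m := by exact_mod_cast hm0
  have hm2 : (m : ℝ) + 1 ≤ (n * N : ℕ) := by exact_mod_cast hm
  have hmT : ((m : ℝ) + 1) * δ ≤ T := by rw [← slots_mul_length hn hδ]; gcongr
  have ht0 : 0 ≤ t := by nlinarith [ht.1]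
  have htT : t ∈ Icc 0 T := ⟨ht0, by nlinarith [ht.2]⟩
  have hfl : ⌊t / δ + 1 / 2⌋₊ = m := by
    rw [Nat.floor_eq_iff (by positivity)]
    constructor
    · have : (m : ℝ) - 1 / 2 ≤ t / δ := by rw [le_div_iff₀ h0]; nlinarith [ht.1]
      linarith
    · have : t / δ < m + 1 / 2 := by rw [div_lt_iff₀ h0]; nlinarith [ht.2]
      linarith
  rw [oscControl_apply htT hδ hθ hfl, if_pos ⟨hm0, hm, ht⟩]

/-- Both ends of the core of a slot are included, since the transition curves have the right end
values. The first slot has no transition on its left and the last one none on its right. -/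
theorem oscControl_eq_cyc (h : IsSeparatedReference T r M B y xb) (hn : 2 ≤ n)
    (hB : B * (T / n) ≤ r / 8) {δ θ : ℝ} (hδ : δ = T / (n * N)) (hθ : θ = δ / (2 * n)) {m : ℕ}
    (hm : m < n * N) {t : ℝ} (ht : t ∈ Icc (m * δ) ((m + 1) * δ)) (hl : m = 0 ∨ m * δ + θ ≤ t)
    (hu : m + 1 = n * N ∨ t ≤ (m + 1) * δ - θ) :
    oscControl T r y xb n t = cyc y m t := by
  obtain ⟨h0, h1, h2, h3⟩ := h.length_pos hn hδ hθ
  have hr := h.radius_pos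
  have htT := h.mem_Icc_of_slot hn hδ hm ht
  have hmt : (m : ℝ) ≤ t / δ := by rw [le_div_iff₀ h0]; exact ht.1
  have hmt' : t / δ ≤ m + 1 := by rw [div_le_iff₀ h0]; exact ht.2
  have hu0 : 0 ≤ t / δ := div_nonneg htT.1 h0.le
  rw [oscControl_apply htT hδ hθ rfl]
  have hfl : ⌊t / δ + 1 / 2⌋₊ = m ∨ ⌊t / δ + 1 / 2⌋₊ = m + 1 := by
    have e1 : m ≤ ⌊t / δ + 1 / 2⌋₊ := Nat.le_floor (by linarith)
    have e2 : ⌊t / δ + 1 / 2⌋₊ < m + 2 := by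
      rw [Nat.floor_lt (by positivity)]; push_cast; linarith
    omega
  split_ifs with hc
  · rcases hfl with hf | hf
    · rw [hf] at hc ⊢
      have hm0 := hc.1
      have hte : t = m * δ + θ := le_antisymm hc.2.2.2 (hl.resolve_left hm0.ne')
      obtain ⟨-, -, d1, d2, d3⟩ := h.transition_data hn hB hδ hθ hm0 hm
      rw [hte, transitionCurve_right (by linarith) d1 d3 (by linarith)]
    · rw [hf] at hc ⊢
      obtain ⟨-, -, d1, d2, d3⟩ := h.transition_data hn hB hδ hθ hc.1 hc.2.1
      have hte : t = (m + 1 : ℕ) * δ - θ := by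
        refine le_antisymm ?_ hc.2.2.1
        push_cast
        exact hu.resolve_left (by omega)
      rw [hte, transitionCurve_left (by linarith) d1 d2, Nat.add_sub_cancel]
  · rcases hmt'.lt_or_eq with hlt | heq
    · have : ⌊t / δ⌋₊ = m := (Nat.floor_eq_iff hu0).2 ⟨hmt, hlt⟩
      rw [this, min_eq_left (by omega)]
    -- This happens only at `t = T`, where the `min` in `oscControl` brings the index back to the
    -- last slot.
    · have hte : t = (m + 1) * δ := by rw [← heq]; field_simp
      have hlast : m + 1 = n * N := hu.resolve_right (by rw [hte]; linarith)
      have : ⌊t / δ⌋₊ = m + 1 := by rw [heq]; exact_mod_cast Nat.floor_natCast (m + 1)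
      rw [this, ← hlast]; simp

/-- The end points are at most `2 * M` apart, the detour at most doubles this, and the transition
lasts `2 * θ = T / (n² * N)`. The resulting speed `O(n²)` is what the mollification at scale `1 /
n³` is designed for. -/
theorem norm_oscControl_sub_le_transition (h : IsSeparatedReference T r M B y xb) (hn : 2 ≤ n)
    (hB : B * (T / n) ≤ r / 8) {δ θ : ℝ} (hδ : δ = T / (n * N)) (hθ : θ = δ / (2 * n)) {m : ℕ}
    (hm0 : 0 < m) (hm : m < n * N) :
    ∀ s ∈ Icc (m * δ - θ) (m * δ + θ), ∀ t ∈ Icc (m * δ - θ) (m * δ + θ),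
      ‖oscControl T r y xb n s - oscControl T r y xb n t‖
        ≤ (M + 4 * M * n ^ 2 * N / T) * |s - t| := by
  intro s hs t ht
  obtain ⟨h0, h1, h2, h3⟩ := h.length_pos hn hδ hθ
  have hr := h.radius_pos
  have hM := h.lip_nonneg
  have hN : (0 : ℝ) < N := by exact_mod_cast NeZero.pos N
  have hn' : (0 : ℝ) < n := by positivity
  obtain ⟨e1, e2, d1, d2, d3⟩ := h.transition_data hn hB hδ hθ hm0 hm
  rw [h.oscControl_eq_transition hn hδ hθ hm0 hm hs, h.oscControl_eq_transition hn hδ hθ hm0 hm ht]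
  refine (norm_transitionCurve_sub_le (by linarith) d1 (by linarith) hs ht).trans ?_
  gcongr
  have e3 : ‖cyc y m (m * δ + θ) - cyc y (m - 1) (m * δ - θ)‖ ≤ 2 * M := by
    refine (norm_sub_le _ _).trans ?_
    have a1 := h.control_le (Fin.ofNat N m) _ e2
    have a2 := h.control_le (Fin.ofNat N (m - 1)) _ e1
    simp only [cyc]
    linarith
  calc 2 * ‖cyc y m (m * δ + θ) - cyc y (m - 1) (m * δ - θ)‖ / (m * δ + θ - (m * δ - θ))
      ≤ 2 * (2 * M) / (m * δ + θ - (m * δ - θ)) := by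
        gcongr; linarith
    _ = 4 * M * n ^ 2 * N / T := by
        have hT := h.time_pos
        have : m * δ + θ - (m * δ - θ) = T / (n ^ 2 * N) := by
          rw [hθ, hδ]; field_simp; ring
        rw [this]; field_simp; ring
    _ ≤ _ := by linarith

theorem norm_oscControl_sub_le_plain (h : IsSeparatedReference T r M B y xb) (hn : 2 ≤ n)
    (hB : B * (T / n) ≤ r / 8) {δ θ : ℝ} (hδ : δ = T / (n * N)) (hθ : θ = δ / (2 * n)) {m : ℕ}
    (hm : m < n * N) {a b : ℝ} (ha : m * δ ≤ a) (hb : b ≤ (m + 1) * δ)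
    (hl : m = 0 ∨ m * δ + θ ≤ a) (hu : m + 1 = n * N ∨ b ≤ (m + 1) * δ - θ) :
    ∀ s ∈ Icc a b, ∀ t ∈ Icc a b, ‖oscControl T r y xb n s - oscControl T r y xb n t‖
        ≤ (M + 4 * M * n ^ 2 * N / T) * |s - t| := by
  intro s hs t ht
  have hM := h.lip_nonneg
  have hT := h.time_pos
  have hslot : ∀ t ∈ Icc a b, t ∈ Icc (m * δ) ((m + 1) * δ) ∧
      oscControl T r y xb n t = cyc y m t := by
    intro t ht
    have ht' : t ∈ Icc (m * δ) ((m + 1) * δ) := ⟨ha.trans ht.1, ht.2.trans hb⟩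
    exact ⟨ht', h.oscControl_eq_cyc hn hB hδ hθ hm ht' (hl.imp_right fun e => e.trans ht.1)
      (hu.imp_right fun e => ht.2.trans e)⟩
  rw [(hslot s hs).2, (hslot t ht).2]
  refine (h.control_lip _ s (h.mem_Icc_of_slot hn hδ hm (hslot s hs).1) t
    (h.mem_Icc_of_slot hn hδ hm (hslot t ht).1)).trans ?_
  gcongr
  have : 0 ≤ 4 * M * n ^ 2 * N / T := by positivity
  linarith

theorem norm_oscControl_sub_le_Icc (h : IsSeparatedReference T r M B y xb) (hn : 2 ≤ n)
    (hB : B * (T / n) ≤ r / 8) :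
    ∀ s ∈ Icc 0 T, ∀ t ∈ Icc 0 T, ‖oscControl T r y xb n s - oscControl T r y xb n t‖
        ≤ (M + 4 * M * n ^ 2 * N / T) * |s - t| := by
  obtain ⟨δ, hδ⟩ : ∃ δ, δ = T / (n * N) := ⟨_, rfl⟩
  obtain ⟨θ, hθ⟩ : ∃ θ, θ = δ / (2 * n) := ⟨_, rfl⟩
  obtain ⟨h0, h1, h2, h3⟩ := h.length_pos hn hδ hθ
  have hnN : 2 ≤ n * N := le_trans hn (Nat.le_mul_of_pos_right n (NeZero.pos N))
  have key : ∀ m : ℕ, 0 < m → m < n * N → ∀ s ∈ Icc 0 (m * δ - θ), ∀ t ∈ Icc 0 (m * δ - θ),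
      ‖oscControl T r y xb n s - oscControl T r y xb n t‖
        ≤ (M + 4 * M * n ^ 2 * N / T) * |s - t| := by
    intro m hm0
    induction m, hm0 using Nat.le_induction with
    | base =>
      intro hm
      refine h.norm_oscControl_sub_le_plain hn hB hδ hθ (m := 0) (by omega) (by simp) ?_
        (Or.inl rfl) (Or.inr ?_) <;> push_cast <;> linarith
    | succ m hm0 ih =>
      intro hm
      refine norm_sub_le_of_Icc_union (norm_sub_le_of_Icc_union (ih (by omega))
        (h.norm_oscControl_sub_le_transition hn hB hδ hθ hm0 (by omega))) ?_
      refine h.norm_oscControl_sub_le_plain hn hB hδ hθ (m := m) (by omega) (by linarith) ?_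
        (Or.inr le_rfl) (Or.inr ?_) <;> push_cast <;> linarith
  have hL : ((n * N - 1 : ℕ) : ℝ) + 1 = (n * N : ℕ) := by
    have : n * N - 1 + 1 = n * N := by omega
    exact_mod_cast this
  refine norm_sub_le_of_Icc_union (norm_sub_le_of_Icc_union (key (n * N - 1) (by omega) (by omega))
    (h.norm_oscControl_sub_le_transition hn hB hδ hθ (by omega) (by omega))) ?_
  refine h.norm_oscControl_sub_le_plain hn hB hδ hθ (m := n * N - 1) (by omega) (by linarith) ?_
    (Or.inr le_rfl) (Or.inl (by omega))
  rw [hL, slots_mul_length hn hδ]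

/-- The oscillating control is Lipschitz. -/
theorem norm_oscControl_sub_le (h : IsSeparatedReference T r M B y xb) (hn : 2 ≤ n)
    (hB : B * (T / n) ≤ r / 8) (s t : ℝ) :
    ‖oscControl T r y xb n s - oscControl T r y xb n t‖
        ≤ (M + 4 * M * n ^ 2 * N / T) * |s - t| := by
  have hM := h.lip_nonneg
  have hT := h.time_pos
  have hmem : ∀ t : ℝ, max 0 (min t T) ∈ Icc 0 T := fun t =>
    ⟨le_max_left _ _, max_le hT.le (min_le_right _ _)⟩
  rw [oscControl_clamp s hT.le, oscControl_clamp t hT.le]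
  refine (h.norm_oscControl_sub_le_Icc hn hB _ (hmem s) _ (hmem t)).trans ?_
  refine mul_le_mul_of_nonneg_left ?_ (by positivity)
  have h1 := abs_max_sub_max_le_max 0 (min s T) 0 (min t T)
  have h2 := abs_min_sub_min_le_max s T t T
  rw [sub_self, abs_zero, max_eq_right (abs_nonneg (min s T - min t T))] at h1
  rw [sub_self, abs_zero, max_eq_left (abs_nonneg (s - t))] at h2
  exact h1.trans h2

theorem continuous_oscControl (h : IsSeparatedReference T r M B y xb) (hn : 2 ≤ n)
    (hB : B * (T / n) ≤ r / 8) : Continuous (oscControl T r y xb n) := by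
  have hM := h.lip_nonneg
  have hT := h.time_pos
  have h0 : 0 ≤ M + 4 * M * n ^ 2 * N / T := by positivity
  refine (LipschitzWith.of_dist_le_mul (K := Real.toNNReal (M + 4 * M * n ^ 2 * N / T))
    fun s t => ?_).continuous
  rw [dist_eq_norm, Real.dist_eq, Real.coe_toNNReal _ h0]
  exact h.norm_oscControl_sub_le hn hB s t

/-- The oscillating control keeps its distance from the vortices. -/
theorem le_norm_oscControl_sub (h : IsSeparatedReference T r M B y xb) (hn : 2 ≤ n)
    (hB : B * (T / n) ≤ r / 8) {t : ℝ} (ht : t ∈ Icc 0 T) (j : Fin N) :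
    11 * r / 8 ≤ ‖oscControl T r y xb n t - xb t j‖ := by
  obtain ⟨δ, hδ⟩ : ∃ δ, δ = T / (n * N) := ⟨_, rfl⟩
  obtain ⟨θ, hθ⟩ : ∃ θ, θ = δ / (2 * n) := ⟨_, rfl⟩
  obtain ⟨h0, h1, h2, h3⟩ := h.length_pos hn hδ hθ
  have hr := h.radius_pos
  have hnN : 2 ≤ n * N := le_trans hn (Nat.le_mul_of_pos_right n (NeZero.pos N))
  -- The avoided discs are frozen at the beginning of the transition. A vortex moves by at most `r /
  -- 8` meanwhile, which reduces `3 * r / 2` to `11 * r / 8`.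
  have htrans : ∀ m : ℕ, 0 < m → m < n * N → t ∈ Icc (m * δ - θ) (m * δ + θ) →
      11 * r / 8 ≤ ‖oscControl T r y xb n t - xb t j‖ := by
    intro m hm0 hm htm
    obtain ⟨e1, e2, d1, d2, d3⟩ := h.transition_data hn hB hδ hθ hm0 hm
    rw [h.oscControl_eq_transition hn hδ hθ hm0 hm htm]
    have a1 := le_norm_transitionCurve_sub (q := cyc y m (m * δ + θ)) (by linarith) d1 d2
      (by linarith) htm j
    have a2 := h.vortex_lip j _ ht _ e1
    have a3 : |t - (m * δ - θ)| ≤ T / n := by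
      rw [abs_of_nonneg (by linarith [htm.1])]; linarith [htm.2]
    have a4 := mul_le_mul_of_nonneg_left a3 h.speed_nonneg
    rw [← sub_add_sub_cancel _ (xb t j)] at a1
    linarith [norm_add_le (transitionCurve (cyc y (m - 1) (m * δ - θ)) (cyc y m (m * δ + θ))
      (xb (m * δ - θ)) (3 * r / 2) (m * δ - θ) (m * δ + θ) t - xb t j)
      (xb t j - xb (m * δ - θ) j)]
  have hu0 : 0 ≤ t / δ := div_nonneg ht.1 h0.le
  obtain ⟨m, hm, htm⟩ : ∃ m : ℕ, m < n * N ∧ t ∈ Icc (m * δ) ((m + 1) * δ) := by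
    rcases ht.2.lt_or_eq with hlt | rfl
    · refine ⟨⌊t / δ⌋₊, ?_, ?_, ?_⟩
      · rw [Nat.floor_lt hu0, div_lt_iff₀ h0, slots_mul_length hn hδ]; exact hlt
      · have := Nat.floor_le hu0
        rwa [le_div_iff₀ h0] at this
      · have := Nat.lt_floor_add_one (t / δ)
        rw [div_lt_iff₀ h0] at this
        exact this.le
    · have hL : ((n * N - 1 : ℕ) : ℝ) + 1 = (n * N : ℕ) := by
        have : n * N - 1 + 1 = n * N := by omega
        exact_mod_cast this
      have hs := slots_mul_length hn hδ
      refine ⟨n * N - 1, by omega, ?_, ?_⟩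
      · nlinarith
      · rw [hL, hs]
  by_cases hl : m = 0 ∨ m * δ + θ ≤ t
  · by_cases hu : m + 1 = n * N ∨ t ≤ (m + 1) * δ - θ
    · rw [h.oscControl_eq_cyc hn hB hδ hθ hm htm hl hu]
      have := h.control_dist t ht j (Fin.ofNat N m)
      simp only [cyc]
      linarith
    · push Not at hu
      refine htrans (m + 1) (by omega) (by omega) ⟨?_, ?_⟩ <;> push_cast <;> linarith [htm.2]
  · push Not at hl
    exact htrans m (by omega) hm ⟨by linarith [htm.1], hl.2.le⟩

end IsSeparatedReference

end

/-! ### The mollified control -/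

section

variable {N : ℕ} [NeZero N] {T r M B A : ℝ} {y : Fin N → ℝ → Plane} {xb : ℝ → Fin N → Plane}
  {n : ℕ} {ρ : ℝ → ℝ}

theorem integral_rescale {ε : ℝ} (hε : 0 < ε) (hρ : ∫ s, ρ s = 1) :
    ∫ s, rescale ρ ε s = 1 := by
  simp only [rescale]
  rw [integral_const_mul, Measure.integral_comp_div ρ ε, hρ, abs_of_pos hε]
  simp [hε.ne']

theorem support_rescale_subset {ε : ℝ} (hε : 0 < ε) (hA : Function.support ρ ⊆ Metric.ball 0 A) :
    Function.support (rescale ρ ε) ⊆ Metric.ball 0 (A * ε) := by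
  intro s hs
  have h1 : s / ε ∈ Function.support ρ := by
    intro h0
    exact hs (by simp [rescale, h0])
  have h2 := hA h1
  rw [mem_ball_zero_iff, Real.norm_eq_abs] at h2 ⊢
  rwa [abs_div, abs_of_pos hε, div_lt_iff₀ hε] at h2

theorem continuous_mollControl (hρ : Continuous ρ) (hA : Function.support ρ ⊆ Metric.ball 0 A)
    (hn : 0 < n) (hz : Continuous (oscControl T r y xb n)) :
    Continuous (mollControl T r ρ y xb n) := by
  have hε : 0 < 1 / (n : ℝ) ^ 3 := by positivity
  refine HasCompactSupport.continuous_convolution_left _ ?_ ?_ hz.locallyIntegrable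
  · exact HasCompactSupport.intro (isCompact_closedBall (0 : ℝ) (A * (1 / (n : ℝ) ^ 3)))
      fun s hs => by
        by_contra h0
        exact hs (Metric.ball_subset_closedBall (support_rescale_subset hε hA h0))
  · exact continuous_const.mul (hρ.comp (continuous_id.div_const _))

/-- A mollified value is a mean, with nonnegative weights, of nearby values, so it lies in every
closed ball that contains them. -/
theorem norm_mollControl_sub_le (hA : Function.support ρ ⊆ Metric.ball 0 A)
    (hρ0 : ∀ s, 0 ≤ ρ s) (hρ1 : ∫ s, ρ s = 1)
    (hn : 0 < n) (hz : Continuous (oscControl T r y xb n)) {t e : ℝ} {p : Plane} (he : 0 ≤ e)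
    (hp : ∀ s, |s - t| < A * (1 / (n : ℝ) ^ 3) → ‖oscControl T r y xb n s - p‖ ≤ e) :
    ‖mollControl T r ρ y xb n t - p‖ ≤ e := by
  have hε : 0 < 1 / (n : ℝ) ^ 3 := by positivity
  rw [← dist_eq_norm]
  refine dist_convolution_le he (support_rescale_subset hε hA)
    (fun s => mul_nonneg (inv_nonneg.2 hε.le) (hρ0 _)) (integral_rescale hε hρ1)
    hz.aestronglyMeasurable fun s hs => ?_
  rw [dist_eq_norm]
  exact hp s (by simpa [Real.dist_eq] using hs)

end

/-! ### Regularity of the reference -/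

theorem norm_sub_sub_smul_le {T Q : ℝ} {u u' : ℝ → Plane} (hQ : 0 ≤ Q)
    (hu : ∀ t ∈ Icc 0 T, HasDerivWithinAt u (u' t) (Icc 0 T) t)
    (hu' : ∀ s ∈ Icc 0 T, ∀ t ∈ Icc 0 T, ‖u' s - u' t‖ ≤ Q * |s - t|)
    {a s : ℝ} (ha : a ∈ Icc 0 T) (hs : s ∈ Icc 0 T) (has : a ≤ s) :
    ‖u s - u a - (s - a) • u' a‖ ≤ Q * (s - a) ^ 2 := by
  have hsub : Icc a s ⊆ Icc 0 T := Icc_subset_Icc ha.1 hs.2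
  have h1 : ∀ t ∈ Icc a s, HasDerivWithinAt (fun τ => u τ - (τ - a) • u' a) (u' t - u' a)
      (Icc a s) t := by
    intro t ht
    have e1 : HasDerivWithinAt (fun τ : ℝ => (τ - a) • u' a) ((1 : ℝ) • u' a) (Icc a s) t :=
      (((hasDerivAt_id t).sub_const a).smul_const (u' a)).hasDerivWithinAt
    rw [one_smul] at e1
    exact ((hu t (hsub ht)).mono hsub).sub e1
  have h2 := Convex.norm_image_sub_le_of_norm_hasDerivWithin_le (C := Q * (s - a)) h1
    (fun t ht => (hu' t (hsub ht) a ha).trans (by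
      gcongr; rw [abs_of_nonneg (by linarith [ht.1])]; linarith [ht.2]))
    (convex_Icc a s) (left_mem_Icc.2 has) (right_mem_Icc.2 has)
  rw [Real.norm_of_nonneg (by linarith)] at h2
  have e : u s - u a - (s - a) • u' a = u s - (s - a) • u' a - (u a - (a - a) • u' a) := by
    rw [sub_self, zero_smul]; abel
  rw [e]
  exact h2.trans_eq (by ring)

/-- Chain rule with a quadratic remainder: `v` is the derivative of the kernel at `u a` applied to
`u' a`. The two terms are the Taylor remainder of the kernel and that of `u`, the latter transported
by the derivative of the kernel. -/
theorem exists_affine_approx {T P Q ρ : ℝ} {u u' : ℝ → Plane} (hρ : 0 < ρ) (hQ : 0 ≤ Q)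
    (hu : ∀ t ∈ Icc 0 T, HasDerivWithinAt u (u' t) (Icc 0 T) t)
    (hP : ∀ s ∈ Icc 0 T, ∀ t ∈ Icc 0 T, ‖u s - u t‖ ≤ P * |s - t|)
    (hu' : ∀ s ∈ Icc 0 T, ∀ t ∈ Icc 0 T, ‖u' s - u' t‖ ≤ Q * |s - t|)
    (hd : ∀ t ∈ Icc 0 T, ρ ≤ ‖u t‖) {a : ℝ} (ha : a ∈ Icc 0 T) :
    ∃ v : Plane, ∀ s ∈ Icc 0 T, a ≤ s →
      ‖biotSavart (u s) - biotSavart (u a) - (s - a) • v‖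
        ≤ (P ^ 2 / ρ ^ 3 + Q / ρ ^ 2) * (s - a) ^ 2 := by
  have hne : ∀ t ∈ Icc 0 T, u t ≠ 0 := fun t ht => norm_pos_iff.1 (hρ.trans_le (hd t ht))
  refine ⟨biotSavartDeriv (u a) (u' a), fun s hs has => ?_⟩
  have e : biotSavart (u s) - biotSavart (u a) - (s - a) • biotSavartDeriv (u a) (u' a)
      = (biotSavart (u s) - biotSavart (u a) - biotSavartDeriv (u a) (u s - u a))
        + biotSavartDeriv (u a) (u s - u a - (s - a) • u' a) := by
    rw [biotSavartDeriv_sub (u a) (u s - u a), biotSavartDeriv_smul, sub_add_sub_cancel]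
  rw [e]
  refine (norm_add_le _ _).trans ?_
  rw [norm_biotSavart_taylor _ _ (hne s hs) (hne a ha), norm_biotSavartDeriv, add_mul]
  refine add_le_add ?_ ?_
  · have h1 : ‖u s - u a‖ ^ 2 ≤ P ^ 2 * (s - a) ^ 2 := by
      have := hP s hs a ha
      calc _ ≤ (P * |s - a|) ^ 2 := by gcongr
        _ = _ := by rw [mul_pow, sq_abs]
    rw [div_mul_eq_mul_div, show ρ ^ 3 = ρ * ρ ^ 2 by ring]
    gcongr
    · exact hd s hs
    · exact hd a ha
  · rw [div_mul_eq_mul_div]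
    gcongr
    · exact norm_sub_sub_smul_le hQ hu hu' ha hs has
    · exact hd a ha

/-- The right-hand side of the reference system. -/
def referenceField {N : ℕ} (γ : Fin N → ℝ) (γc : ℝ) (y : Fin N → Plane) (x : Fin N → Plane) :
    Fin N → Plane := fun i =>
  (∑ j ∈ Finset.univ.erase i, γ j • biotSavart (x i - x j))
    + ∑ k, (γc / N) • biotSavart (x i - y k)

/-- A bound of the speed of the vortices of a reference solution. -/
def speedBound {N : ℕ} (r : ℝ) (γ : Fin N → ℝ) (γc : ℝ) : ℝ := (∑ j, |γ j| + |γc|) / r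

section

variable {N : ℕ} [NeZero N] {T r M B : ℝ} {y : Fin N → ℝ → Plane} {xb : ℝ → Fin N → Plane}
  {γ : Fin N → ℝ} {γc : ℝ}

theorem sum_abs_div (γc : ℝ) (c : ℝ) : ∑ _k : Fin N, |γc / N| * c = |γc| * c := by
  have hN : (0 : ℝ) < N := by exact_mod_cast NeZero.pos N
  rw [Finset.sum_const, Finset.card_univ, Fintype.card_fin, nsmul_eq_mul, abs_div, abs_of_pos hN]
  field_simp

theorem norm_referenceField_le (hr : 0 < r) {p x : Fin N → Plane}
    (h1 : ∀ i k, r ≤ ‖x i - p k‖) (h2 : ∀ i j, i ≠ j → r ≤ ‖x i - x j‖) (i : Fin N) :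
    ‖referenceField γ γc p x i‖ ≤ speedBound r γ γc := by
  have hK : ∀ w : Plane, r ≤ ‖w‖ → ‖biotSavart w‖ ≤ r⁻¹ := fun w hw => by
    rw [norm_biotSavart]; gcongr
  refine (norm_add_le _ _).trans ?_
  rw [speedBound, add_div, div_eq_mul_inv (∑ j, |γ j|), div_eq_mul_inv |γc|]
  refine add_le_add ((norm_sum_le _ _).trans ?_) ((norm_sum_le _ _).trans ?_)
  · refine le_trans ?_ (mul_le_mul_of_nonneg_right (sum_erase_abs_le γ i) (by positivity))
    rw [Finset.sum_mul]
    refine Finset.sum_le_sum fun j hj => ?_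
    rw [norm_smul, Real.norm_eq_abs]
    exact mul_le_mul_of_nonneg_left (hK _ (h2 i j (Finset.ne_of_mem_erase hj).symm))
      (abs_nonneg _)
  · rw [← sum_abs_div (N := N)]
    refine Finset.sum_le_sum fun k _ => ?_
    rw [norm_smul, Real.norm_eq_abs]
    exact mul_le_mul_of_nonneg_left (hK _ (h1 i k)) (abs_nonneg _)

/-- Applied at two times of a reference solution, this makes the velocities of the vortices
Lipschitz, as the second-order averaging requires. -/
theorem norm_referenceField_sub_le (hr : 0 < r) {p x p' x' : Fin N → Plane} {ε ε' : ℝ}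
    (h1 : ∀ i k, r ≤ ‖x i - p k‖) (h2 : ∀ i j, i ≠ j → r ≤ ‖x i - x j‖)
    (h1' : ∀ i k, r ≤ ‖x' i - p' k‖) (h2' : ∀ i j, i ≠ j → r ≤ ‖x' i - x' j‖)
    (hx : ∀ i, ‖x i - x' i‖ ≤ ε) (hp : ∀ k, ‖p k - p' k‖ ≤ ε') (i : Fin N) :
    ‖referenceField γ γc p x i - referenceField γ γc p' x' i‖
      ≤ (∑ j, |γ j|) * (2 * ε / r ^ 2) + |γc| * ((ε + ε') / r ^ 2) := by
  have e : referenceField γ γc p x i - referenceField γ γc p' x' i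
      = (∑ j ∈ Finset.univ.erase i,
          γ j • (biotSavart (x i - x j) - biotSavart (x' i - x' j)))
        + ∑ k, (γc / N) • (biotSavart (x i - p k) - biotSavart (x' i - p' k)) := by
    simp only [referenceField, smul_sub, Finset.sum_sub_distrib]; abel
  rw [e]
  have hε : 0 ≤ ε := (norm_nonneg _).trans (hx i)
  refine (norm_add_le _ _).trans ?_
  refine add_le_add ((norm_sum_le _ _).trans ?_) ((norm_sum_le _ _).trans ?_)
  · refine le_trans ?_ (mul_le_mul_of_nonneg_right (sum_erase_abs_le γ i) (by positivity))
    rw [Finset.sum_mul]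
    refine Finset.sum_le_sum fun j hj => ?_
    have hij := (Finset.ne_of_mem_erase hj).symm
    rw [norm_smul, Real.norm_eq_abs]
    refine mul_le_mul_of_nonneg_left ((norm_biotSavart_sub_le hr (h2 i j hij)
      (h2' i j hij)).trans ?_) (abs_nonneg _)
    gcongr
    rw [show x i - x j - (x' i - x' j) = (x i - x' i) - (x j - x' j) by abel, two_mul]
    exact (norm_sub_le _ _).trans (add_le_add (hx i) (hx j))
  · rw [← sum_abs_div (N := N)]
    refine Finset.sum_le_sum fun k _ => ?_
    rw [norm_smul, Real.norm_eq_abs]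
    refine mul_le_mul_of_nonneg_left ((norm_biotSavart_sub_le hr (h1 i k)
      (h1' i k)).trans ?_) (abs_nonneg _)
    gcongr
    rw [show x i - p k - (x' i - p' k) = (x i - x' i) - (p k - p' k) by abel]
    exact (norm_sub_le _ _).trans (add_le_add (hx i) (hp k))

theorem isSeparatedReference_of_lip (hT : 0 < T) (hr : 0 < r) {x₀ : Fin N → Plane}
    (hx : IsReferenceSolution T γ γc y x₀ xb)
    (hy : ∀ k, ∀ s ∈ Icc 0 T, ∀ t ∈ Icc 0 T, ‖y k s - y k t‖ ≤ M * |s - t|)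
    (hyM : ∀ k, ∀ t ∈ Icc 0 T, ‖y k t‖ ≤ M)
    (hd : ∀ t ∈ Icc 0 T, ∀ j k, 2 * r ≤ ‖y k t - xb t j‖)
    (hs : ∀ t ∈ Icc 0 T, ∀ i j, i ≠ j → 4 * r ≤ ‖xb t i - xb t j‖) :
    IsSeparatedReference T r M (speedBound r γ γc) y xb := by
  refine ⟨hT, hr, by unfold speedBound; positivity, hy, hyM, fun j s hs' t ht => ?_, hd, hs⟩
  have := Convex.norm_image_sub_le_of_norm_hasDerivWithin_le (f := fun t => xb t j)
    (f' := fun t => referenceField γ γc (fun k => y k t) (xb t) j)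
    (C := speedBound r γ γc) (fun t ht => hx.ode t ht j)
    (fun t ht => norm_referenceField_le hr
      (fun i k => by rw [norm_sub_rev]; linarith [hd t ht i k])
      (fun i j hij => by linarith [hs t ht i j hij]) j)
    (convex_Icc 0 T) ht hs'
  simpa [Real.norm_eq_abs] using this

theorem norm_sub_le_of_iteratedDerivWithin {f : ℝ → Plane} (hT : 0 < T)
    (hf : ContDiffOn ℝ ∞ f (Icc 0 T)) {l : ℕ}
    (hM : ∀ t ∈ Icc 0 T, ‖iteratedDerivWithin (l + 1) f (Icc 0 T) t‖ ≤ M) :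
    (∀ t ∈ Icc 0 T, HasDerivWithinAt (iteratedDerivWithin l f (Icc 0 T))
      (iteratedDerivWithin (l + 1) f (Icc 0 T) t) (Icc 0 T) t) ∧
    ∀ s ∈ Icc 0 T, ∀ t ∈ Icc 0 T,
      ‖iteratedDerivWithin l f (Icc 0 T) s - iteratedDerivWithin l f (Icc 0 T) t‖
        ≤ M * |s - t| := by
  have hd : ∀ t ∈ Icc 0 T, HasDerivWithinAt (iteratedDerivWithin l f (Icc 0 T))
      (iteratedDerivWithin (l + 1) f (Icc 0 T) t) (Icc 0 T) t := by
    intro t ht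
    rw [iteratedDerivWithin_succ]
    exact (hf.differentiableOn_iteratedDerivWithin (by exact_mod_cast WithTop.coe_lt_top _)
      (uniqueDiffOn_Icc hT) t ht).hasDerivWithinAt
  refine ⟨hd, fun s hs t ht => ?_⟩
  have := Convex.norm_image_sub_le_of_norm_hasDerivWithin_le hd hM (convex_Icc 0 T) ht hs
  rwa [Real.norm_eq_abs] at this

end

/-! ### Convergence of the oscillating controls -/

theorem continuousOn_of_norm_sub_le {f : ℝ → Plane} {s : Set ℝ} {K : ℝ}
    (h : ∀ x ∈ s, ∀ y ∈ s, ‖f x - f y‖ ≤ K * |x - y|) : ContinuousOn f s := by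
  refine LipschitzOnWith.continuousOn (K := K.toNNReal)
    (LipschitzOnWith.of_dist_le_mul fun x hx y hy => ?_)
  rw [dist_eq_norm, Real.dist_eq]
  exact (h x hx y hy).trans (mul_le_mul_of_nonneg_right (Real.le_coe_toNNReal K) (abs_nonneg _))

section

variable {N : ℕ} {T r M B : ℝ} {y : Fin N → ℝ → Plane} {xb : ℝ → Fin N → Plane}
  {γ : Fin N → ℝ} {γc : ℝ} {n : ℕ}

theorem referenceField_sub_vortexField (p x : Fin N → Plane) (z : Plane) (i : Fin N) :
    referenceField γ γc p x i - vortexField γ γc z x i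
      = -γc • (biotSavart (x i - z) - (N : ℝ)⁻¹ • ∑ k, biotSavart (x i - p k)) := by
  simp only [referenceField, vortexField, ← Finset.smul_sum]
  module

namespace IsSeparatedReference

theorem continuousOn_control (h : IsSeparatedReference T r M B y xb) (k : Fin N) :
    ContinuousOn (y k) (Icc 0 T) := continuousOn_of_norm_sub_le (h.control_lip k)

theorem continuousOn_vortex (h : IsSeparatedReference T r M B y xb) (j : Fin N) :
    ContinuousOn (fun t => xb t j) (Icc 0 T) := continuousOn_of_norm_sub_le (h.vortex_lip j)

theorem le_norm_vortex_sub (h : IsSeparatedReference T r M B y xb) {t : ℝ} (ht : t ∈ Icc 0 T)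
    (i k : Fin N) : 2 * r ≤ ‖xb t i - y k t‖ := by
  rw [norm_sub_rev]; exact h.control_dist t ht i k

theorem continuousOn_referenceField (h : IsSeparatedReference T r M B y xb) (i : Fin N) :
    ContinuousOn (fun t => referenceField γ γc (fun k => y k t) (xb t) i) (Icc 0 T) := by
  have hr := h.radius_pos
  have hne : ∀ w : Plane, r ≤ ‖w‖ → w ≠ 0 := fun w hw => norm_pos_iff.1 (hr.trans_le hw)
  refine ContinuousOn.add (continuousOn_finsetSum _ fun j hj => ?_)
    (continuousOn_finsetSum _ fun k _ => ?_)
  · have hij := (Finset.ne_of_mem_erase hj).symm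
    have h1 := (h.continuousOn_vortex i).sub (h.continuousOn_vortex j)
    have h2 := ContinuousOn.biotSavart h1 fun t ht =>
      hne _ (by linarith [h.vortex_dist t ht i j hij] : r ≤ ‖xb t i - xb t j‖)
    exact h2.fun_const_smul (γ j)
  · have h1 := (h.continuousOn_vortex i).sub (h.continuousOn_control k)
    have h2 := ContinuousOn.biotSavart h1 fun t ht =>
      hne _ (by linarith [h.le_norm_vortex_sub ht i k] : r ≤ ‖xb t i - y k t‖)
    exact h2.fun_const_smul (γc / N)

theorem norm_integral_discrepancy_le [NeZero N] (h : IsSeparatedReference T r M B y xb) {z : ℝ → Plane}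
    (hz : ContinuousOn z (Icc 0 T)) (hzd : ∀ t ∈ Icc 0 T, ∀ j, r ≤ ‖xb t j - z t‖)
    (hn : 0 < n) {ε E : ℝ} (hε : 0 ≤ ε)
    (hclose : ∀ m : ℕ, m < n * N → ∀ t ∈ Icc (m * (T / (n * N)) + T / (n * N) / n)
      ((m + 1) * (T / (n * N)) - T / (n * N) / n), t ∈ Icc 0 T → ‖z t - cyc y m t‖ ≤ ε)
    (hE : ∀ i k, ∀ a ∈ Icc 0 T, ∃ v : Plane, ∀ s ∈ Icc 0 T, a ≤ s → s ≤ a + T / n →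
      ‖biotSavart (xb s i - y k s) - biotSavart (xb a i - y k a) - (s - a) • v‖ ≤ E) :
    ∀ t ∈ Icc 0 T, ∀ i, ‖∫ u in (0 : ℝ)..t, (referenceField γ γc (fun k => y k u) (xb u) i
      - vortexField γ γc (z u) (xb u) i)‖ ≤ |γc| * (T * (7 * r⁻¹ / n + ε / r ^ 2 + 3 * E)) := by
  intro t ht i
  have hr := h.radius_pos
  have hT := h.time_pos
  have hne : ∀ w : Plane, r ≤ ‖w‖ → w ≠ 0 := fun w hw => norm_pos_iff.1 (hr.trans_le hw)
  have hK : ∀ w : Plane, r ≤ ‖w‖ → ‖biotSavart w‖ ≤ r⁻¹ := fun w hw => by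
    rw [norm_biotSavart]; gcongr
  have hd : ∀ t ∈ Icc 0 T, ∀ k, r ≤ ‖xb t i - y k t‖ := fun t ht k => by
    linarith [h.le_norm_vortex_sub ht i k]
  simp only [referenceField_sub_vortexField]
  rw [intervalIntegral.integral_smul, norm_smul, norm_neg, Real.norm_eq_abs]
  refine mul_le_mul_of_nonneg_left ?_ (abs_nonneg _)
  refine norm_integral_sub_mean_le (F := fun k u => biotSavart (xb u i - y k u))
    (H := fun u => biotSavart (xb u i - z u)) hn hT (by positivity) (fun k => ?_) ?_
    (fun k t ht => hK _ (hd t ht k)) (fun t ht => hK _ (hzd t ht i)) (hE i) ?_ t ht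
  · have := (h.continuousOn_vortex i).sub (h.continuousOn_control k)
    exact ContinuousOn.biotSavart this fun t ht => hne _ (hd t ht k)
  · have := (h.continuousOn_vortex i).sub hz
    exact ContinuousOn.biotSavart this fun t ht => hne _ (hzd t ht i)
  · intro m hm t ht
    have hN : (0 : ℝ) < N := by exact_mod_cast NeZero.pos N
    have hn' : (0 : ℝ) < n := by exact_mod_cast hn
    have htT : t ∈ Icc 0 T := by
      have h1 : 0 ≤ T / (n * N) / n := by positivity
      have h2 : 0 ≤ m * (T / (n * N)) := by positivity
      have h3 : ((m : ℝ) + 1) * (T / (n * N)) ≤ T := by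
        have : (m : ℝ) + 1 ≤ n * N := by exact_mod_cast hm
        calc _ ≤ (n * N : ℝ) * (T / (n * N)) := by gcongr
          _ = T := by field_simp
      exact ⟨by linarith [ht.1], by linarith [ht.2]⟩
    refine (norm_biotSavart_sub_le hr (hzd t htT i) (hd t htT _)).trans ?_
    rw [sub_sub_sub_cancel_left, norm_sub_rev]
    gcongr
    exact hclose m hm t ht htT

end IsSeparatedReference

/-- A continuous control that stays away from the vortices of a reference trajectory and has
nearly the same integrated effect steers the system along the trajectory. -/
theorem exists_solution_near_reference {x₀ : Fin N → Plane} (h : IsSeparatedReference T r M B y xb)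
    (hx : IsReferenceSolution T γ γc y x₀ xb) {z : ℝ → Plane} (hz : ContinuousOn z (Icc 0 T))
    {ρ s η : ℝ} (hρ : 0 < ρ) (hs : 0 ≤ s) (hρs : ρ + 2 * s ≤ 4 * r)
    (hzd : ∀ t ∈ Icc 0 T, ∀ j, ρ + s ≤ ‖xb t j - z t‖)
    (hint : ∀ t ∈ Icc 0 T, ∀ i, ‖∫ u in (0 : ℝ)..t, (referenceField γ γc (fun k => y k u) (xb u) i
      - vortexField γ γc (z u) (xb u) i)‖ ≤ η)
    (hη : η * Real.exp (fieldLip ρ γ γc * T) ≤ s) :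
    ∃ x, IsSingleControlSolution T γ γc z x₀ x ∧
      ∀ t ∈ Icc 0 T, ∀ i, ‖x t i - xb t i‖ ≤ η * Real.exp (fieldLip ρ γ γc * T) := by
  rw [← hx.init]
  refine exists_solution_near h.time_pos hρ hs hz
    (xb' := fun t => referenceField γ γc (fun k => y k t) (xb t)) (fun t ht i => hx.ode t ht i)
    h.continuousOn_referenceField (fun t ht i j hij => hρs.trans (h.vortex_dist t ht i j hij)) hzd
    hint hη

end

/-! ### Choice of the constants and rate of convergence -/

theorem exists_nat_forall_ge (a b c d e f : ℝ) : ∃ n₀ : ℕ, 2 ≤ n₀ ∧ ∀ n : ℕ, n₀ ≤ n →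
    a ≤ n ∧ b ≤ n ∧ c ≤ n ∧ d ≤ n ∧ e ≤ n ∧ f ≤ n := by
  obtain ⟨n₀, hn₀⟩ := exists_nat_ge (max a (max b (max c (max d (max e f)))))
  refine ⟨max n₀ 2, le_max_right _ _, fun n hn => ?_⟩
  have h1 : (n₀ : ℝ) ≤ n := by exact_mod_cast (le_max_left _ _).trans hn
  simpa [max_le_iff] using hn₀.trans h1

/-- Solutions driven by the mollified oscillating controls converge to the reference solution. -/
theorem exists_mollControl_bound {N : ℕ} [NeZero N] (γ : Fin N → ℝ) (γc : ℝ) {T r : ℝ}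
    (hT : 0 < T) (hr : 0 < r) : ∃ C : ℝ, 0 < C ∧
      ∀ ρ : ℝ → ℝ, ContDiff ℝ ∞ ρ → HasCompactSupport ρ → (∀ s, 0 ≤ ρ s) → ∫ s, ρ s = 1 →
      ∀ M : ℝ, ∃ n₀ : ℕ, 1 ≤ n₀ ∧
        ∀ (x₀ : Fin N → Plane) (y : Fin N → ℝ → Plane) (xb : ℝ → Fin N → Plane),
          (∀ k, ContDiffOn ℝ ∞ (y k) (Icc 0 T)) →
          (∀ k, ∀ l ≤ 2, ∀ t ∈ Icc 0 T,
            ‖iteratedDerivWithin l (y k) (Icc 0 T) t‖ ≤ M) →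
          IsReferenceSolution T γ γc y x₀ xb →
          (∀ t ∈ Icc 0 T, ∀ j k, 2 * r ≤ ‖y k t - xb t j‖) →
          (∀ t ∈ Icc 0 T, ∀ i j, i ≠ j → 4 * r ≤ ‖xb t i - xb t j‖) →
          ∀ n : ℕ, n₀ ≤ n →
            (∃ x, IsSingleControlSolution T γ γc (mollControl T r ρ y xb n) x₀ x) ∧
            ∀ x, IsSingleControlSolution T γ γc (mollControl T r ρ y xb n) x₀ x →
              ∀ t ∈ Icc 0 T, configDist (x t) (xb t) ≤ C / n := by
  have hN : (0 : ℝ) < N := by exact_mod_cast NeZero.pos N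
  -- `M` must not enter here: the three terms are the averaging error with kernel bound `1 / r`, a
  -- control error `1 / n`, and a second-order error `1 / n`.
  set C₁ : ℝ := T * (7 * r⁻¹ + 1 / r ^ 2 + 3) with hC₁
  have hC₁0 : 0 < C₁ := by positivity
  set ex := Real.exp (fieldLip r γ γc * T) with hex
  have hex0 : 0 < ex := Real.exp_pos _
  set B := speedBound r γ γc with hB
  have hB0 : 0 ≤ B := by rw [hB]; unfold speedBound; positivity
  refine ⟨√N * (|γc| * C₁ * ex) + 1, by positivity, fun ρ hρ hρs hρ0 hρ1 M => ?_⟩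
  by_cases hM : 0 ≤ M
  swap
  · exact ⟨1, le_rfl, fun x₀ y xb hy hyM => absurd ((norm_nonneg _).trans
      (hyM ⟨0, NeZero.pos N⟩ 0 (by norm_num) 0 ⟨le_rfl, hT.le⟩)) hM⟩
  obtain ⟨A, hA0, hA⟩ : ∃ A : ℝ, 0 < A ∧ Function.support ρ ⊆ Metric.ball 0 A := by
    obtain ⟨A, hA⟩ := hρs.isCompact.isBounded.subset_ball 0
    exact ⟨max A 1, by positivity, (subset_tsupport ρ).trans (hA.trans
      (Metric.ball_subset_ball (le_max_left _ _)))⟩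
  set Q : ℝ := (∑ j, |γ j|) * (2 * B / r ^ 2) + |γc| * ((B + M) / r ^ 2) + M with hQ
  have hQ0 : 0 ≤ Q := by positivity
  -- `Q` is a Lipschitz constant of the derivative of `x̄ᵢ - yₖ`, and `Q₂` the coefficient that
  -- `exists_affine_approx` yields from it.
  set Q₂ : ℝ := (B + M) ^ 2 / r ^ 3 + Q / r ^ 2 with hQ₂
  have hQ₂0 : 0 ≤ Q₂ := by positivity
  -- In this order the thresholds ensure: small motion of the vortices during a period, displacement
  -- at most `r / 8` by the mollification, mollification radius at most half a transition, control
  -- error at most `1 / n` in the core, second-order error at most `1 / n`, and a final error within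
  -- the margin `r / 4`.
  obtain ⟨n₀, hn₀, hbig⟩ := exists_nat_forall_ge (8 * B * T / r) (8 * (M + 4 * M * N / T) * A / r)
    (2 * N * A / T) (M * A) (Q₂ * T ^ 2) (4 * (|γc| * C₁ * ex) / r)
  refine ⟨n₀, by omega, fun x₀ y xb hy hyM hx hd hs n hn => ?_⟩
  have hn2 : 2 ≤ n := hn₀.trans hn
  have hn0 : (0 : ℝ) < n := by positivity
  have hn1 : (1 : ℝ) ≤ n := by exact_mod_cast (by omega : 1 ≤ n)
  obtain ⟨b1, b2, b3, b4, b5, b6⟩ := hbig n hn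
  have hy0 : ∀ k, _ := fun k => norm_sub_le_of_iteratedDerivWithin hT (hy k) (l := 0)
    (fun t ht => hyM k 1 (by norm_num) t ht)
  have hy1 : ∀ k, _ := fun k => norm_sub_le_of_iteratedDerivWithin hT (hy k) (l := 1)
    (fun t ht => hyM k 2 le_rfl t ht)
  simp only [iteratedDerivWithin_zero, zero_add] at hy0
  have hsr : IsSeparatedReference T r M B y xb :=
    isSeparatedReference_of_lip hT hr hx (fun k => (hy0 k).2)
      (fun k t ht => by simpa using hyM k 0 (by norm_num) t ht) hd hs
  have hBn : B * (T / n) ≤ r / 8 := by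
    rw [div_le_iff₀ hr] at b1
    rw [mul_div_assoc', div_le_iff₀ hn0]; linarith
  have hzc := hsr.continuous_oscControl hn2 hBn
  have hmc := continuous_mollControl hρ.continuous hA (by omega) hzc
  set z := mollControl T r ρ y xb n with hz
  set a : ℝ := A * (1 / (n : ℝ) ^ 3) with ha
  have ha0 : 0 < a := by positivity
  have hnear : ∀ t, ‖z t - oscControl T r y xb n t‖ ≤ r / 8 := by
    intro t
    refine norm_mollControl_sub_le hA hρ0 hρ1 (by omega) hzc (by positivity) fun s hs => ?_
    refine (hsr.norm_oscControl_sub_le hn2 hBn s t).trans ?_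
    have h1 : M + 4 * M * n ^ 2 * N / T ≤ (M + 4 * M * N / T) * n ^ 2 := by
      have h2 : M ≤ M * n ^ 2 := le_mul_of_one_le_right hM (one_le_pow₀ hn1)
      calc M + 4 * M * n ^ 2 * N / T ≤ M * n ^ 2 + 4 * M * n ^ 2 * N / T := by gcongr
        _ = _ := by ring
    have h3 : 0 ≤ M + 4 * M * N / T := by positivity
    calc (M + 4 * M * n ^ 2 * N / T) * |s - t| ≤ ((M + 4 * M * N / T) * n ^ 2) * a := by
          gcongr
      _ = (M + 4 * M * N / T) * A / n := by rw [ha]; field_simp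
      _ ≤ r / 8 := by
          rw [div_le_iff₀ hr] at b2
          rw [div_le_iff₀ hn0]; linarith
  have hzd : ∀ t ∈ Icc 0 T, ∀ j, r + r / 4 ≤ ‖xb t j - z t‖ := by
    intro t ht j
    have h1 := hsr.le_norm_oscControl_sub hn2 hBn ht j
    have h2 := hnear t
    rw [norm_sub_rev] at h2 ⊢
    rw [← sub_add_sub_cancel _ (z t)] at h1
    linarith [norm_add_le (oscControl T r y xb n t - z t) (z t - xb t j)]
  have haθ : a ≤ T / (n * N) / (2 * n) := by
    rw [div_le_iff₀ hT] at b3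
    rw [ha, div_div, le_div_iff₀ (by positivity)]
    calc A * (1 / (n : ℝ) ^ 3) * (n * N * (2 * n)) = 2 * N * A / n := by field_simp
      _ ≤ T := by rw [div_le_iff₀ hn0]; linarith
  -- The excluded layers are twice as long as half a transition, so the mollifier sees a single
  -- control there.
  have hclose : ∀ m : ℕ, m < n * N → ∀ t ∈ Icc (m * (T / (n * N)) + T / (n * N) / n)
      ((m + 1) * (T / (n * N)) - T / (n * N) / n), t ∈ Icc 0 T →
      ‖z t - cyc y m t‖ ≤ 1 / n := by
    intro m hm t ht htT
    refine norm_mollControl_sub_le hA hρ0 hρ1 (by omega) hzc (by positivity) fun s hs => ?_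
    have hst := abs_lt.1 hs
    have hhalf : T / (n * N) / n = 2 * (T / (n * N) / (2 * n)) := by field_simp
    have hθ0 : 0 < T / (n * N) / (2 * n) := by positivity
    rw [hhalf] at ht
    have hsm : s ∈ Icc (m * (T / (n * N))) ((m + 1) * (T / (n * N))) :=
      ⟨by linarith [ht.1], by linarith [ht.2]⟩
    rw [hsr.oscControl_eq_cyc hn2 hBn rfl rfl hm hsm (Or.inr (by linarith [ht.1]))
      (Or.inr (by linarith [ht.2]))]
    refine (hsr.control_lip _ s (hsr.mem_Icc_of_slot hn2 rfl hm hsm) t htT).trans ?_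
    calc M * |s - t| ≤ M * a := by gcongr
      _ = M * A / n ^ 3 := by rw [ha]; ring
      _ ≤ 1 / n := by
        rw [div_le_div_iff₀ (by positivity) hn0, one_mul]
        nlinarith [mul_nonneg hn0.le (sub_nonneg.2 b4), mul_nonneg hn0.le (sub_nonneg.2 hn1),
          mul_nonneg (mul_nonneg hn0.le hn0.le) (sub_nonneg.2 hn1)]
  have hE : ∀ i k, ∀ a ∈ Icc 0 T, ∃ v : Plane, ∀ s ∈ Icc 0 T, a ≤ s → s ≤ a + T / n →
      ‖biotSavart (xb s i - y k s) - biotSavart (xb a i - y k a) - (s - a) • v‖ ≤ 1 / n := by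
    intro i k a ha
    have hP : ∀ s ∈ Icc 0 T, ∀ t ∈ Icc 0 T,
        ‖(xb s i - y k s) - (xb t i - y k t)‖ ≤ (B + M) * |s - t| := by
      intro s hs t ht
      rw [show xb s i - y k s - (xb t i - y k t) = (xb s i - xb t i) - (y k s - y k t) by abel,
        add_mul]
      exact (norm_sub_le _ _).trans (add_le_add (hsr.vortex_lip i s hs t ht)
        (hsr.control_lip k s hs t ht))
    have hQ' : ∀ s ∈ Icc 0 T, ∀ t ∈ Icc 0 T,
        ‖(referenceField γ γc (fun k => y k s) (xb s) i - iteratedDerivWithin 1 (y k) (Icc 0 T) s)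
          - (referenceField γ γc (fun k => y k t) (xb t) i
            - iteratedDerivWithin 1 (y k) (Icc 0 T) t)‖ ≤ Q * |s - t| := by
      intro s hs' t ht
      rw [sub_sub_sub_comm]
      have h1 := norm_referenceField_sub_le (γ := γ) (γc := γc) (p := fun k => y k s)
        (x := xb s) (p' := fun k => y k t) (x' := xb t) hr
        (fun i k => by linarith [hsr.le_norm_vortex_sub hs' i k])
        (fun i j hij => by linarith [hs s hs' i j hij])
        (fun i k => by linarith [hsr.le_norm_vortex_sub ht i k])
        (fun i j hij => by linarith [hs t ht i j hij])
        (fun i => hsr.vortex_lip i s hs' t ht) (fun k => hsr.control_lip k s hs' t ht) i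
      refine (norm_sub_le _ _).trans ((add_le_add h1 ((hy1 k).2 s hs' t ht)).trans_eq ?_)
      rw [hQ]; ring
    obtain ⟨v, hv⟩ := exists_affine_approx (u := fun t => xb t i - y k t)
      (u' := fun t => referenceField γ γc (fun k => y k t) (xb t) i
        - iteratedDerivWithin 1 (y k) (Icc 0 T) t) hr hQ0
      (fun t ht => (hx.ode t ht i).sub ((hy0 k).1 t ht)) hP hQ'
      (fun t ht => by linarith [hsr.le_norm_vortex_sub ht i k]) ha
    -- The error is quadratic in the period `T / n`: one power of `n` absorbs `Q₂`, and with it `M`,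
    -- and the other remains.
    refine ⟨v, fun s hs has hsa => (hv s hs has).trans ?_⟩
    calc Q₂ * (s - a) ^ 2 ≤ Q₂ * (T / n) ^ 2 := by
          gcongr
          linarith
      _ = Q₂ * T ^ 2 / n ^ 2 := by ring
      _ ≤ n / n ^ 2 := by gcongr
      _ = 1 / n := by field_simp
  have hint := hsr.norm_integral_discrepancy_le (γ := γ) (γc := γc) hmc.continuousOn
    (fun t ht j => by linarith [hzd t ht j]) (by omega) (by positivity) hclose hE
  have hη : |γc| * (T * (7 * r⁻¹ / n + 1 / n / r ^ 2 + 3 * (1 / n))) = |γc| * C₁ / n := by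
    rw [hC₁]; field_simp
  rw [hη] at hint
  obtain ⟨x, hxs, hxc⟩ := exists_solution_near_reference hsr hx hmc.continuousOn hr
    (by positivity) (by linarith) hzd hint (by
      rw [div_le_iff₀ hr] at b6
      rw [← hex, div_mul_eq_mul_div, div_le_iff₀ hn0]; linarith)
  refine ⟨⟨x, hxs⟩, fun x' hx' t ht => ?_⟩
  rw [hx'.eqOn hT.le hmc.continuousOn hxs ht]
  refine (configDist_le (by positivity) (hxc t ht)).trans ?_
  rw [← hex, div_mul_eq_mul_div, mul_div_assoc']
  gcongr
  linarith

/-! ### Trajectories joining two configurations -/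

theorem exists_lipschitz_bound {ι : Type*} [Finite ι] {T : ℝ} {f : ι → ℝ → Plane}
    (hf : ∀ i, ContDiff ℝ 1 (f i)) : ∃ K : ℝ, 0 ≤ K ∧
      ∀ i, ∀ s ∈ Icc 0 T, ∀ t ∈ Icc 0 T, ‖f i s - f i t‖ ≤ K * |s - t| := by
  have h : ∀ i, ∃ K : NNReal, LipschitzOnWith K (f i) (Icc 0 T) := fun i =>
    (hf i).contDiffOn.exists_lipschitzOnWith one_ne_zero (convex_Icc 0 T) isCompact_Icc
  choose K hK using h
  obtain ⟨B, hB⟩ := (Set.finite_range fun i => (K i : ℝ)).bddAbove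
  refine ⟨max B 0, le_max_right _ _, fun i s hs t ht => ?_⟩
  have := (hK i).dist_le_mul s hs t ht
  rw [dist_eq_norm, Real.dist_eq] at this
  exact this.trans (mul_le_mul_of_nonneg_right ((hB ⟨i, rfl⟩).trans (le_max_left _ _))
    (abs_nonneg _))

theorem exists_norm_bound {ι : Type*} [Finite ι] {T : ℝ} {f : ι → ℝ → Plane}
    (hf : ∀ i, ContinuousOn (f i) (Icc 0 T)) : ∃ K : ℝ, 0 ≤ K ∧
      ∀ i, ∀ t ∈ Icc 0 T, ‖f i t‖ ≤ K := by
  choose K hK using fun i => isCompact_Icc.exists_bound_of_continuousOn (hf i)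
  obtain ⟨B, hB⟩ := (Set.finite_range K).bddAbove
  exact ⟨max B 0, le_max_right _ _, fun i t ht =>
    (hK i t ht).trans ((hB ⟨i, rfl⟩).trans (le_max_left _ _))⟩

/-- The parabolic arc from `a` to `a + D`, bent by the amount `l`. -/
def bentPath (l : ℝ) (a D : Plane) (s : ℝ) : Plane := a + s • D + (l * (s * (1 - s))) • perp D

theorem bentPath_sub (l : ℝ) (a D a' D' : Plane) (s : ℝ) :
    bentPath l a D s - bentPath l a' D' s = bentPath l (a - a') (D - D') s := by
  simp only [bentPath, perp_sub]; module

/-- At most one of the bent paths from `a ≠ 0` to `a + D ≠ 0` meets the origin. -/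
theorem subsingleton_bentPath_eq_zero {a D : Plane} (ha : a ≠ 0) (haD : a + D ≠ 0) :
    {l : ℝ | ∃ s, bentPath l a D s = 0}.Subsingleton := by
  rintro l ⟨s, hs⟩ l' ⟨s', hs'⟩
  have hD : D ≠ 0 := by
    rintro rfl
    apply ha
    have : perp 0 = 0 := by simpa using perp_smul 0 0
    simpa [bentPath, this] using hs
  -- Orthogonality of `D` and `perp D` forces both coefficients to vanish, hence `s = s'`. Since
  -- neither end point is the origin, `s * (1 - s) ≠ 0`, and so `l = l'`.
  have h1 : (s - s') • D + (l * (s * (1 - s)) - l' * (s' * (1 - s'))) • perp D = 0 := by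
    have : (s - s') • D + (l * (s * (1 - s)) - l' * (s' * (1 - s'))) • perp D
        = bentPath l a D s - bentPath l' a D s' := by simp only [bentPath]; module
    rw [this, hs, hs', sub_zero]
  have h2 := norm_sq_smul_add_perp D (s - s') (l * (s * (1 - s)) - l' * (s' * (1 - s')))
  rw [h1, norm_zero, zero_pow two_ne_zero] at h2
  have h3 : (s - s') ^ 2 + (l * (s * (1 - s)) - l' * (s' * (1 - s'))) ^ 2 = 0 := by
    rcases mul_eq_zero.1 h2.symm with h | h
    · exact h
    · exact absurd (norm_eq_zero.1 (pow_eq_zero_iff two_ne_zero |>.1 h)) hD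
  have h4 : s = s' := by
    nlinarith [sq_nonneg (s - s'),
    sq_nonneg (l * (s * (1 - s)) - l' * (s' * (1 - s')))]
  subst h4
  have h5 : (l - l') * (s * (1 - s)) = 0 := by nlinarith
  have hs0 : s ≠ 0 := by
    rintro rfl
    apply ha; simpa [bentPath] using hs
  have hs1 : 1 - s ≠ 0 := by
    intro h
    have : s = 1 := by linarith
    subst this
    apply haD; simpa [bentPath] using hs
  have := (mul_eq_zero.1 h5).resolve_right (mul_ne_zero hs0 hs1)
  linarith

/-- The difference of two bent paths with the same `l` is again a bent path, so each of the finitely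
many pairs excludes at most one value of `l`. -/
theorem exists_bentPath_ne {N : ℕ} {x₀ xf : Fin N → Plane} (h₀ : Function.Injective x₀)
    (hf : Function.Injective xf) : ∃ l : ℝ, ∀ s : ℝ, ∀ i j, i ≠ j →
      bentPath l (x₀ i) (xf i - x₀ i) s ≠ bentPath l (x₀ j) (xf j - x₀ j) s := by
  have hfin : (⋃ p : {p : Fin N × Fin N // p.1 ≠ p.2}, {l : ℝ | ∃ s, bentPath l
      (x₀ p.1.1 - x₀ p.1.2) ((xf p.1.1 - x₀ p.1.1) - (xf p.1.2 - x₀ p.1.2)) s = 0}).Finite := by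
    refine Set.finite_iUnion fun p => (subsingleton_bentPath_eq_zero
      (sub_ne_zero.2 (h₀.ne p.2)) ?_).finite
    rw [show x₀ p.1.1 - x₀ p.1.2 + ((xf p.1.1 - x₀ p.1.1) - (xf p.1.2 - x₀ p.1.2))
      = xf p.1.1 - xf p.1.2 by abel]
    exact sub_ne_zero.2 (hf.ne p.2)
  obtain ⟨l, hl⟩ := hfin.exists_notMem
  refine ⟨l, fun s i j hij heq => hl (mem_iUnion.2 ⟨⟨(i, j), hij⟩, s, ?_⟩)⟩
  rw [← bentPath_sub, heq, sub_self]

/-- Trajectories without collisions between two configurations whose speeds are large. -/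
theorem exists_fast_trajectory {N : ℕ} {T : ℝ} (hT : 0 < T) {x₀ xf : Fin N → Plane}
    (h₀ : Function.Injective x₀) (hf : Function.Injective xf) : ∃ d : ℝ, 0 < d ∧ ∀ W : ℝ,
      ∃ xb xb' : ℝ → Fin N → Plane, xb 0 = x₀ ∧ xb T = xf ∧
        (∀ t i, HasDerivAt (fun u => xb u i) (xb' t i) t) ∧
        (∀ i, ContDiff ℝ 1 fun u => xb u i) ∧ (∀ i, ContDiff ℝ 1 fun u => xb' u i) ∧
        (∀ t ∈ Icc 0 T, ∀ i j, i ≠ j → d ≤ ‖xb t i - xb t j‖) ∧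
        ∀ t ∈ Icc 0 T, ∀ i, W ≤ ‖xb' t i‖ := by
  obtain ⟨l, hl⟩ := exists_bentPath_ne h₀ hf
  let D : Fin N → Plane := fun i => xf i - x₀ i
  let p : Fin N → ℝ → Plane := fun i t => bentPath l (x₀ i) (D i) (t / T)
  let p' : Fin N → ℝ → Plane := fun i t =>
    T⁻¹ • D i + (l * (T⁻¹ * (1 - t / T) + t / T * (-T⁻¹))) • perp (D i)
  have hpc : ∀ i, ContDiff ℝ 1 (p i) := fun i => by
    simp only [p, bentPath]; fun_prop
  have hpc' : ∀ i, ContDiff ℝ 1 (p' i) := fun i => by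
    simp only [p']; fun_prop
  have hpd : ∀ i t, HasDerivAt (p i) (p' i t) t := by
    intro i t
    have h1 : HasDerivAt (fun u : ℝ => u / T) T⁻¹ t := by
      simpa using (hasDerivAt_id t).div_const T
    have h2 : HasDerivAt (fun u : ℝ => 1 - u / T) (-T⁻¹) t := h1.const_sub 1
    exact ((h1.smul_const (D i)).const_add (x₀ i)).add
      (((h1.mul h2).const_mul l).smul_const (perp (D i)))
  have hd : ∃ d : ℝ, 0 < d ∧ ∀ t ∈ Icc 0 T, ∀ i j, i ≠ j → d ≤ ‖p i t - p j t‖ := by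
    have : ∀ q : {q : Fin N × Fin N // q.1 ≠ q.2}, ∃ d : ℝ, 0 < d ∧ ∀ t ∈ Icc 0 T,
        d ≤ ‖p q.1.1 t - p q.1.2 t‖ := fun q =>
      exists_pos_le_norm_sub hT.le (hpc _).continuous.continuousOn
        (hpc _).continuous.continuousOn fun t _ => hl (t / T) _ _ q.2
    choose f hf hf' using this
    obtain ⟨d, hd, hd'⟩ := exists_pos_le_of_finite f hf
    exact ⟨d, hd, fun t ht i j hij => (hd' ⟨(i, j), hij⟩).trans (hf' ⟨(i, j), hij⟩ t ht)⟩
  obtain ⟨d, hd0, hd⟩ := hd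
  obtain ⟨W₀, hW₀, hW₀'⟩ := exists_norm_bound (T := T) fun i => (hpc' i).continuous.continuousOn
  refine ⟨d, hd0, fun W => ?_⟩
  obtain ⟨m, hm⟩ := exists_nat_ge ((W + W₀) * T)
  -- A circular motion common to all vortices leaves their differences unchanged, so `d` does not
  -- depend on `W`. It makes `m` full turns, so the end points are unchanged too.
  set om : ℝ := m * (2 * Real.pi) / T with hom
  have homT : om * T = m * (2 * Real.pi) := by rw [hom]; field_simp
  have hom0 : 0 ≤ om := by have := Real.pi_pos; positivity
  have homW : W + W₀ ≤ om := by
    rw [hom, le_div_iff₀ hT]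
    refine hm.trans (le_mul_of_one_le_right (Nat.cast_nonneg m) ?_)
    linarith [Real.pi_gt_three]
  let e : Plane := EuclideanSpace.single 0 1
  have he : ‖e‖ = 1 := by simp [e]
  let c : ℝ → Plane := fun t => (Real.cos (om * t) - 1) • e + Real.sin (om * t) • perp e
  let c' : ℝ → Plane := fun t =>
    (-Real.sin (om * t) * om) • e + (Real.cos (om * t) * om) • perp e
  have hcc : ContDiff ℝ 1 c := by simp only [c]; fun_prop
  have hcc' : ContDiff ℝ 1 c' := by simp only [c']; fun_prop
  have hcd : ∀ t, HasDerivAt c (c' t) t := by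
    intro t
    have h1 : HasDerivAt (fun u : ℝ => om * u) om t := by
      simpa using (hasDerivAt_id t).const_mul om
    exact ((h1.cos.sub_const 1).smul_const e).add (h1.sin.smul_const (perp e))
  have hcn : ∀ t, ‖c' t‖ = om := by
    intro t
    refine (sq_eq_sq₀ (norm_nonneg _) hom0).1 ?_
    rw [norm_sq_add_perp he]
    linear_combination om ^ 2 * Real.sin_sq_add_cos_sq (om * t)
  refine ⟨fun t i => p i t + c t, fun t i => p' i t + c' t, ?_, ?_,
    fun t i => (hpd i t).add (hcd t), fun i => (hpc i).add hcc, fun i => (hpc' i).add hcc',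
    fun t ht i j hij => ?_, fun t ht i => ?_⟩
  · funext i; simp [p, c, bentPath]
  · funext i
    have h1 : Real.sin (om * T) = 0 := by
      rw [homT]
      have := Real.sin_nat_mul_pi (2 * m)
      push_cast at this
      rw [← this]; ring_nf
    have h2 : Real.cos (om * T) = 1 := by rw [homT]; exact Real.cos_nat_mul_two_pi m
    simp [p, c, D, bentPath, h1, h2, hT.ne']
  · rw [add_sub_add_right_eq_sub]; exact hd t ht i j hij
  · have h1 := hW₀' i t ht
    have h2 := norm_sub_le (p' i t + c' t) (p' i t)
    rw [add_sub_cancel_left, hcn] at h2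
    linarith

/-! ### Controls that realize a given trajectory -/

/-- A fast trajectory without collisions is a solution of the reference system for some Lipschitz
controls, the `k`-th of which stays near the `k`-th vortex. -/
theorem exists_reference_controls {N : ℕ} [NeZero N] {γ : Fin N → ℝ} {γc : ℝ} (hγc : γc ≠ 0)
    {T d W : ℝ} (hd : 0 < d) {xb xb' : ℝ → Fin N → Plane}
    (hxd : ∀ t i, HasDerivAt (fun u => xb u i) (xb' t i) t)
    (hxc : ∀ i, ContDiff ℝ 1 fun u => xb u i) (hxc' : ∀ i, ContDiff ℝ 1 fun u => xb' u i)
    (hsep : ∀ t ∈ Icc 0 T, ∀ i j, i ≠ j → d ≤ ‖xb t i - xb t j‖)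
    (hW : ∀ t ∈ Icc 0 T, ∀ i, W ≤ ‖xb' t i‖)
    (hWd : (∑ j, |γ j|) * d⁻¹ + |γc| * (d / 2)⁻¹ + |γc| * (5 / d) ≤ W) :
    ∃ (y : Fin N → ℝ → Plane) (K : ℝ),
      (∀ k, ∀ s ∈ Icc 0 T, ∀ t ∈ Icc 0 T, ‖y k s - y k t‖ ≤ K * |s - t|) ∧
      IsReferenceSolution T γ γc y (xb 0) xb := by
  have hN : (0 : ℝ) < N := by exact_mod_cast NeZero.pos N
  have hN1 : (1 : ℝ) ≤ N := by exact_mod_cast NeZero.pos N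
  have hc0 : 0 < |γc| := abs_pos.2 hγc
  have hd2 : 0 < d / 2 := by positivity
  obtain ⟨K₁, hK₁, hx₁⟩ := exists_lipschitz_bound (T := T) hxc
  obtain ⟨K₂, hK₂, hx₂⟩ := exists_lipschitz_bound (T := T) hxc'
  -- The controls are sought as `xb + a`. The `i`-th control has to produce what `w` and the other
  -- controls leave over, that is `K(-aᵢ) = uᵢ(a)`; since `K(-K(u)) = u`, it suffices that `aᵢ =
  -- K(uᵢ(a))`. The kernel is cut off in `q` so that this fixed point problem makes sense for every
  -- `a`.
  let w : ℝ → Fin N → Plane := fun t i =>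
    xb' t i - ∑ j ∈ Finset.univ.erase i, γ j • biotSavart (xb t i - xb t j)
  let q : ℝ → (Fin N → Plane) → Fin N → Plane := fun t a i =>
    ∑ k ∈ Finset.univ.erase i, cutKernel (d / 2) (xb t i - xb t k - a k)
  let u : ℝ → (Fin N → Plane) → Fin N → Plane := fun t a i => (N / γc : ℝ) • w t i - q t a i
  have hcard : ∀ i : Fin N, ((Finset.univ.erase i).card : ℝ) ≤ N := by
    intro i
    have : (Finset.univ.erase i).card ≤ N := by
      simp
    exact_mod_cast this
  have hqn : ∀ t a i, ‖q t a i‖ ≤ N * (d / 2)⁻¹ := by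
    intro t a i
    refine (norm_sum_le_of_le _ fun k _ => norm_cutKernel_le hd2 _).trans ?_
    rw [Finset.sum_const, nsmul_eq_mul]
    exact mul_le_mul_of_nonneg_right (hcard i) (by positivity)
  have hwn : ∀ t ∈ Icc 0 T, ∀ i, |γc| * (d / 2)⁻¹ + |γc| * (5 / d) ≤ ‖w t i‖ := by
    intro t ht i
    have h1 : ‖∑ j ∈ Finset.univ.erase i, γ j • biotSavart (xb t i - xb t j)‖
        ≤ (∑ j, |γ j|) * d⁻¹ := by
      refine (norm_sum_le _ _).trans (le_trans ?_
        (mul_le_mul_of_nonneg_right (sum_erase_abs_le γ i) (by positivity)))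
      rw [Finset.sum_mul]
      refine Finset.sum_le_sum fun j hj => ?_
      rw [norm_smul, Real.norm_eq_abs, norm_biotSavart]
      have := hsep t ht i j (Finset.ne_of_mem_erase hj).symm
      gcongr
    have h2 := norm_sub_norm_le (xb' t i)
      (∑ j ∈ Finset.univ.erase i, γ j • biotSavart (xb t i - xb t j))
    linarith [hW t ht i, show ‖w t i‖ = ‖xb' t i
      - ∑ j ∈ Finset.univ.erase i, γ j • biotSavart (xb t i - xb t j)‖ from rfl]
  -- A lower bound of `‖u‖`, obtained from the large speeds. It gives the contraction factor `12 /
  -- (25 * N) ≤ 1 / 2` and offsets of length at most `1 / Ω ≤ d / 2`, for which the cut-off is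
  -- inactive.
  set Ω : ℝ := 5 * N / d with hΩ
  have hΩ0 : 0 < Ω := by positivity
  have hun : ∀ t ∈ Icc 0 T, ∀ a i, Ω ≤ ‖u t a i‖ := by
    intro t ht a i
    have h1 := norm_sub_norm_le ((N / γc : ℝ) • w t i) (q t a i)
    rw [norm_smul, Real.norm_eq_abs, abs_div, abs_of_pos hN] at h1
    have h2 : N / |γc| * (|γc| * (d / 2)⁻¹ + |γc| * (5 / d)) ≤ N / |γc| * ‖w t i‖ := by
      gcongr; exact hwn t ht i
    have h3 : N / |γc| * (|γc| * (d / 2)⁻¹ + |γc| * (5 / d)) = N * (d / 2)⁻¹ + Ω := by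
      rw [hΩ]; field_simp
    linarith [hqn t a i, show ‖u t a i‖ = ‖(N / γc : ℝ) • w t i - q t a i‖ from rfl]
  have hKu : ∀ t ∈ Icc 0 T, ∀ t' ∈ Icc 0 T, ∀ a a' i, ‖biotSavart (u t a i)
      - biotSavart (u t' a' i)‖ ≤ ‖u t a i - u t' a' i‖ / Ω ^ 2 := fun t ht t' ht' a a' i =>
    norm_biotSavart_sub_le hΩ0 (hun t ht a i) (hun t' ht' a' i)
  let Φ : ℝ → (Fin N → Plane) → Fin N → Plane := fun t a i => biotSavart (u t a i)
  have hcontr : ∀ t ∈ Icc 0 T, ∀ a a', ‖Φ t a - Φ t a'‖ ≤ 1 / 2 * ‖a - a'‖ := by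
    intro t ht a a'
    refine (pi_norm_le_iff_of_nonneg (by positivity)).2 fun i => ?_
    have h1 : u t a i - u t a' i = ∑ k ∈ Finset.univ.erase i,
        (cutKernel (d / 2) (xb t i - xb t k - a' k)
          - cutKernel (d / 2) (xb t i - xb t k - a k)) := by
      simp only [u, q, Finset.sum_sub_distrib]; abel
    have h2 : ‖u t a i - u t a' i‖ ≤ N * (3 / (d / 2) ^ 2 * ‖a - a'‖) := by
      rw [h1]
      refine (norm_sum_le_of_le _ fun k _ => (norm_cutKernel_sub_le hd2 _ _).trans
        (mul_le_mul_of_nonneg_left (?_ : _ ≤ ‖a - a'‖) (by positivity))).trans ?_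
      · rw [sub_sub_sub_cancel_left]; exact norm_le_pi_norm (a - a') k
      · rw [Finset.sum_const, nsmul_eq_mul]
        exact mul_le_mul_of_nonneg_right (hcard i) (by positivity)
    refine (hKu t ht t ht a a' i).trans ?_
    rw [div_le_iff₀ (by positivity)]
    refine h2.trans ?_
    have h3 : N * (3 / (d / 2) ^ 2 * ‖a - a'‖) = 12 * N / d ^ 2 * ‖a - a'‖ := by
      field_simp; ring
    have h4 : 1 / 2 * ‖a - a'‖ * Ω ^ 2 = 25 * N ^ 2 / 2 / d ^ 2 * ‖a - a'‖ := by
      rw [hΩ]; field_simp; ring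
    rw [h3, h4]
    gcongr
    nlinarith
  have hfix : ∀ t, ∃ a, t ∈ Icc 0 T → Φ t a = a := by
    intro t
    by_cases ht : t ∈ Icc 0 T
    · have hc : ContractingWith (1 / 2) (Φ t) := by
        refine ⟨NNReal.half_lt_self one_ne_zero,
          LipschitzWith.of_dist_le_mul fun a a' => ?_⟩
        rw [dist_eq_norm, dist_eq_norm]
        simpa using hcontr t ht a a'
      exact ⟨hc.fixedPoint, fun _ => hc.fixedPoint_isFixedPt⟩
    · exact ⟨0, fun h => absurd h ht⟩
  choose a ha using hfix
  set Λ : ℝ := N / |γc| * (K₂ + (∑ j, |γ j|) * (2 * K₁ / d ^ 2))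
    + N * (3 / (d / 2) ^ 2 * (2 * K₁)) with hΛ
  have hΛ0 : 0 ≤ Λ := by positivity
  have hdiff : ∀ s ∈ Icc 0 T, ∀ t ∈ Icc 0 T, ∀ i j,
      ‖(xb s i - xb s j) - (xb t i - xb t j)‖ ≤ 2 * K₁ * |s - t| := by
    intro s hs t ht i j
    rw [sub_sub_sub_comm]
    linarith [norm_sub_le (xb s i - xb t i) (xb s j - xb t j), hx₁ i s hs t ht, hx₁ j s hs t ht]
  have hut : ∀ s ∈ Icc 0 T, ∀ t ∈ Icc 0 T, ∀ a i, ‖u s a i - u t a i‖ ≤ Λ * |s - t| := by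
    intro s hs t ht a i
    have h1 : u s a i - u t a i = (N / γc : ℝ) • ((xb' s i - xb' t i)
        - ∑ j ∈ Finset.univ.erase i, γ j • (biotSavart (xb s i - xb s j)
          - biotSavart (xb t i - xb t j)))
        - ∑ k ∈ Finset.univ.erase i, (cutKernel (d / 2) (xb s i - xb s k - a k)
          - cutKernel (d / 2) (xb t i - xb t k - a k)) := by
      simp only [u, q, w, Finset.sum_sub_distrib, smul_sub]; abel
    have h2 : ‖∑ k ∈ Finset.univ.erase i, (cutKernel (d / 2) (xb s i - xb s k - a k)
          - cutKernel (d / 2) (xb t i - xb t k - a k))‖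
        ≤ N * (3 / (d / 2) ^ 2 * (2 * K₁ * |s - t|)) := by
      refine (norm_sum_le_of_le _ fun k _ => (norm_cutKernel_sub_le hd2 _ _).trans
        (mul_le_mul_of_nonneg_left (?_ : _ ≤ 2 * K₁ * |s - t|) (by positivity))).trans ?_
      · rw [sub_sub_sub_cancel_right]; exact hdiff s hs t ht i k
      · rw [Finset.sum_const, nsmul_eq_mul]
        exact mul_le_mul_of_nonneg_right (hcard i) (by positivity)
    have h3 : ‖∑ j ∈ Finset.univ.erase i, γ j • (biotSavart (xb s i - xb s j)
          - biotSavart (xb t i - xb t j))‖ ≤ (∑ j, |γ j|) * (2 * K₁ * |s - t| / d ^ 2) := by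
      refine (norm_sum_le _ _).trans (le_trans ?_
        (mul_le_mul_of_nonneg_right (sum_erase_abs_le γ i) (by positivity)))
      rw [Finset.sum_mul]
      refine Finset.sum_le_sum fun j hj => ?_
      have hij := (Finset.ne_of_mem_erase hj).symm
      rw [norm_smul, Real.norm_eq_abs]
      refine mul_le_mul_of_nonneg_left ((norm_biotSavart_sub_le hd (hsep s hs i j hij)
        (hsep t ht i j hij)).trans ?_) (abs_nonneg _)
      gcongr
      exact hdiff s hs t ht i j
    rw [h1]
    refine (norm_sub_le _ _).trans ?_
    rw [norm_smul, Real.norm_eq_abs, abs_div, abs_of_pos hN]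
    calc _ ≤ N / |γc| * (K₂ * |s - t| + (∑ j, |γ j|) * (2 * K₁ * |s - t| / d ^ 2))
          + N * (3 / (d / 2) ^ 2 * (2 * K₁ * |s - t|)) := by
          refine add_le_add (mul_le_mul_of_nonneg_left ((norm_sub_le _ _).trans
            (add_le_add (hx₂ i s hs t ht) h3)) (by positivity)) h2
      _ = Λ * |s - t| := by rw [hΛ]; ring
  -- The contraction bounds `‖a s - a t‖` by half of itself plus the variation in time of the map at
  -- a fixed argument; absorbing the half doubles the constant.
  have hat : ∀ s ∈ Icc 0 T, ∀ t ∈ Icc 0 T, ‖a s - a t‖ ≤ 2 * (Λ / Ω ^ 2) * |s - t| := by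
    intro s hs t ht
    have h1 : a s - a t = (Φ s (a s) - Φ s (a t)) + (Φ s (a t) - Φ t (a t)) := by
      rw [ha s hs, ha t ht]; abel
    have h2 : ‖Φ s (a t) - Φ t (a t)‖ ≤ Λ / Ω ^ 2 * |s - t| := by
      refine (pi_norm_le_iff_of_nonneg (by positivity)).2 fun i => ?_
      refine (hKu s hs t ht (a t) (a t) i).trans ?_
      rw [div_mul_eq_mul_div]
      gcongr
      exact hut s hs t ht (a t) i
    have h3 : ‖a s - a t‖ ≤ ‖Φ s (a s) - Φ s (a t)‖ + ‖Φ s (a t) - Φ t (a t)‖ := by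
      conv_lhs => rw [h1]
      exact norm_add_le _ _
    linarith [hcontr s hs (a s) (a t)]
  have hai : ∀ t ∈ Icc 0 T, ∀ i, a t i = biotSavart (u t (a t) i) := fun t ht i =>
    (congrFun (ha t ht) i).symm
  have han : ∀ t ∈ Icc 0 T, ∀ i, ‖a t i‖ ≤ d / 2 := by
    intro t ht i
    rw [hai t ht i, norm_biotSavart]
    refine (inv_anti₀ hΩ0 (hun t ht (a t) i)).trans ?_
    rw [hΩ, inv_div, div_le_div_iff₀ (by positivity) two_pos]
    nlinarith
  have hfar : ∀ t ∈ Icc 0 T, ∀ i k, i ≠ k → d / 2 ≤ ‖xb t i - xb t k - a t k‖ := by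
    intro t ht i k hik
    linarith [hsep t ht i k hik, han t ht k, norm_sub_norm_le (xb t i - xb t k) (a t k)]
  have hself : ∀ (t : ℝ) i, xb t i - (xb t i + a t i) = -a t i := fun t i => by abel
  have hother : ∀ (t : ℝ) i k, xb t i - (xb t k + a t k) = xb t i - xb t k - a t k :=
    fun t i k => by abel
  refine ⟨fun k t => xb t k + a t k, K₁ + 2 * (Λ / Ω ^ 2), fun k s hs t ht => ?_,
    ⟨rfl, fun t ht i j hij => ?_, fun t ht i k => ?_, fun t ht i => ?_⟩⟩
  · rw [add_sub_add_comm, add_mul]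
    exact (norm_add_le _ _).trans (add_le_add (hx₁ k s hs t ht)
      ((norm_le_pi_norm (a s - a t) k).trans (hat s hs t ht)))
  · exact sub_ne_zero.1 (norm_pos_iff.1 (hd.trans_le (hsep t ht i j hij)))
  · rw [← sub_ne_zero]
    rcases eq_or_ne i k with rfl | hik
    · rw [hself, neg_ne_zero, hai t ht i, ← norm_pos_iff, norm_biotSavart]
      exact inv_pos.2 (hΩ0.trans_le (hun t ht (a t) i))
    · rw [hother]
      exact norm_pos_iff.1 (hd2.trans_le (hfar t ht i k hik))
  · have h1 : ∑ k, (γc / N) • biotSavart (xb t i - (xb t k + a t k)) = w t i := by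
      rw [← Finset.add_sum_erase _ _ (Finset.mem_univ i), hself]
      have h2 : biotSavart (-a t i) = u t (a t) i := by
        rw [hai t ht i, biotSavart_neg, biotSavart_biotSavart, neg_neg]
      have h3 : ∑ k ∈ Finset.univ.erase i, (γc / N) • biotSavart (xb t i - (xb t k + a t k))
          = (γc / N) • q t (a t) i := by
        rw [Finset.smul_sum]
        refine Finset.sum_congr rfl fun k hk => ?_
        rw [hother, cutKernel_eq (hfar t ht i k (Finset.ne_of_mem_erase hk).symm)]
      rw [h2, h3, ← smul_add]
      simp only [u]
      rw [sub_add_cancel, smul_smul]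
      have : γc / N * (N / γc) = 1 := by field_simp
      rw [this, one_smul]
    rw [h1]
    simp only [w]
    rw [add_sub_cancel]
    exact (hxd t i).hasDerivWithinAt

/-! ### Controls with prescribed end points -/

/-- Uniform approximation by a smooth curve with the same end points. -/
theorem exists_contDiff_near {f : ℝ → Plane} {T β : ℝ} (hT : 0 < T) (hf : Continuous f)
    (hβ : 0 < β) : ∃ g : ℝ → Plane, ContDiff ℝ ∞ g ∧ g 0 = f 0 ∧ g T = f T ∧
      ∀ t ∈ Icc 0 T, ‖g t - f t‖ ≤ β := by
  obtain ⟨g, hg, hgf, -⟩ := hf.exists_contDiff_approx (ε := fun _ => β / 2) ⊤ continuous_const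
    fun _ => by positivity
  have hle : ∀ t, ‖g t - f t‖ ≤ β / 2 := fun t => by rw [← dist_eq_norm]; exact (hgf t).le
  -- The end point errors are removed by subtracting their affine interpolation, which costs at most
  -- another `β / 2`.
  refine ⟨fun t => g t - ((1 - t / T) • (g 0 - f 0) + (t / T) • (g T - f T)), ?_, ?_, ?_,
    fun t ht => ?_⟩
  · exact hg.sub (by fun_prop)
  · simp
  · simp [hT.ne']
  · have h0 : 0 ≤ t / T := div_nonneg ht.1 hT.le
    have h1 : 0 ≤ 1 - t / T := sub_nonneg.2 ((div_le_one hT).2 ht.2)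
    have h2 : ‖(1 - t / T) • (g 0 - f 0) + (t / T) • (g T - f T)‖ ≤ β / 2 := by
      refine (norm_add_le _ _).trans ?_
      rw [norm_smul, norm_smul, Real.norm_of_nonneg h0, Real.norm_of_nonneg h1]
      calc _ ≤ (1 - t / T) * (β / 2) + t / T * (β / 2) := by
            gcongr
            · exact hle 0
            · exact hle T
        _ = β / 2 := by ring
    rw [sub_right_comm]
    linarith [norm_sub_le (g t - f t) ((1 - t / T) • (g 0 - f 0) + (t / T) • (g T - f T)), hle t]

section

variable {N : ℕ} {T r M B : ℝ} {y : Fin N → ℝ → Plane} {xb : ℝ → Fin N → Plane}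
  {γ : Fin N → ℝ} {γc : ℝ}

theorem vortexField_sub (x : Fin N → Plane) (z z' : Plane) (i : Fin N) :
    vortexField γ γc z x i - vortexField γ γc z' x i
      = γc • (biotSavart (x i - z) - biotSavart (x i - z')) := by
  simp only [vortexField]; module

theorem norm_vortexField_sub_le {ρ : ℝ} (hρ : 0 < ρ) {x : Fin N → Plane} {z z' : Plane} {i : Fin N}
    (h : ρ ≤ ‖x i - z‖) (h' : ρ ≤ ‖x i - z'‖) :
    ‖vortexField γ γc z x i - vortexField γ γc z' x i‖ ≤ |γc| * (‖z - z'‖ / ρ ^ 2) := by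
  rw [vortexField_sub, norm_smul, Real.norm_eq_abs]
  refine mul_le_mul_of_nonneg_left ((norm_biotSavart_sub_le hρ h h').trans ?_) (abs_nonneg _)
  rw [sub_sub_sub_cancel_left, norm_sub_rev]

theorem norm_vortexField_sub_le_const {ρ : ℝ} (hρ : 0 < ρ) {x : Fin N → Plane} {z z' : Plane}
    {i : Fin N} (h : ρ ≤ ‖x i - z‖) (h' : ρ ≤ ‖x i - z'‖) :
    ‖vortexField γ γc z x i - vortexField γ γc z' x i‖ ≤ |γc| * (2 * ρ⁻¹) := by
  rw [vortexField_sub, norm_smul, Real.norm_eq_abs]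
  refine mul_le_mul_of_nonneg_left ((norm_sub_le _ _).trans ?_) (abs_nonneg _)
  rw [norm_biotSavart, norm_biotSavart, two_mul]
  gcongr

namespace IsSeparatedReference

theorem continuousOn_vortexField (h : IsSeparatedReference T r M B y xb) {z : ℝ → Plane}
    (hz : ContinuousOn z (Icc 0 T)) (hzd : ∀ t ∈ Icc 0 T, ∀ j, r ≤ ‖xb t j - z t‖) (i : Fin N) :
    ContinuousOn (fun t => vortexField γ γc (z t) (xb t) i) (Icc 0 T) := by
  have hne : ∀ w : Plane, r ≤ ‖w‖ → w ≠ 0 := fun w hw => norm_pos_iff.1 (h.radius_pos.trans_le hw)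
  refine ContinuousOn.add (continuousOn_finsetSum _ fun j hj => ?_) ?_
  · have hij := (Finset.ne_of_mem_erase hj).symm
    have h1 := (h.continuousOn_vortex i).sub (h.continuousOn_vortex j)
    have h2 := ContinuousOn.biotSavart h1 fun t ht =>
      hne _ (by linarith [h.vortex_dist t ht i j hij, h.radius_pos] : r ≤ ‖xb t i - xb t j‖)
    exact h2.fun_const_smul (γ j)
  · have h1 := (h.continuousOn_vortex i).sub hz
    exact (ContinuousOn.biotSavart h1 fun t ht => hne _ (hzd t ht i)).fun_const_smul γc

/-- The end points of a control can be changed without coming near the vortices. -/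
theorem exists_glued_control (h : IsSeparatedReference T r M B y xb) {z : ℝ → Plane}
    (hz : Continuous z) (hzd : ∀ t ∈ Icc 0 T, ∀ j, 11 * r / 8 ≤ ‖z t - xb t j‖) {p q : Plane}
    (hp : ∀ j, 2 * r ≤ ‖p - xb 0 j‖) (hq : ∀ j, 2 * r ≤ ‖q - xb T j‖) {τ : ℝ} (hτ : 0 < τ)
    (hτT : 2 * τ < T) (hBτ : B * τ ≤ r / 8) :
    ∃ w : ℝ → Plane, Continuous w ∧ w 0 = p ∧ w T = q ∧ (∀ t ∈ Icc τ (T - τ), w t = z t) ∧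
      ∀ t ∈ Icc 0 T, ∀ j, 9 * r / 8 ≤ ‖w t - xb t j‖ := by
  have hr := h.radius_pos
  have hT := h.time_pos
  -- Discs are frozen at the end times, and vortices move by at most `r / 8` within `τ`. The radius
  -- is thus the distance `11 * r / 8` less one such motion, and one more leaves `9 * r / 8`.
  set R : ℝ := 5 * r / 4 with hR
  have hR0 : 0 < R := by positivity
  have m0 : (0 : ℝ) ∈ Icc 0 T := ⟨le_rfl, hT.le⟩
  have mT : T ∈ Icc 0 T := ⟨hT.le, le_rfl⟩
  have hsep : ∀ t ∈ Icc 0 T, ∀ i j, i ≠ j → 2 * R ≤ ‖xb t i - xb t j‖ := fun t ht i j hij => by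
    linarith [h.vortex_dist t ht i j hij]
  have hmove : ∀ {s t : ℝ} {j : Fin N} {v : Plane} {c : ℝ}, s ∈ Icc 0 T → t ∈ Icc 0 T →
      |s - t| ≤ τ → c ≤ ‖v - xb s j‖ → c - r / 8 ≤ ‖v - xb t j‖ := by
    intro s t j v c hs ht hst hc
    have h1 := h.vortex_lip j s hs t ht
    have h2 := mul_le_mul_of_nonneg_left hst h.speed_nonneg
    rw [norm_sub_rev] at h1
    rw [← sub_add_sub_cancel _ (xb t j)] at hc
    linarith [norm_add_le (v - xb t j) (xb t j - xb s j)]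
  have hp' : ∀ j, R ≤ ‖p - xb 0 j‖ := fun j => by linarith [hp j]
  have hq' : ∀ j, R ≤ ‖q - xb T j‖ := fun j => by linarith [hq j]
  have mτ : τ ∈ Icc 0 T := ⟨hτ.le, by linarith⟩
  have mτ' : T - τ ∈ Icc 0 T := ⟨by linarith, by linarith⟩
  have hzl : ∀ j, R ≤ ‖z τ - xb 0 j‖ := fun j => by
    linarith [hmove mτ m0 (by rw [sub_zero, abs_of_pos hτ]) (hzd τ mτ j)]
  have hzr : ∀ j, R ≤ ‖z (T - τ) - xb T j‖ := fun j => by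
    linarith [hmove mτ' mT (by rw [sub_sub_cancel_left, abs_neg, abs_of_pos hτ])
      (hzd (T - τ) mτ' j)]
  let w₁ : ℝ → Plane := fun t => detourPath p (z τ) (xb 0) R (t / τ)
  let w₃ : ℝ → Plane := fun t => detourPath (z (T - τ)) q (xb T) R ((t - (T - τ)) / τ)
  have c₁ : Continuous w₁ := (continuous_detourPath hR0 (hsep 0 m0)).comp (by fun_prop)
  have c₃ : Continuous w₃ := (continuous_detourPath hR0 (hsep T mT)).comp (by fun_prop)
  have e₁ : w₁ τ = z τ := by simp only [w₁]; rw [div_self hτ.ne', detourPath_one hzl]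
  have e₃ : w₃ (T - τ) = z (T - τ) := by
    simp only [w₃]; rw [sub_self, zero_div, detourPath_zero hzr]
  refine ⟨fun t => if t ≤ τ then w₁ t else if t ≤ T - τ then z t else w₃ t, ?_, ?_, ?_,
    fun t ht => ?_, fun t ht j => ?_⟩
  · refine c₁.if_le (hz.if_le c₃ continuous_id continuous_const fun t ht => ?_) continuous_id
      continuous_const fun t ht => ?_
    · rw [ht, e₃]
    · rw [ht, if_pos (by linarith), e₁]
  · simp only [if_pos hτ.le, w₁, zero_div]
    exact detourPath_zero hp'
  · simp only [if_neg (not_le.2 (by linarith : τ < T)), if_neg (not_le.2 (by linarith : T - τ < T)),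
      w₃, sub_sub_cancel, div_self hτ.ne']
    exact detourPath_one hq'
  · rcases ht.1.eq_or_lt with rfl | hlt
    · simp only [if_pos le_rfl, e₁]
    · simp only [if_neg (not_le.2 hlt), if_pos ht.2]
  · by_cases h1 : t ≤ τ
    · simp only [if_pos h1]
      have := hmove m0 ht (by rw [zero_sub, abs_neg, abs_of_nonneg ht.1]; exact h1)
        (le_norm_detourPath_sub (q := z τ) hR0 (hsep 0 m0) hp' (t / τ) j)
      simp only [w₁]
      linarith
    by_cases h2 : t ≤ T - τ
    · simp only [if_neg h1, if_pos h2]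
      linarith [hzd t ht j]
    · simp only [if_neg h1, if_neg h2]
      have := hmove mT ht (by rw [abs_of_nonneg (by linarith [ht.2])]; linarith)
        (le_norm_detourPath_sub (q := q) hR0 (hsep T mT) hzr ((t - (T - τ)) / τ) j)
      simp only [w₃]
      linarith

/-- The integrated effect of the oscillating controls tends to that of the reference controls. -/
theorem norm_integral_oscControl_le [NeZero N] (h : IsSeparatedReference T r M B y xb) {n : ℕ}
    (hn : 2 ≤ n) (hB : B * (T / n) ≤ r / 8) : ∀ t ∈ Icc 0 T, ∀ i,
      ‖∫ u in (0 : ℝ)..t, (referenceField γ γc (fun k => y k u) (xb u) i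
        - vortexField γ γc (oscControl T r y xb n u) (xb u) i)‖
        ≤ |γc| * (T * (7 * r⁻¹ + 3 * ((B + M) * T / r ^ 2))) / n := by
  have hr := h.radius_pos
  have hn0 : (0 : ℝ) < n := by positivity
  have hM := h.lip_nonneg
  have hB0 := h.speed_nonneg
  intro t ht i
  -- The controls are only Lipschitz here, so the slope is taken to be `0` and the error is of first
  -- order in `T / n`. Its constant depends on `M`, which is harmless for a qualitative limit.
  refine (h.norm_integral_discrepancy_le (n := n) (h.continuous_oscControl hn hB).continuousOn
    (fun t ht j => ?_) (by omega) le_rfl (fun m hm t ht htT => ?_)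
    (E := (B + M) * (T / n) / r ^ 2) (fun i k a ha => ⟨0, fun s hs has hsa => ?_⟩) t ht i).trans_eq
    ?_
  · rw [norm_sub_rev]; linarith [h.le_norm_oscControl_sub hn hB ht j]
  · obtain ⟨h0, h1, -, -⟩ := h.length_pos hn rfl rfl
    have hhalf : T / (n * N) / n = 2 * (T / (n * N) / (2 * n)) := by field_simp
    rw [hhalf] at ht
    rw [h.oscControl_eq_cyc hn hB rfl rfl hm ⟨by linarith [ht.1], by linarith [ht.2]⟩
      (Or.inr (by linarith [ht.1])) (Or.inr (by linarith [ht.2]))]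
    simp
  · rw [smul_zero, sub_zero]
    refine (norm_biotSavart_sub_le hr (by linarith [h.le_norm_vortex_sub hs i k])
      (by linarith [h.le_norm_vortex_sub ha i k])).trans ?_
    gcongr
    rw [sub_sub_sub_comm]
    refine (norm_sub_le _ _).trans ((add_le_add (h.vortex_lip i s hs a ha)
      (h.control_lip k s hs a ha)).trans ?_)
    rw [← add_mul]
    gcongr
    rw [abs_of_nonneg (by linarith)]; linarith
  · field_simp; ring

/-- Smooth controls with given end points and nearly the same integrated effect as the
reference controls. -/
theorem exists_smooth_control [NeZero N] (h : IsSeparatedReference T r M B y xb)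
    (γ : Fin N → ℝ) (γc : ℝ) {p q : Plane}
    (hp : ∀ j, 2 * r ≤ ‖p - xb 0 j‖) (hq : ∀ j, 2 * r ≤ ‖q - xb T j‖) {η : ℝ} (hη : 0 < η) :
    ∃ z : ℝ → Plane, ContDiff ℝ ∞ z ∧ z 0 = p ∧ z T = q ∧
      (∀ t ∈ Icc 0 T, ∀ j, r ≤ ‖xb t j - z t‖) ∧
      ∀ t ∈ Icc 0 T, ∀ i, ‖∫ u in (0 : ℝ)..t, (referenceField γ γc (fun k => y k u) (xb u) i
        - vortexField γ γc (z u) (xb u) i)‖ ≤ η := by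
  have hr := h.radius_pos
  have hT := h.time_pos
  have hB0 := h.speed_nonneg
  -- A third of `η` is allotted to each of three errors: oscillation (by the choice of `n`),
  -- modified end points (`τ`), and smoothing (`β`).
  set A : ℝ := |γc| * (T * (7 * r⁻¹ + 3 * ((B + M) * T / r ^ 2))) with hA
  obtain ⟨n, hn, hbig⟩ := exists_nat_forall_ge (8 * B * T / r) (3 * A / η) 0 0 0 0
  obtain ⟨b1, b2, -⟩ := hbig n le_rfl
  have hn0 : (0 : ℝ) < n := by positivity
  have hBn : B * (T / n) ≤ r / 8 := by
    rw [div_le_iff₀ hr] at b1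
    rw [mul_div_assoc', div_le_iff₀ hn0]; linarith
  have hz := h.continuous_oscControl hn hBn
  have hosc := h.norm_integral_oscControl_le (γ := γ) (γc := γc) hn hBn
  rw [div_le_iff₀ hη] at b2
  set z₀ := oscControl T r y xb n with hz₀
  obtain ⟨τ, hτ, hτle⟩ := exists_pos_le_of_finite
    ![T / 3, r / (8 * (B + 1)), η / (12 * (|γc| * r⁻¹ + 1))] (fun i => by
      fin_cases i <;> simp <;> positivity)
  have t1 : τ ≤ T / 3 := hτle 0
  have t2 : τ ≤ r / (8 * (B + 1)) := hτle 1
  have t3 : τ ≤ η / (12 * (|γc| * r⁻¹ + 1)) := hτle 2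
  rw [le_div_iff₀ (by positivity)] at t2 t3
  obtain ⟨w, hw, hw0, hwT, hwz, hwd⟩ := h.exists_glued_control hz
    (fun t ht j => h.le_norm_oscControl_sub hn hBn ht j) hp hq hτ (by linarith) (by nlinarith)
  obtain ⟨β, hβ, hβle⟩ := exists_pos_le_of_finite
    ![r / 8, η * r ^ 2 / (3 * T * (|γc| + 1))] (fun i => by
      fin_cases i <;> simp <;> positivity)
  have s1 : β ≤ r / 8 := hβle 0
  have s2 : β ≤ η * r ^ 2 / (3 * T * (|γc| + 1)) := hβle 1
  rw [le_div_iff₀ (by positivity)] at s2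
  obtain ⟨z, hzs, hz0, hzT, hzw⟩ := exists_contDiff_near hT hw hβ
  have hzd : ∀ t ∈ Icc 0 T, ∀ j, r ≤ ‖xb t j - z t‖ := by
    intro t ht j
    have h1 := hwd t ht j
    have h2 := hzw t ht
    rw [norm_sub_rev] at h2 ⊢
    rw [← sub_add_sub_cancel _ (z t)] at h1
    linarith [norm_add_le (w t - z t) (z t - xb t j)]
  have hzd₀ : ∀ t ∈ Icc 0 T, ∀ j, r ≤ ‖xb t j - z₀ t‖ := fun t ht j => by
    rw [norm_sub_rev]; linarith [h.le_norm_oscControl_sub hn hBn ht j]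
  refine ⟨z, hzs, hz0.trans hw0, hzT.trans hwT, hzd, fun t ht i => ?_⟩
  have hsub : Icc 0 t ⊆ Icc 0 T := Icc_subset_Icc_right ht.2
  have cR := (h.continuousOn_referenceField (γ := γ) (γc := γc) i).mono hsub
  have c0 := (h.continuousOn_vortexField (γ := γ) (γc := γc) hz.continuousOn hzd₀ i).mono hsub
  have c1 := (h.continuousOn_vortexField (γ := γ) (γc := γc)
    hzs.continuous.continuousOn hzd i).mono hsub
  have hcore : ‖∫ u in (0 : ℝ)..t, (vortexField γ γc (z₀ u) (xb u) i
      - vortexField γ γc (z u) (xb u) i)‖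
      ≤ t * (|γc| * (β / r ^ 2)) + 2 * τ * (|γc| * (2 * r⁻¹)) := by
    have := norm_integral_le_of_core (a := 0) (δ := t) (θ := τ) (e := |γc| * (β / r ^ 2))
      (C := |γc| * (2 * r⁻¹))
      (G := fun u => vortexField γ γc (z₀ u) (xb u) i - vortexField γ γc (z u) (xb u) i)
      hτ.le ht.1 (by positivity) (by rw [zero_add]; exact c0.sub c1)
      (fun u hu => by
        rw [zero_add] at hu
        exact norm_vortexField_sub_le_const hr (hzd₀ u (hsub hu) i) (hzd u (hsub hu) i))
      (fun u hu => by
        rw [zero_add, zero_add] at hu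
        have hu' : u ∈ Icc 0 T := ⟨by linarith [hu.1], by linarith [hu.2, ht.2]⟩
        refine (norm_vortexField_sub_le hr (hzd₀ u hu' i) (hzd u hu' i)).trans ?_
        gcongr
        rw [← hwz u ⟨hu.1, by linarith [hu.2, ht.2]⟩, norm_sub_rev]
        exact hzw u hu')
    rwa [zero_add] at this
  have hsplit : ∫ u in (0 : ℝ)..t, (referenceField γ γc (fun k => y k u) (xb u) i
        - vortexField γ γc (z u) (xb u) i)
      = (∫ u in (0 : ℝ)..t, (referenceField γ γc (fun k => y k u) (xb u) i
        - vortexField γ γc (z₀ u) (xb u) i))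
      + ∫ u in (0 : ℝ)..t, (vortexField γ γc (z₀ u) (xb u) i
        - vortexField γ γc (z u) (xb u) i) := by
    rw [← intervalIntegral.integral_add]
    · simp only [sub_add_sub_cancel]
    · exact (cR.sub c0).intervalIntegrable_of_Icc ht.1
    · exact (c0.sub c1).intervalIntegrable_of_Icc ht.1
  rw [hsplit]
  refine (norm_add_le _ _).trans ((add_le_add (hosc t ht i) hcore).trans ?_)
  have k1 : A / n ≤ η / 3 := by rw [div_le_iff₀ hn0]; linarith
  have k2 : t * (|γc| * (β / r ^ 2)) ≤ η / 3 := by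
    calc t * (|γc| * (β / r ^ 2)) ≤ T * ((|γc| + 1) * (β / r ^ 2)) := by
          gcongr
          · exact ht.2
          · linarith
      _ = β * (3 * T * (|γc| + 1)) / r ^ 2 / 3 := by ring
      _ ≤ η * r ^ 2 / r ^ 2 / 3 := by gcongr
      _ = η / 3 := by field_simp
  have k3 : 2 * τ * (|γc| * (2 * r⁻¹)) ≤ η / 3 := by
    have : 2 * τ * (|γc| * (2 * r⁻¹)) = (τ * (12 * (|γc| * r⁻¹ + 1)) - 12 * τ) / 3 := by ring
    rw [this]; gcongr; linarith
  linarith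

end IsSeparatedReference

end

/-- The system with a single control vortex is approximately controllable. -/
theorem approximatelyControllable {N : ℕ} [NeZero N] (γ : Fin N → ℝ) {γc : ℝ} (hγc : γc ≠ 0) :
    ApproximatelyControllable γ γc := by
  intro T hT x₀ xf p q h₀ hp hf hq ε hε
  obtain ⟨d, hd, hfast⟩ := exists_fast_trajectory hT h₀ hf
  obtain ⟨xb, xb', hx0, hxT, hxd, hxc, hxc', hsep, hW⟩ := hfast
    ((∑ j, |γ j|) * d⁻¹ + |γc| * (d / 2)⁻¹ + |γc| * (5 / d))
  obtain ⟨y, K, hyK, hx⟩ := exists_reference_controls hγc hd hxd hxc hxc' hsep hW le_rfl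
  have hyc : ∀ k, ContinuousOn (y k) (Icc 0 T) := fun k => continuousOn_of_norm_sub_le (hyK k)
  obtain ⟨L, -, hL⟩ := exists_norm_bound hyc
  have hpair : ∀ a : Fin N × Fin N, ∃ ρ : ℝ, 0 < ρ ∧ ∀ t ∈ Icc 0 T,
      ρ ≤ ‖y a.1 t - xb t a.2‖ := fun a =>
    exists_pos_le_norm_sub hT.le (hyc a.1) (hxc a.2).continuous.continuousOn
      fun t ht => (hx.control_ne t ht a.2 a.1).symm
  choose f hf0 hfle using hpair
  obtain ⟨ρ₁, hρ₁, hρ₁'⟩ := exists_pos_le_of_finite f hf0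
  obtain ⟨ρ₂, hρ₂, hρ₂'⟩ := exists_pos_le_of_finite (fun i => ‖p - x₀ i‖)
    fun i => norm_pos_iff.2 (sub_ne_zero.2 (hp i).symm)
  obtain ⟨ρ₃, hρ₃, hρ₃'⟩ := exists_pos_le_of_finite (fun i => ‖q - xf i‖)
    fun i => norm_pos_iff.2 (sub_ne_zero.2 (hq i).symm)
  -- The radius accounts for the distances of the controls and of the prescribed end points of the
  -- control from the vortices, needed to be `2 * r`, and for the mutual distances `4 * r`.
  obtain ⟨r, hr, hrle⟩ := exists_pos_le_of_finite ![ρ₁ / 2, ρ₂ / 2, ρ₃ / 2, d / 4] (fun i => by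
    fin_cases i <;> simp <;> positivity)
  have r1 : r ≤ ρ₁ / 2 := hrle 0
  have r2 : r ≤ ρ₂ / 2 := hrle 1
  have r3 : r ≤ ρ₃ / 2 := hrle 2
  have r4 : r ≤ d / 4 := hrle 3
  have h : IsSeparatedReference T r (max K L) (speedBound r γ γc) y xb := by
    refine isSeparatedReference_of_lip hT hr hx (fun k s hs t ht => (hyK k s hs t ht).trans ?_)
      (fun k t ht => (hL k t ht).trans (le_max_right _ _)) (fun t ht j k => ?_)
      (fun t ht i j hij => by linarith [hsep t ht i j hij])
    · gcongr; exact le_max_left _ _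
    · linarith [hρ₁' (k, j), hfle (k, j) t ht]
  have hN : (0 : ℝ) < N := by exact_mod_cast NeZero.pos N
  set ex := Real.exp (fieldLip (r / 2) γ γc * T) with hex
  have hex0 : 0 < ex := Real.exp_pos _
  -- The factor `√N` is lost in passing from a bound for each vortex to `configDist`. The other
  -- bound keeps the solution within the margin left by the cut-off radius `r / 2`.
  set s : ℝ := min (r / 4) (ε / √N) with hs
  have hs0 : 0 < s := by positivity
  obtain ⟨z, hz, hz0, hzT, hzd, hint⟩ := h.exists_smooth_control γ γc (p := p) (q := q)
    (fun j => by rw [hx0]; linarith [hρ₂' j]) (fun j => by rw [hxT]; linarith [hρ₃' j])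
    (η := s / ex) (by positivity)
  have hse : s / ex * ex = s := div_mul_cancel₀ _ hex0.ne'
  have hsr : s ≤ r / 4 := min_le_left _ _
  obtain ⟨x, hxs, hxn⟩ := exists_solution_near_reference h hx hz.continuous.continuousOn
    (ρ := r / 2) (by positivity) hs0.le (by linarith)
    (fun t ht j => by linarith [hzd t ht j]) hint hse.le
  refine ⟨z, hz.contDiffOn, hz0, hzT, x, hx0 ▸ hxs, ?_⟩
  rw [← hxT]
  refine (configDist_le hs0.le fun i =>
    (hxn T ⟨hT.le, le_rfl⟩ i).trans hse.le).trans ?_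
  calc √N * s ≤ √N * (ε / √N) := by gcongr; exact min_le_right _ _
    _ = ε := by field_simp

end

theorem theorem3 (N : ℕ) [NeZero N] (γ : Fin N → ℝ) (γc : ℝ) (hγc : γc ≠ 0) :
    (∀ T r : ℝ, 0 < T → 0 < r → ∃ C : ℝ, 0 < C ∧
      ∀ ρ : ℝ → ℝ, ContDiff ℝ ∞ ρ → HasCompactSupport ρ → (∀ s, 0 ≤ ρ s) → ∫ s, ρ s = 1 →
      ∀ M : ℝ, ∃ n₀ : ℕ, 1 ≤ n₀ ∧
        ∀ (x₀ : Fin N → Plane) (y : Fin N → ℝ → Plane) (xb : ℝ → Fin N → Plane),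
          (∀ k, ContDiffOn ℝ ∞ (y k) (Set.Icc 0 T)) →
          (∀ k, ∀ l ≤ 2, ∀ t ∈ Set.Icc 0 T,
            ‖iteratedDerivWithin l (y k) (Set.Icc 0 T) t‖ ≤ M) →
          IsReferenceSolution T γ γc y x₀ xb →
          (∀ t ∈ Set.Icc 0 T, ∀ j k, 2 * r ≤ ‖y k t - xb t j‖) →
          (∀ t ∈ Set.Icc 0 T, ∀ i j, i ≠ j → 4 * r ≤ ‖xb t i - xb t j‖) →
          ∀ n : ℕ, n₀ ≤ n →
            (∃ x, IsSingleControlSolution T γ γc (mollControl T r ρ y xb n) x₀ x) ∧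
            ∀ x, IsSingleControlSolution T γ γc (mollControl T r ρ y xb n) x₀ x →
              ∀ t ∈ Set.Icc 0 T, configDist (x t) (xb t) ≤ C / n) ∧
    ApproximatelyControllable γ γc := 
  ⟨fun _ _ hT hr => exists_mollControl_bound γ γc hT hr, approximatelyControllable γ hγc⟩
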